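/- **Input.** Let $K$ be a finite pure polygonal complex in $\mathbb R^2$: a finite set of (possibly non-convex) simple polygons, together with their edges and vertices, such that any two distinct polygons are disjoint or meet exactly in one common vertex or one common edge. Let $\mathcal C^H$ be a finite set of simple polygons (the holes), and let $O$ (the outside cell) be the closure of $\mathbb R^2\setminus(|K|\cup|\mathcal C^H|)$. Suppose that 1. $\mathbb R^2\setminus(|K|\cup|\mathcal C^H|)$ is connected; 2. the holes are pairwise disjoint and disjoint from $O$; 3. a polygon of $K$ and a hole meet only along common vertices and common edges, and have at most one common edge; 4. no two adjacent edges of a polygon of $K$ are both contained in $O$. **Mitered offsets.** For each polygon $f\in K$ let $\delta_f>0$, and let $\hat f$ be the mitered offset of $f$ at distance $\delta_f$: all edges of $f$ move inwards in parallel with unit speed for time $\delta_f$, the vertices moving along angular bisectors. Suppose that no combinatorial change occurs, i.e. at every time up to $\delta_f$ each edge of $f$ has exactly one moved copy, which is a segment of positive length with the direction of the original edge, and two different moved edges meet at most in common end points. (So no edge is shrunk to a point or subdivided.) Topological changes are allowed: at times when two or more vertices of the moving boundary come to coincide, the boundary may split there into several polygons, so that $\hat f$ may consist of several polygons, which may touch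 at vertices. **Euler transformation.** Duplicate every cell of $K\cup\mathcal C^H\cup\{O\}$: the duplicate of $f\in K$ is $\hat f$, and the duplicates of holes and of $O$ are unchanged (the edges of $O$ are the edges of $K$ contained in $O$). Vertices in duplicates of different cells are regarded as different; within the duplicate of one cell vertices are identified if they are the same point. The complex $\hat K$ consists of the polygons of * Class 1: the polygons of $\hat f$, for $f\in K$; * Class 2: for each edge $e=\{u,v\}$ of $K$, shared by $f\in K$ and another cell $f'\in K\cup\mathcal C^H\cup\{O\}$, with copies $\{\hat u,\hat v\}$ in the duplicate of $f$ and $\{\hat u',\hat v'\}$ in the duplicate of $f'$, the 4-gon with edges $\{\hat u,\hat v\},\{\hat v,\hat v'\},\{\hat u',\hat v'\},\{\hat u,\hat u'\}$; * Class 3: for each vertex $v$ of $K$, the polygon whose edges join the copies of $v$ in any two cells that share an edge at $v$ (where offset polygons have been split, several of these polygons are merged into one having all their edges). The 1-skeleton of $\hat K$ is the graph formed by the vertices and edges of these polygons. **Lemma.** Every vertex of $\hat K$ has (finite and) even degree in the 1-skeleton of $\hat K$. Furthermore, if $K$ is connected (i.e. its underlying space $|K|$ is connected), then $\hat K$ is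 connected (i.e. its 1-skeleton is a connected graph). -/

import Mathlib

open Set Filter Topology

noncomputable section

/-- The Euclidean plane. -/
abbrev Plane : Type := EuclideanSpace ℝ (Fin 2)

/-- Rotation by a quarter turn to the left. -/
def quarterTurn (x : Plane) : Plane := !₂[-x 1, x 0]

/-- A (not necessarily convex) simple polygon with `m + 3` sides. Side `i` joins `vertex i` to
`vertex (i + 1)`, indices being cyclic. -/
structure PolygonCurve where
  m : ℕ
  vertex : Fin (m + 3) → Plane
  vertex_injective : Function.Injective vertex
  /-- Two different sides meet at most in common end points. -/
  simple : ∀ i j, i ≠ j →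
    ∀ x ∈ segment ℝ (vertex i) (vertex (i + 1)) ∩ segment ℝ (vertex j) (vertex (j + 1)),
      (x = vertex i ∨ x = vertex (i + 1)) ∧ (x = vertex j ∨ x = vertex (j + 1))

namespace PolygonCurve

/-- The index type of the vertices and of the sides. -/
abbrev Idx (P : PolygonCurve) : Type := Fin (P.m + 3)

def edge (P : PolygonCurve) (i : P.Idx) : Set Plane :=
  segment ℝ (P.vertex i) (P.vertex (i + 1))

def boundary (P : PolygonCurve) : Set Plane := ⋃ i, P.edge i

/-- The points enclosed by the polygon: those lying in a bounded component of the complement of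
the boundary curve. -/
def inside (P : PolygonCurve) : Set Plane :=
  {x | x ∉ P.boundary ∧ Bornology.IsBounded (connectedComponentIn P.boundaryᶜ x)}

/-- The closed polygonal region. -/
def region (P : PolygonCurve) : Set Plane := P.boundary ∪ P.inside

/-- Direction vector of a side. -/
def dir (P : PolygonCurve) (i : P.Idx) : Plane := P.vertex (i + 1) - P.vertex i

/-- The unit normal of a side that points to its left. -/
def normal (P : PolygonCurve) (i : P.Idx) : Plane := ‖P.dir i‖⁻¹ • quarterTurn (P.dir i)

/-- The vertices are listed counterclockwise: the enclosed points lie to the left of each side. -/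
def Counterclockwise (P : PolygonCurve) : Prop :=
  ∀ i, ∀ x ∈ openSegment ℝ (P.vertex i) (P.vertex (i + 1)),
    ∀ᶠ ε in 𝓝[>] (0 : ℝ), x + ε • P.normal i ∈ P.inside

end PolygonCurve

/-- A polygon (2-cell), its vertices listed counterclockwise. -/
structure Polygon2 extends PolygonCurve where
  ccw : toPolygonCurve.Counterclockwise

/-- The intersection of the two polygons is empty or a common proper face (a vertex or an edge). -/
def MeetInFace (P Q : PolygonCurve) : Prop :=
  P.region ∩ Q.region = ∅ ∨
  (∃ i j, P.vertex i = Q.vertex j ∧ P.region ∩ Q.region = {P.vertex i}) ∨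
  (∃ i j, P.edge i = Q.edge j ∧ P.region ∩ Q.region = P.edge i)

/-- A pure polygonal complex in the plane, given by its polygons; its vertices and edges are the
vertices and sides of these polygons. -/
structure PolygonalComplex (ι : Type*) where
  polygon : ι → Polygon2
  meet : ∀ f g, f ≠ g → MeetInFace (polygon f).toPolygonCurve (polygon g).toPolygonCurve

/-- The underlying space `|K|`. -/
def PolygonalComplex.support {ι : Type*} (K : PolygonalComplex ι) : Set Plane :=
  ⋃ f, (K.polygon f).region

/-- The outside cell: the closure of what neither the complex nor the holes cover. In particular
the complex, the holes and the outside cell cover the plane. -/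
def outsideRegion {ι κ : Type*} (K : PolygonalComplex ι) (H : κ → Polygon2) : Set Plane :=
  closure (K.support ∪ ⋃ h, (H h).region)ᶜ

/-- The conditions on a complex `K`, its holes `H` and the outside cell under which the Euler
transformation is defined. -/
structure AdmissibleInput {ι κ : Type*} (K : PolygonalComplex ι) (H : κ → Polygon2) : Prop where
  /-- The outside is a single cell. -/
  outside_connected : IsConnected (K.support ∪ ⋃ h, (H h).region)ᶜ
  /-- A polygon of `K` and a hole meet only along common vertices and common edges. -/
  meet_hole : ∀ f h, ∀ x ∈ (K.polygon f).region ∩ (H h).region,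
    (∃ i j, x = (K.polygon f).vertex i ∧ x = (H h).vertex j) ∨
    (∃ i j, (K.polygon f).edge i = (H h).edge j ∧ x ∈ (K.polygon f).edge i)
  /-- Holes are pairwise disjoint. -/
  holes_disjoint : ∀ h h', h ≠ h' → Disjoint (H h).region (H h').region
  /-- Holes are disjoint from the outside. -/
  hole_outside_disjoint : ∀ h, Disjoint (H h).region (outsideRegion K H)
  /-- A polygon of `K` and a hole have at most one common edge. -/
  hole_edge_unique : ∀ f h i i' j j', (K.polygon f).edge i = (H h).edge j →
    (K.polygon f).edge i' = (H h).edge j' → i = i'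
  /-- No two adjacent edges of a polygon of `K` are both edges of the outside cell. -/
  outside_not_adjacent : ∀ f i,
    ¬ ((K.polygon f).edge i ⊆ outsideRegion K H ∧ (K.polygon f).edge (i + 1) ⊆ outsideRegion K H)

namespace PolygonCurve

/-- A state of the shrinking boundary of `P`: for each side of `P`, the start point and the end
point of its moved copy. -/
abbrev Wavefront (P : PolygonCurve) : Type := P.Idx → Plane × Plane

def initialWavefront (P : PolygonCurve) : P.Wavefront := fun i => (P.vertex i, P.vertex (i + 1))

/-- No side has shrunk to a point (or reversed its direction), and two different sides meet at
most in common end points. Hence the sides form polygons which, counted together, have exactly one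
side for each side of `P`, and which may touch only at vertices. -/
def Wavefront.Proper {P : PolygonCurve} (c : P.Wavefront) : Prop :=
  (∀ i, ∃ l : ℝ, 0 < l ∧ (c i).2 - (c i).1 = l • P.dir i) ∧
  ∀ i j, i ≠ j → ∀ x ∈ segment ℝ (c i).1 (c i).2 ∩ segment ℝ (c j).1 (c j).2,
    (x = (c i).1 ∨ x = (c i).2) ∧ (x = (c j).1 ∨ x = (c j).2)

/-- Velocity of the meeting point of two lines with unit normals `n`, `n'` which both move along
their normals with unit speed, the point moving along the bisector: it is the multiple `w` of
`n + n'` with `⟪w, n⟫ = ⟪w, n'⟫ = 1` (and `w = n` if `n = n'`). -/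
def miterVelocity (n n' : Plane) : Plane := (1 + inner ℝ n n')⁻¹ • (n + n')

/-- The wavefront after a further time `s` if the side following side `i` is side `σ i`: all sides
move inwards in parallel with unit speed. -/
def Wavefront.advance {P : PolygonCurve} (c : P.Wavefront) (σ : Equiv.Perm P.Idx) (s : ℝ) :
    P.Wavefront := fun i =>
  ((c i).1 + s • miterVelocity (P.normal (σ.symm i)) (P.normal i),
   (c i).2 + s • miterVelocity (P.normal i) (P.normal (σ i)))

/-- `P.MiteredOffset t c`: the wavefront `c` is the mitered offset of `P` at distance `t`, generated
by letting the sides of `P` move inwards in parallel with unit speed while vertices move along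
bisectors; no side is lost or subdivided on the way (no combinatorial change). At the instants where
several vertices have come to coincide, the sides ending there may be joined anew to the sides
starting there, which splits a polygon into several ones (topological change); as sides must not
cross afterwards, the new joining is the splitting one. -/
inductive MiteredOffset (P : PolygonCurve) : ℝ → P.Wavefront → Prop
  | start : MiteredOffset P 0 P.initialWavefront
  | move {t : ℝ} {c : P.Wavefront} (hc : MiteredOffset P t c)
      (σ : Equiv.Perm P.Idx) (hσ : ∀ i, (c i).2 = (c (σ i)).1)
      (d : ℝ) (hd : 0 < d) (hproper : ∀ s ∈ Ioc 0 d, (c.advance σ s).Proper) :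
      MiteredOffset P (t + d) (c.advance σ d)

end PolygonCurve

/-- The polygons that are duplicated: those of `K`, the holes, and the outside cell. -/
inductive Cell (ι κ : Type*)
  | mesh (f : ι) : Cell ι κ
  | hole (h : κ) : Cell ι κ
  | outside : Cell ι κ

section EulerTransformation

variable {ι κ : Type*} (K : PolygonalComplex ι) (H : κ → Polygon2)
  (W : ∀ f, (K.polygon f).Wavefront)

/-- `IsCopy K H W c u v u' v'`: the cell `c` has an edge with end points `u`, `v`, and the copy of
this edge in the duplicate of `c` has the corresponding end points `u'`, `v'`. The duplicate of a
polygon of `K` is its offset `W`; holes and the outside cell are duplicated without change. -/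
inductive IsCopy : Cell ι κ → Plane → Plane → Plane → Plane → Prop
  | mesh (f : ι) (i : (K.polygon f).Idx) :
      IsCopy (Cell.mesh f) ((K.polygon f).vertex i) ((K.polygon f).vertex (i + 1))
        (W f i).1 (W f i).2
  | hole (h : κ) (j : (H h).Idx) :
      IsCopy (Cell.hole h) ((H h).vertex j) ((H h).vertex (j + 1))
        ((H h).vertex j) ((H h).vertex (j + 1))
  | outside (f : ι) (i : (K.polygon f).Idx) (hi : (K.polygon f).edge i ⊆ outsideRegion K H) :
      IsCopy Cell.outside ((K.polygon f).vertex i) ((K.polygon f).vertex (i + 1))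
        ((K.polygon f).vertex i) ((K.polygon f).vertex (i + 1))
  | symm {c : Cell ι κ} {u v u' v' : Plane} (h : IsCopy c u v u' v') : IsCopy c v u v' u'

/-- Facets of the polygons of Class 1, the offset (possibly split) copy of the polygon `f` of `K`.
A vertex of the transformed complex is a point together with the cell in whose duplicate it lies. -/
def class1Facets (f : ι) : Set (Sym2 (Cell ι κ × Plane)) :=
  {e | ∃ u v u' v', IsCopy K H W (Cell.mesh f) u v u' v' ∧
    e = s((Cell.mesh f, u'), (Cell.mesh f, v'))}

/-- Facets of the 4-gon of Class 2 generated by the edge `{u, v}` of `K`, which is shared by a polygon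
`f` of `K` and another cell `c`: the two copies of the edge, and two new edges that join the
two copies of `u` and the two copies of `v`. -/
def class2Facets (u v : Plane) : Set (Sym2 (Cell ι κ × Plane)) :=
  {e | ∃ (f : ι) (c : Cell ι κ) (u₁ v₁ u₂ v₂ : Plane), c ≠ Cell.mesh f ∧
    IsCopy K H W (Cell.mesh f) u v u₁ v₁ ∧ IsCopy K H W c u v u₂ v₂ ∧
    (e = s((Cell.mesh f, u₁), (Cell.mesh f, v₁)) ∨ e = s((c, u₂), (c, v₂)) ∨
     e = s((Cell.mesh f, u₁), (c, u₂)) ∨ e = s((Cell.mesh f, v₁), (c, v₂)))}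

/-- Facets of the Class 3 polygon generated by the vertex `v`: for any two cells sharing an edge at
`v`, the edge that joins their copies of `v`. If offset polygons have been split, several Class 3
polygons merge into one, whose facets are all facets of the merged ones. -/
def class3Facets (v : Plane) : Set (Sym2 (Cell ι κ × Plane)) :=
  {e | ∃ (c₁ c₂ : Cell ι κ) (u u₁ v₁ u₂ v₂ : Plane), c₁ ≠ c₂ ∧
    IsCopy K H W c₁ u v u₁ v₁ ∧ IsCopy K H W c₂ u v u₂ v₂ ∧ e = s((c₁, v₁), (c₂, v₂))}

/-- The edges of the Euler transformed complex. -/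
def eulerEdges : Set (Sym2 (Cell ι κ × Plane)) :=
  (⋃ f, class1Facets K H W f) ∪ (⋃ u, ⋃ v, class2Facets K H W u v) ∪ ⋃ v, class3Facets K H W v

/-- The vertices of the Euler transformed complex. -/
def eulerVertices : Set (Cell ι κ × Plane) := {x | ∃ e ∈ eulerEdges K H W, x ∈ e}

/-- The 1-skeleton of the Euler transformed complex (inside the type of all potential vertices). -/
def eulerSkeleton : SimpleGraph (Cell ι κ × Plane) := SimpleGraph.fromEdgeSet (eulerEdges K H W)

end EulerTransformation

end

/-! Degrees. A vertex of the complex is a cell `c` with a point `p` of its duplicate. Every side of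
`c` having an end whose copy is `p` yields two edges there: one along the copied side, one across it
to the only other cell with that side (`HasSide.exists_opposite`, `HasSide.opposite_unique`).
Different sides give different neighbours (`IsCopy.opposite_injective`), because two polygons share
at most one side and the outside cell contains no two adjacent sides of a polygon. So the degree is
twice a number of sides (`eulerSkeleton_degree`).

Connectedness. The danger is a split offset whose parts fall into different components. Colour a
side by whether its copy is reachable from a fixed vertex. Common sides then get equal colours, and
so do sides meeting at a vertex of the same hole or of the outside. That each polygon has only one
colour (`CompatibleColoring.constant`) follows by estimating in two ways the sum of the turning
angles over all corners where the colour changes.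

At a fixed vertex of `K` there is never exactly one such corner
(`CompatibleColoring.not_existsUnique_transition`), and two interior angles there add up to at most
`2π`, so two turning angles have a nonnegative sum. Hence the total is nonnegative. On the other
hand a polygon with a colour change contributes a negative amount (`Polygon2.transition_turn_neg`).
To see this, follow the shrinking boundary. Sides move in parallel, so turning angles only change
when sides are joined anew at a point `p`. The winding number around `p` is 1 just before and 0 just
after that instant; evaluating both through limits of view angles gives `∑ (π + turn before) + ∑ (π
- turn after) = 2π`, all terms being positive (`Wavefront.transition_at`). The colour changes before
and after are together even in number; if there are any at a genuine rejoining, the identity forces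
their turning sum to increase strictly. At the end no colour change is left and the sum is 0, so it
was negative at the start.

Finally a colouring constant on polygons is constant on a connected `|K|`
(`CompatibleColoring.eq_of_isConnected`): two colour classes could only touch at a vertex, where
each would need a side on a hole or the outside, and these sides all have one colour. -/

noncomputable section

/-! ### The plane as the complex numbers -/

/-- The identification of the plane with the complex numbers. -/
def cx : Plane ≃ₗᵢ[ℝ] ℂ := Complex.orthonormalBasisOneI.repr.symm

lemma cx_re (x : Plane) : (cx x).re = x 0 := by simp [cx]

lemma cx_im (x : Plane) : (cx x).im = x 1 := by simp [cx]

attribute [irreducible] cx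

lemma cx_smul (r : ℝ) (x : Plane) : cx (r • x) = r * cx x := by simp

lemma cx_quarterTurn (x : Plane) : cx (quarterTurn x) = Complex.I * cx x := by
  apply Complex.ext <;> simp [cx_re, cx_im, quarterTurn]

lemma inner_plane (x y : Plane) : inner ℝ x y = x 0 * y 0 + x 1 * y 1 := by
  simp [PiLp.inner_apply, Fin.sum_univ_two, mul_comm]

lemma inner_eq_re (x y : Plane) : inner ℝ x y = (cx y * (starRingEnd ℂ) (cx x)).re := by
  simp [inner_plane, cx_re, cx_im]; ring

lemma cx_eq_zero {x : Plane} : cx x = 0 ↔ x = 0 := by simp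

/-- The point at distance `r` from `z` in the direction with angle `θ`. -/
def polar (z : Plane) (r θ : ℝ) : Plane := z + cx.symm (r * Complex.exp (θ * Complex.I))

lemma cx_polar (z : Plane) (r θ : ℝ) :
    cx (polar z r θ) = cx z + r * Complex.exp (θ * Complex.I) := by simp [polar]

lemma continuous_polar (z : Plane) : Continuous fun q : ℝ × ℝ => polar z q.1 q.2 := by
  have h : Continuous fun q : ℝ × ℝ => (q.1 * Complex.exp (q.2 * Complex.I) : ℂ) := by fun_prop
  have h2 : Continuous fun q : ℝ × ℝ => cx.symm (q.1 * Complex.exp (q.2 * Complex.I) : ℂ) :=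
    Continuous.comp cx.symm.continuous h
  exact Continuous.add continuous_const h2

lemma continuous_polar_angle (z : Plane) (r : ℝ) : Continuous fun θ => polar z r θ := by
  have h : Continuous fun θ : ℝ => (r, θ) := by fun_prop
  exact Continuous.comp (g := fun q : ℝ × ℝ => polar z q.1 q.2) (continuous_polar z) h

lemma dist_polar (z : Plane) (r θ : ℝ) : dist (polar z r θ) z = |r| := by
  simp [polar, dist_eq_norm, Complex.norm_exp]

lemma polar_add_two_pi (z : Plane) (r θ : ℝ) (n : ℤ) :
    polar z r (θ + n * (2 * Real.pi)) = polar z r θ := by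
  unfold polar
  congr 3
  rw [Complex.exp_eq_exp_iff_exists_int]
  exact ⟨n, by push_cast; ring⟩

lemma polar_inj {z : Plane} {r r' θ θ' : ℝ} (hr : 0 < r) (hr' : 0 < r')
    (h : polar z r θ = polar z r' θ') : r = r' ∧ ∃ n : ℤ, θ = θ' + n * (2 * Real.pi) := by
  have h1 : r = r' := by
    have := congrArg (fun x => dist x z) h
    simpa [dist_polar, abs_of_pos hr, abs_of_pos hr'] using this
  refine ⟨h1, ?_⟩
  subst h1
  have h2 := congrArg cx h
  rw [cx_polar, cx_polar, add_left_cancel_iff] at h2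
  have h3 := mul_left_cancel₀ (by exact_mod_cast hr.ne') h2
  obtain ⟨n, hn⟩ := Complex.exp_eq_exp_iff_exists_int.1 h3
  refine ⟨n, ?_⟩
  have := congrArg Complex.im hn
  simpa using this

lemma exists_polar {z x : Plane} (h : x ≠ z) (ψ : ℝ) :
    ∃ r θ, 0 < r ∧ θ ∈ Ico ψ (ψ + 2 * Real.pi) ∧ x = polar z r θ := by
  have hp : (0 : ℝ) < 2 * Real.pi := by positivity
  refine ⟨dist x z, toIcoMod hp ψ (Complex.arg (cx (x - z))), dist_pos.2 h,
    toIcoMod_mem_Ico _ _ _, ?_⟩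
  have h1 : toIcoMod hp ψ (Complex.arg (cx (x - z))) =
      Complex.arg (cx (x - z)) + ((-toIcoDiv hp ψ (Complex.arg (cx (x - z))) : ℤ) : ℝ) *
        (2 * Real.pi) := by
    rw [toIcoMod]; push_cast; rw [zsmul_eq_mul]; ring
  rw [h1, polar_add_two_pi]
  apply cx.injective
  rw [cx_polar, dist_eq_norm, ← cx.norm_map, Complex.norm_mul_exp_arg_mul_I]
  simp

lemma polar_of_arg {z v : Plane} {θ : ℝ} (h : cx v = ‖v‖ * Complex.exp (θ * Complex.I)) (t : ℝ) :
    z + t • v = polar z (t * ‖v‖) θ := by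
  apply cx.injective
  rw [cx_polar, map_add, cx_smul, h]; push_cast; ring

/-! ### Sectors -/

/-- The open circular sector with angles between `a` and `b`. -/
def sector (z : Plane) (ρ a b : ℝ) : Set Plane :=
  (fun q : ℝ × ℝ => polar z q.1 q.2) '' (Ioo 0 ρ ×ˢ Ioo a b)

lemma isPreconnected_sector (z : Plane) (ρ a b : ℝ) : IsPreconnected (sector z ρ a b) :=
  (isPreconnected_Ioo.prod isPreconnected_Ioo).image _ (continuous_polar z).continuousOn

lemma polar_mem_sector {z : Plane} {ρ a b r θ : ℝ} (hr : r ∈ Ioo 0 ρ) (hθ : θ ∈ Ioo a b) :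
    polar z r θ ∈ sector z ρ a b := ⟨(r, θ), ⟨hr, hθ⟩, rfl⟩

lemma sector_subset_ball (z : Plane) (ρ a b : ℝ) : sector z ρ a b ⊆ Metric.ball z ρ := by
  rintro _ ⟨⟨r, θ⟩, ⟨hr, -⟩, rfl⟩
  simp only [Metric.mem_ball, dist_polar, abs_of_pos hr.1]
  exact hr.2

lemma polar_mem_closure_sector {z : Plane} {ρ a b r θ : ℝ} (hr : r ∈ Ioo 0 ρ)
    (hab : a < b) (hθ : θ ∈ Icc a b) : polar z r θ ∈ closure (sector z ρ a b) := by
  have h1 : θ ∈ closure (Ioo a b) := by rw [closure_Ioo hab.ne]; exact hθ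
  have := image_closure_subset_closure_image (continuous_polar_angle z r) (mem_image_of_mem _ h1)
  exact closure_mono (by rintro _ ⟨t, ht, rfl⟩; exact polar_mem_sector hr ht) this

/-! ### Elementary facts on polygons -/

lemma Fin.add_one_ne {m : ℕ} (i : Fin (m + 3)) : i + 1 ≠ i := by simp

lemma Fin.cyclic_induction {m : ℕ} {p : Fin (m + 3) → Prop} (i : Fin (m + 3)) (h0 : p i)
    (hs : ∀ j, p j → p (j + 1)) (j : Fin (m + 3)) : p j := by
  have key : ∀ k : Fin (m + 3), p (i + k) := by
    intro k
    induction k using Fin.induction with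
    | zero => simpa using h0
    | succ k ih => rw [← Fin.coeSucc_eq_succ, ← add_assoc]; exact hs _ ih
  simpa using key (j - i)

/-- Equal diameters force the parameters of `a` and `b` on the other segment to differ by exactly 1,
so they are 0 and 1. -/
lemma segment_eq_segment {a b c d : Plane} (h : segment ℝ a b = segment ℝ c d) :
    (a = c ∧ b = d) ∨ (a = d ∧ b = c) := by
  have hd : dist a b = dist c d := by
    have := congrArg Metric.diam h
    rw [← convexHull_pair, ← convexHull_pair, convexHull_diam, convexHull_diam,
      Metric.diam_pair, Metric.diam_pair] at this
    exact this
  have ha : a ∈ segment ℝ c d := h ▸ left_mem_segment ℝ a b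
  have hb : b ∈ segment ℝ c d := h ▸ right_mem_segment ℝ a b
  rw [segment_eq_image'] at ha hb
  obtain ⟨s, hs, rfl⟩ := ha
  obtain ⟨t, ht, rfl⟩ := hb
  simp only at hd
  have h1 : dist (c + s • (d - c)) (c + t • (d - c)) = |s - t| * dist c d := by
    rw [dist_add_left, dist_eq_norm, ← sub_smul, norm_smul, dist_comm c d, dist_eq_norm d c]
    rfl
  rw [h1] at hd
  by_cases hcd : c = d
  · subst hcd; simp
  have h2 : |s - t| = 1 := by
    have := dist_pos.2 hcd
    exact mul_right_cancel₀ this.ne' (by linarith)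
  rcases abs_eq (by norm_num : (0 : ℝ) ≤ 1) |>.1 h2 with h3 | h3
  · have : s = 1 := by linarith [hs.1, hs.2, ht.1, ht.2]
    have : t = 0 := by linarith [hs.1, hs.2, ht.1, ht.2]
    subst s t; right; simp
  · have : s = 0 := by linarith [hs.1, hs.2, ht.1, ht.2]
    have : t = 1 := by linarith [hs.1, hs.2, ht.1, ht.2]
    subst s t; left; simp

lemma ne_of_mem_openSegment {a b x : Plane} (hab : a ≠ b) (hx : x ∈ openSegment ℝ a b) :
    x ≠ a ∧ x ≠ b := by
  constructor
  · rintro rfl; exact hab (left_mem_openSegment_iff.1 hx)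
  · rintro rfl; exact hab (right_mem_openSegment_iff.1 hx)

lemma mem_openSegment_of_ne {a b x : Plane} (hx : x ∈ segment ℝ a b) (ha : x ≠ a) (hb : x ≠ b) :
    x ∈ openSegment ℝ a b := mem_openSegment_of_ne_left_right ha.symm hb.symm hx

lemma isCompact_segment (a b : Plane) : IsCompact (segment ℝ a b) := by
  rw [segment_eq_image]
  exact isCompact_Icc.image (by fun_prop)

namespace PolygonCurve

variable (P : PolygonCurve)

lemma vertex_succ_ne (i : P.Idx) : P.vertex i ≠ P.vertex (i + 1) :=
  fun h => Fin.add_one_ne i (P.vertex_injective h).symm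

lemma dir_ne_zero (i : P.Idx) : P.dir i ≠ 0 := sub_ne_zero.2 (P.vertex_succ_ne i).symm

lemma cx_dir_ne_zero (i : P.Idx) : cx (P.dir i) ≠ 0 := by
  rw [Ne, cx_eq_zero]; exact P.dir_ne_zero i

lemma norm_dir_pos (i : P.Idx) : 0 < ‖P.dir i‖ := norm_pos_iff.2 (P.dir_ne_zero i)

lemma cx_dir (i : P.Idx) :
    cx (P.dir i) = ‖P.dir i‖ * Complex.exp (Complex.arg (cx (P.dir i)) * Complex.I) := by
  rw [← cx.norm_map, Complex.norm_mul_exp_arg_mul_I]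

lemma edge_subset_boundary (i : P.Idx) : P.edge i ⊆ P.boundary := subset_iUnion P.edge i

lemma isCompact_edge (i : P.Idx) : IsCompact (P.edge i) := isCompact_segment _ _

lemma isCompact_boundary : IsCompact P.boundary := isCompact_iUnion P.isCompact_edge

lemma edge_inj {i j : P.Idx} (h : P.edge i = P.edge j) : i = j := by
  by_contra hij
  obtain ⟨x, hx⟩ : (openSegment ℝ (P.vertex i) (P.vertex (i + 1))).Nonempty :=
    ⟨_, midpoint_mem_openSegment _ _⟩
  have hx' := openSegment_subset_segment _ _ _ hx
  have h1 : x ∈ P.edge j := by rw [← h]; exact hx'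
  have := P.simple i j hij x ⟨hx', h1⟩
  have h2 := ne_of_mem_openSegment (P.vertex_succ_ne i) hx
  tauto

lemma vertex_mem_edge (i : P.Idx) : P.vertex i ∈ P.edge i := left_mem_segment _ _ _

lemma vertex_succ_mem_edge (i : P.Idx) : P.vertex (i + 1) ∈ P.edge i := right_mem_segment _ _ _

/-- The open segment of a side. -/
def openEdge (i : P.Idx) : Set Plane := openSegment ℝ (P.vertex i) (P.vertex (i + 1))

lemma openEdge_subset (i : P.Idx) : P.openEdge i ⊆ P.edge i := openSegment_subset_segment _ _ _

lemma openEdge_nonempty (i : P.Idx) : (P.openEdge i).Nonempty := ⟨_, midpoint_mem_openSegment _ _⟩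

lemma closure_openEdge (i : P.Idx) : closure (P.openEdge i) = P.edge i :=
  closure_openSegment _ _

lemma eq_of_mem_openEdge {i j : P.Idx} {x : Plane} (hx : x ∈ P.openEdge i) (hj : x ∈ P.edge j) :
    i = j := by
  by_contra hij
  have := P.simple i j hij x ⟨P.openEdge_subset i hx, hj⟩
  have h2 := ne_of_mem_openSegment (P.vertex_succ_ne i) hx
  tauto

lemma eq_of_vertex_mem_edge {i j : P.Idx} (h : P.vertex i ∈ P.edge j) : i = j ∨ i = j + 1 := by
  by_cases hij : i = j
  · exact Or.inl hij
  have := P.simple i j hij _ ⟨P.vertex_mem_edge i, h⟩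
  rcases this.2 with h | h
  · exact Or.inl (P.vertex_injective h)
  · exact Or.inr (P.vertex_injective h)

lemma vertex_notMem_openEdge {i j : P.Idx} : P.vertex i ∉ P.openEdge j := by
  intro h
  have h2 := ne_of_mem_openSegment (P.vertex_succ_ne j) h
  rcases P.eq_of_vertex_mem_edge (P.openEdge_subset _ h) with rfl | rfl
  · exact h2.1 rfl
  · exact h2.2 rfl

lemma mem_boundary_iff {x : Plane} :
    x ∈ P.boundary ↔ (∃ i, x = P.vertex (i + 1)) ∨ ∃ i, x ∈ P.openEdge i := by
  constructor
  · intro h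
    obtain ⟨i, hi⟩ := mem_iUnion.1 h
    by_cases h1 : x = P.vertex i
    · left; exact ⟨i - 1, by simpa using h1⟩
    by_cases h2 : x = P.vertex (i + 1)
    · left; exact ⟨i, h2⟩
    · right; exact ⟨i, mem_openSegment_of_ne hi h1 h2⟩
  · rintro (⟨i, rfl⟩ | ⟨i, hi⟩)
    · exact P.edge_subset_boundary i (P.vertex_succ_mem_edge i)
    · exact P.edge_subset_boundary i (P.openEdge_subset i hi)

lemma isPreconnected_boundary : IsPreconnected P.boundary := by
  refine IsPreconnected.iUnion_of_reflTransGen (fun i => (convex_segment _ _).isPreconnected) ?_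
  intro i
  refine Fin.cyclic_induction i Relation.ReflTransGen.refl fun j hj => hj.tail ?_
  exact ⟨_, P.vertex_succ_mem_edge _, P.vertex_mem_edge _⟩

lemma inside_subset_region : P.inside ⊆ P.region := subset_union_right

lemma boundary_subset_region : P.boundary ⊆ P.region := subset_union_left

lemma edge_subset_region (i : P.Idx) : P.edge i ⊆ P.region :=
  (P.edge_subset_boundary i).trans P.boundary_subset_region

lemma vertex_mem_region (i : P.Idx) : P.vertex i ∈ P.region :=
  P.edge_subset_region i (P.vertex_mem_edge i)

/-- A connected set off the boundary lies in one component of the complement, whose boundedness is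
common to all its points. -/
lemma subset_inside {C : Set Plane} (hC : IsPreconnected C) (hd : ∀ y ∈ C, y ∉ P.boundary)
    {x : Plane} (hx : x ∈ C) (hin : x ∈ P.inside) : C ⊆ P.inside := by
  intro y hy
  have h1 : C ⊆ connectedComponentIn P.boundaryᶜ x :=
    hC.subset_connectedComponentIn hx (fun y hy => hd y hy)
  refine ⟨hd y hy, ?_⟩
  rw [← connectedComponentIn_eq (h1 hy)]
  exact hin.2

lemma isOpen_inside : IsOpen P.inside := by
  rw [isOpen_iff_mem_nhds]
  intro x hx
  have h0 : P.boundaryᶜ ∈ 𝓝 x := P.isCompact_boundary.isClosed.isOpen_compl.mem_nhds hx.1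
  refine mem_of_superset (connectedComponentIn_mem_nhds h0) ?_
  exact P.subset_inside isPreconnected_connectedComponentIn
    (fun y hy => connectedComponentIn_subset _ _ hy) (mem_connectedComponentIn hx.1) hx

lemma isClosed_region : IsClosed P.region := by
  rw [← isOpen_compl_iff, isOpen_iff_mem_nhds]
  intro x hx
  have h1 : x ∉ P.boundary := fun h => hx (Or.inl h)
  have h0 : P.boundaryᶜ ∈ 𝓝 x := P.isCompact_boundary.isClosed.isOpen_compl.mem_nhds h1
  refine mem_of_superset (connectedComponentIn_mem_nhds h0) ?_
  rintro y hy (h | h)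
  · exact connectedComponentIn_subset _ _ hy h
  · apply hx
    right
    exact P.subset_inside isPreconnected_connectedComponentIn
      (fun y hy => connectedComponentIn_subset _ _ hy) hy h (mem_connectedComponentIn h1)

/-- A half-plane beyond the compact boundary is connected and unbounded, so its points are not
enclosed. -/
lemma region_ne_univ : P.region ≠ univ := by
  intro h
  obtain ⟨R, hR⟩ := P.isCompact_boundary.isBounded.subset_closedBall 0
  have hb : ∀ x ∈ P.boundary, x 0 ≤ R := by
    intro x hx
    have h1 := hR hx
    rw [mem_closedBall_zero_iff] at h1
    exact (le_abs_self _).trans ((PiLp.norm_apply_le x 0).trans h1)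
  set C : Set Plane := {x | R < x 0}
  have hC : IsPreconnected C := by
    refine Convex.isPreconnected ?_
    have : C = (EuclideanSpace.proj (0 : Fin 2) : Plane →L[ℝ] ℝ) ⁻¹' Ioi R := rfl
    rw [this]
    exact (convex_Ioi R).linear_preimage (EuclideanSpace.proj (0 : Fin 2) : Plane →L[ℝ] ℝ).toLinearMap
  have hCb : ∀ y ∈ C, y ∉ P.boundary := fun y hy hy' => absurd (hb y hy') (not_le.2 hy)
  have hx0 : (!₂[R + 1, 0] : Plane) ∈ C := by simp [C]
  have hx1 : (!₂[R + 1, 0] : Plane) ∈ P.inside := by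
    have : (!₂[R + 1, 0] : Plane) ∈ P.region := h ▸ mem_univ _
    exact this.resolve_left (hCb _ hx0)
  have hbd := hx1.2.subset (hC.subset_connectedComponentIn hx0 hCb)
  obtain ⟨R', hR'⟩ := hbd.subset_closedBall 0
  have h2 : (!₂[|R| + |R'| + 1, 0] : Plane) ∈ C := by
    simp only [C, mem_ofPred_eq]
    have := le_abs_self R
    have := abs_nonneg R'
    simp; linarith
  have h3 := hR' h2
  rw [mem_closedBall_zero_iff] at h3
  have h4 := (le_abs_self _).trans ((PiLp.norm_apply_le (!₂[|R| + |R'| + 1, 0] : Plane) 0).trans h3)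
  simp at h4
  have := le_abs_self R'
  have := abs_nonneg R
  linarith

end PolygonCurve

/-! ### Local shape of the boundary and turning angles. -/

namespace PolygonCurve

variable (P : PolygonCurve)

/-- The angle of the direction of a side. -/
def ang (i : P.Idx) : ℝ := Complex.arg (cx (P.dir i))

/-- The turning angle from side `i` to side `j`. -/
def turn (i j : P.Idx) : ℝ := Complex.arg (cx (P.dir j) / cx (P.dir i))

lemma cx_dir_eq (i : P.Idx) : cx (P.dir i) = ‖P.dir i‖ * Complex.exp (P.ang i * Complex.I) :=
  P.cx_dir i

lemma cx_normal (i : P.Idx) : cx (P.normal i) = Complex.I * Complex.exp (P.ang i * Complex.I) := by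
  have h : (‖P.dir i‖ : ℂ) ≠ 0 := by exact_mod_cast (P.norm_dir_pos i).ne'
  rw [normal, cx_smul, cx_quarterTurn, cx_dir_eq]
  push_cast
  field_simp

/-- The direction back along side `i` is the direction of side `j` turned by `π - turn`; at a corner
of a counterclockwise polygon this is the interior angle. -/
lemma cx_neg_dir_eq (i j : P.Idx) : cx (-P.dir i) =
    ‖-P.dir i‖ * Complex.exp ((P.ang j + (Real.pi - P.turn i j) : ℝ) * Complex.I) := by
  have h1 : cx (P.dir j) / cx (P.dir i) = ‖cx (P.dir j) / cx (P.dir i)‖ *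
      Complex.exp (P.turn i j * Complex.I) := (Complex.norm_mul_exp_arg_mul_I _).symm
  have e : Complex.exp ((P.ang j + (Real.pi - P.turn i j) : ℝ) * Complex.I) =
      - (Complex.exp (P.ang j * Complex.I) / Complex.exp (P.turn i j * Complex.I)) := by
    rw [← Complex.exp_sub, ← neg_one_mul, ← Complex.exp_pi_mul_I, ← Complex.exp_add]
    congr 1; push_cast; ring
  rw [e]
  have h2 : (‖P.dir i‖ : ℂ) ≠ 0 := by exact_mod_cast (P.norm_dir_pos i).ne'
  have h3 : (‖P.dir j‖ : ℂ) ≠ 0 := by exact_mod_cast (P.norm_dir_pos j).ne'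
  have h4 := P.cx_dir_ne_zero i
  have h5 := Complex.exp_ne_zero (P.turn i j * Complex.I)
  rw [norm_div, cx.norm_map, cx.norm_map, P.cx_dir_eq j, div_eq_iff h4] at h1
  push_cast at h1
  rw [norm_neg, map_neg, neg_eq_iff_eq_neg]
  generalize Complex.exp (P.turn i j * Complex.I) = E at *
  field_simp at h1 ⊢
  linear_combination -h1

lemma inner_normal_polar (i : P.Idx) (z : Plane) (r θ : ℝ) :
    inner ℝ (polar z r θ - z) (P.normal i) = r * Real.sin (θ - P.ang i) := by
  rw [inner_eq_re, cx_normal, map_sub, cx_polar, Real.sin_sub]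
  simp [Complex.exp_ofReal_mul_I_re, Complex.exp_ofReal_mul_I_im]
  ring

/-- Near `z` the boundary is contained in two rays starting at `z`. -/
def LocalRays (z : Plane) (ρ ψ γ : ℝ) : Prop :=
  ∀ x ∈ Metric.ball z ρ, x ∈ P.boundary →
    x = z ∨ ∃ r, 0 < r ∧ (x = polar z r ψ ∨ x = polar z r (ψ + γ))

variable {P}

lemma LocalRays.notMem_left {z : Plane} {ρ ψ γ : ℝ} (h : P.LocalRays z ρ ψ γ)
    (hγ' : γ < 2 * Real.pi) {x : Plane} (hx : x ∈ sector z ρ ψ (ψ + γ)) : x ∉ P.boundary := by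
  intro hb
  have hball := sector_subset_ball _ _ _ _ hx
  obtain ⟨⟨r, θ⟩, ⟨hr, hθ⟩, rfl⟩ := hx
  simp only at hr hθ hb hball
  have hp := Real.pi_pos
  rcases h _ hball hb with h0 | ⟨r', hr', h0 | h0⟩
  · have := dist_polar z r θ
    rw [h0, dist_self, abs_of_pos hr.1] at this
    linarith [hr.1]
  · obtain ⟨-, n, hn⟩ := polar_inj hr.1 hr' h0
    have h1 : (0 : ℝ) < n := by nlinarith [hθ.1]
    have h2 : (n : ℝ) < 1 := by nlinarith [hθ.2]
    have h1 : 0 < n := by exact_mod_cast h1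
    have h2 : n < 1 := by exact_mod_cast h2
    omega
  · obtain ⟨-, n, hn⟩ := polar_inj hr.1 hr' h0
    have h1 : (-1 : ℝ) < n := by nlinarith [hθ.1]
    have h2 : (n : ℝ) < 0 := by nlinarith [hθ.2]
    have h1 : -1 < n := by exact_mod_cast h1
    have h2 : n < 0 := by exact_mod_cast h2
    omega

lemma LocalRays.notMem_right {z : Plane} {ρ ψ γ : ℝ} (h : P.LocalRays z ρ ψ γ)
    (hγ : 0 < γ) {x : Plane} (hx : x ∈ sector z ρ (ψ + γ) (ψ + 2 * Real.pi)) :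
    x ∉ P.boundary := by
  -- The complementary sector lies between the same two rays taken in the other order.
  have h' : P.LocalRays z ρ (ψ + γ) (2 * Real.pi - γ) := by
    intro y hy hyb
    rcases h y hy hyb with h0 | ⟨r, hr, h0 | h0⟩
    · exact Or.inl h0
    · refine Or.inr ⟨r, hr, Or.inr ?_⟩
      rw [h0, ← polar_add_two_pi z r ψ 1]; congr 1; push_cast; ring
    · exact Or.inr ⟨r, hr, Or.inl h0⟩
  refine h'.notMem_left (by linarith) ?_
  convert hx using 1; ring_nf

lemma LocalRays.sector_subset_inside {z : Plane} {ρ ψ γ : ℝ} (h : P.LocalRays z ρ ψ γ)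
    (hγ' : γ < 2 * Real.pi) {x : Plane} (hx : x ∈ sector z ρ ψ (ψ + γ)) (hin : x ∈ P.inside) :
    sector z ρ ψ (ψ + γ) ⊆ P.inside :=
  P.subset_inside (isPreconnected_sector _ _ _ _) (fun _ hy => h.notMem_left hγ' hy) hx hin

/-- A point `w ≠ z` on one of the rays is in the closure of both sectors. A neighbourhood of `w` in
the region makes each sector contain an enclosed point, hence consist of enclosed points, and the
closures of the two sectors fill the ball. -/
lemma LocalRays.region_mem_nhds {z : Plane} {ρ ψ γ : ℝ} (h : P.LocalRays z ρ ψ γ) (hρ : 0 < ρ)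
    (hγ : 0 < γ) (hγ' : γ < 2 * Real.pi) (hz : z ∈ P.boundary) {w : Plane}
    (hw : w ∈ Metric.ball z ρ) (hwb : w ∈ P.boundary) (hn : P.region ∈ 𝓝 w) :
    P.region ∈ 𝓝 z := by
  rcases h w hw hwb with rfl | ⟨r, hr, hw'⟩
  · exact hn
  have hrρ : r < ρ := by
    rw [Metric.mem_ball] at hw
    rcases hw' with rfl | rfl <;> simpa [dist_polar, abs_of_pos hr] using hw
  have hp := Real.pi_pos
  have c1 : w ∈ closure (sector z ρ ψ (ψ + γ)) := by
    rcases hw' with rfl | rfl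
    · exact polar_mem_closure_sector ⟨hr, hrρ⟩ (by linarith) ⟨le_rfl, by linarith⟩
    · exact polar_mem_closure_sector ⟨hr, hrρ⟩ (by linarith) ⟨by linarith, le_rfl⟩
  have c2 : w ∈ closure (sector z ρ (ψ + γ) (ψ + 2 * Real.pi)) := by
    rcases hw' with rfl | rfl
    · rw [← polar_add_two_pi z r ψ 1]
      exact polar_mem_closure_sector ⟨hr, hrρ⟩ (by linarith)
        ⟨by push_cast; linarith, by push_cast; linarith⟩
    · exact polar_mem_closure_sector ⟨hr, hrρ⟩ (by linarith) ⟨le_rfl, by linarith⟩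
  have s1 : closure (sector z ρ ψ (ψ + γ)) ⊆ P.region := by
    obtain ⟨y, hy, hys⟩ := mem_closure_iff_nhds.1 c1 _ hn
    refine closure_minimal (Subset.trans ?_ P.inside_subset_region) P.isClosed_region
    exact h.sector_subset_inside hγ' hys (hy.resolve_left (h.notMem_left hγ' hys))
  have s2 : closure (sector z ρ (ψ + γ) (ψ + 2 * Real.pi)) ⊆ P.region := by
    obtain ⟨y, hy, hys⟩ := mem_closure_iff_nhds.1 c2 _ hn
    refine closure_minimal (Subset.trans ?_ P.inside_subset_region) P.isClosed_region
    exact P.subset_inside (isPreconnected_sector _ _ _ _) (fun _ hy => h.notMem_right hγ hy) hys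
      (hy.resolve_left (h.notMem_right hγ hys))
  refine mem_of_superset (Metric.ball_mem_nhds z hρ) fun x hx => ?_
  by_cases hxz : x = z
  · rw [hxz]; exact P.boundary_subset_region hz
  obtain ⟨s, θ, hs, hθ, rfl⟩ := exists_polar hxz ψ
  have hsρ : s < ρ := by
    rw [Metric.mem_ball] at hx
    simpa [dist_polar, abs_of_pos hs] using hx
  by_cases hc : θ ≤ ψ + γ
  · exact s1 (polar_mem_closure_sector ⟨hs, hsρ⟩ (by linarith) ⟨hθ.1, hc⟩)
  · exact s2 (polar_mem_closure_sector ⟨hs, hsρ⟩ (by linarith) ⟨(not_le.1 hc).le, hθ.2.le⟩)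

variable (P)

lemma exists_ball_edge (z : Plane) :
    ∃ ρ > 0, ∀ x ∈ Metric.ball z ρ, ∀ j, x ∈ P.edge j → z ∈ P.edge j := by
  have h : ∀ᶠ x in 𝓝 z, ∀ j, x ∈ P.edge j → z ∈ P.edge j := by
    rw [eventually_all]
    intro j
    by_cases hz : z ∈ P.edge j
    · exact Eventually.of_forall fun _ _ => hz
    · filter_upwards [(P.isCompact_edge j).isClosed.isOpen_compl.mem_nhds hz] with x hx hx'
      exact absurd hx' hx
  obtain ⟨ρ, hρ, h⟩ := Metric.eventually_nhds_iff_ball.1 h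
  exact ⟨ρ, hρ, h⟩

lemma mem_edge_iff {i : P.Idx} {x : Plane} :
    x ∈ P.edge i ↔ ∃ t ∈ Icc (0 : ℝ) 1, x = P.vertex i + t • P.dir i := by
  rw [edge, segment_eq_image', mem_image]
  simp only [dir, eq_comm]

lemma mem_edge_iff' {i : P.Idx} {x : Plane} :
    x ∈ P.edge i ↔ ∃ t ∈ Icc (0 : ℝ) 1, x = P.vertex (i + 1) + t • (-P.dir i) := by
  rw [edge, segment_symm, segment_eq_image', mem_image]
  simp only [dir, eq_comm, neg_sub]

lemma mem_openEdge_iff {i : P.Idx} {x : Plane} :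
    x ∈ P.openEdge i ↔ ∃ t ∈ Ioo (0 : ℝ) 1, x = P.vertex i + t • P.dir i := by
  rw [openEdge, openSegment_eq_image', mem_image]
  simp only [dir, eq_comm]

lemma localRays_vertex (i : P.Idx) : ∃ ρ > 0, P.LocalRays (P.vertex (i + 1)) ρ
    (P.ang (i + 1)) (Real.pi - P.turn i (i + 1)) := by
  obtain ⟨ρ, hρ, h⟩ := P.exists_ball_edge (P.vertex (i + 1))
  refine ⟨ρ, hρ, fun x hx hb => ?_⟩
  obtain ⟨j, hj⟩ := mem_iUnion.1 hb
  rcases P.eq_of_vertex_mem_edge (h x hx j hj) with hji | hji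
  · subst hji
    obtain ⟨t, ht, rfl⟩ := P.mem_edge_iff.1 hj
    rcases ht.1.eq_or_lt with rfl | ht0
    · left; simp
    · right
      exact ⟨t * ‖P.dir (i + 1)‖, mul_pos ht0 (P.norm_dir_pos _),
        Or.inl (polar_of_arg (P.cx_dir_eq _) t)⟩
  · rw [add_left_inj] at hji
    subst hji
    obtain ⟨t, ht, rfl⟩ := P.mem_edge_iff'.1 hj
    rcases ht.1.eq_or_lt with rfl | ht0
    · left; simp
    · right
      exact ⟨t * ‖-P.dir i‖, mul_pos ht0 (by simpa using P.norm_dir_pos i),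
        Or.inr (polar_of_arg (P.cx_neg_dir_eq i (i + 1)) t)⟩

lemma turn_self (i : P.Idx) : P.turn i i = 0 := by
  rw [turn, div_self (P.cx_dir_ne_zero i), Complex.arg_one]

lemma localRays_openEdge {i : P.Idx} {z : Plane} (hz : z ∈ P.openEdge i) :
    ∃ ρ > 0, P.LocalRays z ρ (P.ang i) Real.pi := by
  obtain ⟨ρ, hρ, h⟩ := P.exists_ball_edge z
  refine ⟨ρ, hρ, fun x hx hb => ?_⟩
  obtain ⟨j, hj⟩ := mem_iUnion.1 hb
  have hij := P.eq_of_mem_openEdge hz (h x hx j hj)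
  subst hij
  obtain ⟨t, ht, rfl⟩ := P.mem_openEdge_iff.1 hz
  obtain ⟨s, hs, rfl⟩ := P.mem_edge_iff.1 hj
  rcases lt_trichotomy s t with hst | rfl | hst
  · right
    refine ⟨(t - s) * ‖-P.dir i‖, mul_pos (by linarith) (by simpa using P.norm_dir_pos i),
      Or.inr ?_⟩
    have h1 := P.cx_neg_dir_eq i i
    rw [turn_self, sub_zero] at h1
    rw [← polar_of_arg h1]
    module
  · exact Or.inl rfl
  · right
    refine ⟨(s - t) * ‖P.dir i‖, mul_pos (by linarith) (P.norm_dir_pos i), Or.inl ?_⟩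
    rw [← polar_of_arg (P.cx_dir_eq i)]
    module

lemma exists_mem_openSegments {a b p : Plane} {μ : ℝ} (hμ : 0 < μ)
    (h : b - p = μ • (a - p)) : (openSegment ℝ a p ∩ openSegment ℝ p b).Nonempty := by
  rw [openSegment_symm ℝ a p, openSegment_eq_image', openSegment_eq_image']
  have h1 : 0 < 1 + μ := by linarith
  -- The factor `μ / (1 + μ)` is below both 1 and `μ`, so the point is on both segments; its
  -- parameter on the second one is `1 / (1 + μ)`.
  refine ⟨p + (μ / (1 + μ)) • (a - p), ⟨_, ⟨by positivity, ?_⟩, rfl⟩,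
    ⟨1 / (1 + μ), ⟨by positivity, ?_⟩, ?_⟩⟩
  · rw [div_lt_one h1]; linarith
  · rw [div_lt_one h1]; linarith
  · simp only [h, smul_smul]
    congr 2; ring

variable {P}

lemma Wavefront.Proper.ne {c : P.Wavefront} (hc : c.Proper) (i : P.Idx) : (c i).1 ≠ (c i).2 := by
  obtain ⟨l, hl, h⟩ := hc.1 i
  intro h0
  rw [h0, sub_self] at h
  exact (smul_ne_zero hl.ne' (P.dir_ne_zero i)) h.symm

lemma Wavefront.Proper.notMem_segment {c : P.Wavefront} (hc : c.Proper) {i j : P.Idx} (hij : i ≠ j)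
    {x : Plane} (hx : x ∈ openSegment ℝ (c i).1 (c i).2) : x ∉ segment ℝ (c j).1 (c j).2 := by
  intro hj
  have h1 := (hc.2 i j hij x ⟨openSegment_subset_segment _ _ _ hx, hj⟩).1
  have h2 := ne_of_mem_openSegment (hc.ne i) hx
  tauto

lemma arg_eq_pi_iff_exists {z w : ℂ} (hw : w ≠ 0) (h : Complex.arg (z / w) = Real.pi) :
    ∃ μ : ℝ, 0 < μ ∧ z = -μ * w := by
  rw [Complex.arg_eq_pi_iff] at h
  refine ⟨-(z / w).re, by linarith [h.1], ?_⟩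
  have : z / w = (z / w).re := by apply Complex.ext <;> simp [h.2]
  push_cast
  rw [neg_neg, ← this, div_mul_cancel₀ _ hw]

/-- A half turn would make side `j` run back over side `i`. -/
lemma Wavefront.Proper.turn_ne_pi {c : P.Wavefront} (hc : c.Proper) {i j : P.Idx}
    (hij : (c i).2 = (c j).1) : P.turn i j ≠ Real.pi := by
  intro h
  obtain ⟨μ, hμ, h⟩ := arg_eq_pi_iff_exists (P.cx_dir_ne_zero i) h
  have h' : P.dir j = (-μ) • P.dir i := by
    apply cx.injective; rw [cx_smul, h]; push_cast; ring
  obtain ⟨l, hl, hl'⟩ := hc.1 i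
  obtain ⟨k, hk, hk'⟩ := hc.1 j
  have hne : i ≠ j := by rintro rfl; exact hc.ne i hij.symm
  have h3 : (c j).2 - (c i).2 = (k * μ / l) • ((c i).1 - (c i).2) := by
    have h4 : (c i).1 - (c i).2 = -(l • P.dir i) := by rw [← hl']; abel
    rw [h4, hij, hk', h', smul_neg, smul_smul, smul_smul, ← neg_smul]
    congr 1; field_simp
  obtain ⟨x, hx1, hx2⟩ := exists_mem_openSegments (by positivity) h3
  rw [hij] at hx2
  exact hc.notMem_segment hne hx1 (openSegment_subset_segment _ _ _ hx2)

lemma Wavefront.Proper.abs_turn_lt {c : P.Wavefront} (hc : c.Proper) {i j : P.Idx}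
    (hij : (c i).2 = (c j).1) : P.turn i j ∈ Ioo (-Real.pi) Real.pi :=
  ⟨Complex.neg_pi_lt_arg _, lt_of_le_of_ne (Complex.arg_le_pi _) (hc.turn_ne_pi hij)⟩

variable (P)

lemma initialWavefront_proper : P.initialWavefront.Proper :=
  ⟨fun i => ⟨1, one_pos, by simp [initialWavefront, dir]⟩, P.simple⟩

lemma turn_succ_mem (i : P.Idx) : P.turn i (i + 1) ∈ Ioo (-Real.pi) Real.pi :=
  P.initialWavefront_proper.abs_turn_lt rfl

lemma exists_localRays {z : Plane} (hz : z ∈ P.boundary) :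
    ∃ ρ ψ γ, 0 < ρ ∧ 0 < γ ∧ γ < 2 * Real.pi ∧ P.LocalRays z ρ ψ γ := by
  have hp := Real.pi_pos
  rcases P.mem_boundary_iff.1 hz with ⟨i, rfl⟩ | ⟨i, hi⟩
  · obtain ⟨ρ, hρ, h⟩ := P.localRays_vertex i
    have := P.turn_succ_mem i
    exact ⟨ρ, _, _, hρ, by linarith [this.2], by linarith [this.1], h⟩
  · obtain ⟨ρ, hρ, h⟩ := P.localRays_openEdge hi
    exact ⟨ρ, _, _, hρ, hp, by linarith, h⟩

/-- No boundary point of a polygon is an interior point of its region. -/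
theorem region_notMem_nhds {z : Plane} (hz : z ∈ P.boundary) : P.region ∉ 𝓝 z := by
  intro hn
  -- This set is relatively open in the boundary and, by local propagation, closed. If nonempty it
  -- is the whole connected boundary; the region is then clopen, hence the plane, which is
  -- impossible.
  have hclosed : IsClosed (P.boundary ∩ interior P.region) := by
    refine isClosed_of_closure_subset fun x hx => ?_
    have hxb : x ∈ P.boundary :=
      closure_minimal inter_subset_left P.isCompact_boundary.isClosed hx
    obtain ⟨ρ, ψ, γ, hρ, hγ, hγ', h⟩ := P.exists_localRays hxb
    obtain ⟨w, hw, hwb, hwi⟩ := mem_closure_iff_nhds.1 hx _ (Metric.ball_mem_nhds x hρ)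
    exact ⟨hxb, mem_interior_iff_mem_nhds.2 (h.region_mem_nhds hρ hγ hγ' hxb hw hwb
      (mem_interior_iff_mem_nhds.1 hwi))⟩
  have hsub : P.boundary ⊆ interior P.region := by
    by_contra hsub
    obtain ⟨y, hy, hyi⟩ := not_subset.1 hsub
    obtain ⟨x, hx, hx1, hx2⟩ := isPreconnected_closed_iff.1 P.isPreconnected_boundary _ _ hclosed
      (isOpen_interior (s := P.region)).isClosed_compl
      (fun x hx => by by_cases h : x ∈ interior P.region <;> simp [hx, h])
      ⟨z, hz, hz, mem_interior_iff_mem_nhds.2 hn⟩ ⟨y, hy, hyi⟩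
    exact hx2 hx1.2
  have hopen : IsOpen P.region := by
    refine isOpen_iff_mem_nhds.2 fun x hx => ?_
    rcases hx with hx | hx
    · exact mem_interior_iff_mem_nhds.1 (hsub hx)
    · exact mem_of_superset (P.isOpen_inside.mem_nhds hx) P.inside_subset_region
  rcases isClopen_iff.1 ⟨P.isClosed_region, hopen⟩ with h | h
  · exact (h ▸ P.boundary_subset_region hz : z ∈ (∅ : Set Plane))
  · exact P.region_ne_univ h

end PolygonCurve

/-! ### Interior angles and neighbouring polygons. -/

namespace Polygon2

variable (P : Polygon2)

/-- Near the start point of side `i + 1`, the points in the interior angle are enclosed. -/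
lemma exists_sector_subset_inside (i : P.Idx) : ∃ ρ > 0, sector (P.vertex (i + 1)) ρ
    (P.ang (i + 1)) (P.ang (i + 1) + (Real.pi - P.turn i (i + 1))) ⊆ P.inside := by
  obtain ⟨ρ, hρ, h⟩ := P.localRays_vertex i
  have hτ := P.turn_succ_mem i
  refine ⟨ρ, hρ, ?_⟩
  set γ := Real.pi - P.turn i (i + 1) with hγ
  have hγ0 : 0 < γ := by linarith [hτ.2]
  -- One enclosed point of the sector suffices. Take a point of side `i + 1` at distance `R < ρ`
  -- from the corner and push it left by a small `ε`; relative to the corner and the side it is the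
  -- complex number `R + ε * I`.
  obtain ⟨t, ht0, ht⟩ : ∃ t : ℝ, 0 < t ∧ t < min 1 (ρ / ‖P.dir (i + 1)‖) :=
    exists_between (lt_min one_pos (div_pos hρ (P.norm_dir_pos _)))
  have hd := P.norm_dir_pos (i + 1)
  have htρ : t * ‖P.dir (i + 1)‖ < ρ := (lt_div_iff₀ hd).1 (ht.trans_le (min_le_right _ _))
  have hmem : P.vertex (i + 1) + t • P.dir (i + 1) ∈ P.openEdge (i + 1) :=
    P.mem_openEdge_iff.2 ⟨t, ⟨ht0, ht.trans_le (min_le_left _ _)⟩, rfl⟩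
  have hev := P.ccw (i + 1) _ hmem
  set R := t * ‖P.dir (i + 1)‖ with hR
  have hR0 : 0 < R := mul_pos ht0 hd
  have hcont : ContinuousAt (fun ε : ℝ => (R : ℂ) + ε * Complex.I) 0 := by fun_prop
  have hz : (R : ℂ) + (0 : ℝ) * Complex.I = R := by simp
  have e1 : ∀ᶠ ε : ℝ in 𝓝 0, ‖(R : ℂ) + ε * Complex.I‖ < ρ := by
    refine hcont.norm.eventually_lt_const ?_
    beta_reduce; rw [hz, Complex.norm_real, Real.norm_of_nonneg hR0.le]; exact htρ
  have e2 : ∀ᶠ ε : ℝ in 𝓝 0, Complex.arg ((R : ℂ) + ε * Complex.I) < γ := by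
    have hc : ContinuousAt (fun ε : ℝ => Complex.arg ((R : ℂ) + ε * Complex.I)) 0 := by
      refine ContinuousAt.comp (g := Complex.arg) ?_ hcont
      rw [hz]
      exact Complex.continuousAt_arg (Or.inl (by simpa using hR0))
    refine hc.eventually_lt_const ?_
    beta_reduce; rw [hz, Complex.arg_ofReal_of_nonneg hR0.le]; exact hγ0
  obtain ⟨ε, ⟨⟨hin, h1⟩, h2⟩, hε⟩ := (((hev.and (nhdsWithin_le_nhds e1)).and
    (nhdsWithin_le_nhds e2)).and self_mem_nhdsWithin).exists
  have hε : 0 < ε := hε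
  have him : ((R : ℂ) + ε * Complex.I).im = ε := by simp
  refine h.sector_subset_inside (by linarith [hτ.1]) (x := _) ?_ hin
  have hpt : P.vertex (i + 1) + t • P.dir (i + 1) + ε • P.normal (i + 1) =
      polar (P.vertex (i + 1)) ‖(R : ℂ) + ε * Complex.I‖
        (P.ang (i + 1) + Complex.arg ((R : ℂ) + ε * Complex.I)) := by
    apply cx.injective
    rw [cx_polar, map_add, map_add, cx_smul, cx_smul, P.cx_normal, P.cx_dir_eq]
    have := Complex.norm_mul_exp_arg_mul_I ((R : ℂ) + ε * Complex.I)
    have e : Complex.exp ((P.ang (i + 1) + Complex.arg ((R : ℂ) + ε * Complex.I) : ℝ) *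
        Complex.I) = Complex.exp (P.ang (i + 1) * Complex.I) *
        Complex.exp (Complex.arg ((R : ℂ) + ε * Complex.I) * Complex.I) := by
      rw [← Complex.exp_add]; congr 1; push_cast; ring
    rw [e]
    have hR' : (R : ℂ) = t * ‖P.dir (i + 1)‖ := by rw [hR]; push_cast; ring
    linear_combination (-Complex.exp (P.ang (i + 1) * Complex.I)) * this -
      Complex.exp (P.ang (i + 1) * Complex.I) * hR'
  rw [hpt]
  refine polar_mem_sector ⟨?_, h1⟩ ⟨?_, by linarith⟩
  · rw [norm_pos_iff]; intro h0; rw [h0] at him; simp at him; exact hε.ne him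
  · have h3 : 0 ≤ Complex.arg ((R : ℂ) + ε * Complex.I) := Complex.arg_nonneg_iff.2 (by
      rw [him]; exact hε.le)
    have h4 : Complex.arg ((R : ℂ) + ε * Complex.I) ≠ 0 := fun h0 =>
      hε.ne' (him ▸ (Complex.arg_eq_zero_iff.1 h0).2)
    have := lt_of_le_of_ne h3 h4.symm
    linarith

/-- Near an interior point of a side, the points to the left of the side are enclosed. -/
lemma exists_ball_left {i : P.Idx} {z : Plane} (hz : z ∈ P.openEdge i) : ∃ ρ > 0,
    ∀ x ∈ Metric.ball z ρ, (0 < inner ℝ (x - z) (P.normal i) → x ∈ P.inside) ∧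
      (0 ≤ inner ℝ (x - z) (P.normal i) → x ∈ P.region) := by
  obtain ⟨ρ, hρ, h⟩ := P.localRays_openEdge hz
  have hp := Real.pi_pos
  have hsub : sector z ρ (P.ang i) (P.ang i + Real.pi) ⊆ P.inside := by
    obtain ⟨ε, hin, hε, hερ⟩ := ((P.ccw i z hz).and (Ioo_mem_nhdsGT hρ)).exists
    refine h.sector_subset_inside (by linarith) (x := _) ?_ hin
    have hpt : z + ε • P.normal i = polar z ε (P.ang i + Real.pi / 2) := by
      apply cx.injective
      rw [cx_polar, map_add, cx_smul, P.cx_normal]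
      push_cast
      rw [add_mul, Complex.exp_add, Complex.exp_pi_div_two_mul_I]
      ring
    rw [hpt]
    exact polar_mem_sector ⟨hε, hερ⟩ ⟨by linarith, by linarith⟩
  refine ⟨ρ, hρ, fun x hx => ?_⟩
  by_cases hxz : x = z
  · subst hxz
    simp only [sub_self, inner_zero_left, lt_self_iff_false, false_imp_iff, true_and]
    exact fun _ => P.edge_subset_region i (P.openEdge_subset i hz)
  obtain ⟨r, θ, hr, hθ, rfl⟩ := exists_polar hxz (P.ang i)
  have hrρ : r < ρ := by
    rw [Metric.mem_ball] at hx
    simpa [dist_polar, abs_of_pos hr] using hx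
  rw [P.inner_normal_polar]
  have key : 0 ≤ r * Real.sin (θ - P.ang i) → θ ≤ P.ang i + Real.pi := by
    intro h0
    by_contra! hlt
    have h1 := Real.sin_pos_of_pos_of_lt_pi (x := θ - P.ang i - Real.pi) (by linarith)
      (by linarith [hθ.2])
    rw [Real.sin_sub_pi] at h1
    nlinarith
  constructor
  · intro h0
    have h1 := key h0.le
    refine hsub (polar_mem_sector ⟨hr, hrρ⟩ ⟨lt_of_le_of_ne hθ.1 ?_, lt_of_le_of_ne h1 ?_⟩)
    · intro h2; rw [← h2] at h0; simp at h0
    · intro h2; rw [h2] at h0; simp at h0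
  · intro h0
    exact closure_minimal (hsub.trans P.inside_subset_region) P.isClosed_region
      (polar_mem_closure_sector ⟨hr, hrρ⟩ (by linarith) ⟨hθ.1, key h0⟩)

lemma inside_inter_nhds_vertex (i : P.Idx) {U : Set Plane} (hU : U ∈ 𝓝 (P.vertex i)) :
    (P.inside ∩ U).Nonempty := by
  have h1 : P.edge i ⊆ closure P.inside := by
    rw [← P.closure_openEdge]
    refine closure_minimal (fun z hz => ?_) isClosed_closure
    rw [mem_closure_iff_frequently]
    have hc : Tendsto (fun ε : ℝ => z + ε • P.normal i) (𝓝[>] 0) (𝓝 z) := by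
      have : ContinuousAt (fun ε : ℝ => z + ε • P.normal i) 0 := by fun_prop
      have h := this.tendsto
      simp only [zero_smul, add_zero] at h
      exact h.mono_left nhdsWithin_le_nhds
    exact hc.frequently (P.ccw i z hz).frequently
  obtain ⟨x, hx, hx'⟩ := mem_closure_iff_nhds.1 (h1 (P.vertex_mem_edge i)) U hU
  exact ⟨x, hx', hx⟩

variable {P} {Q : Polygon2}

/-- Two polygons without common interior points have at most a full angle at a common vertex. -/
theorem turn_add_turn_nonneg (h : Disjoint P.inside Q.inside) {i : P.Idx} {j : Q.Idx}
    (hij : P.vertex (i + 1) = Q.vertex (j + 1)) : 0 ≤ P.turn i (i + 1) + Q.turn j (j + 1) := by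
  by_contra! hneg
  obtain ⟨ρ, hρ, hP⟩ := P.exists_sector_subset_inside i
  obtain ⟨ρ', hρ', hQ⟩ := Q.exists_sector_subset_inside j
  rw [hij] at hP
  have hτ := P.turn_succ_mem i
  have hτ' := Q.turn_succ_mem j
  set γ := Real.pi - P.turn i (i + 1)
  set γ' := Real.pi - Q.turn j (j + 1)
  have hγ : 0 < γ := by simp only [γ]; linarith [hτ.2]
  have hγ' : 0 < γ' := by simp only [γ']; linarith [hτ'.2]
  have hsum : 2 * Real.pi < γ + γ' := by simp only [γ, γ']; linarith
  have hp : (0 : ℝ) < 2 * Real.pi := by positivity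
  set ψ := P.ang (i + 1)
  obtain ⟨r, hr, hr'⟩ := exists_between (lt_min hρ hρ')
  have hr1 : r ∈ Ioo 0 ρ := ⟨hr, hr'.trans_le (min_le_left _ _)⟩
  have hr2 : r ∈ Ioo 0 ρ' := ⟨hr, hr'.trans_le (min_le_right _ _)⟩
  -- Shift the first ray of `Q` by full turns to lie at or after that of `P`. Then either it is
  -- within the sector of `P`, or the sector of `Q` extends past `ψ + 2π` and re-enters that of `P`.
  obtain ⟨n, hn⟩ : ∃ n : ℤ, Q.ang (j + 1) + n * (2 * Real.pi) ∈ Ico ψ (ψ + 2 * Real.pi) := by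
    refine ⟨-toIcoDiv hp ψ (Q.ang (j + 1)), ?_⟩
    have := toIcoMod_mem_Ico hp ψ (Q.ang (j + 1))
    rw [toIcoMod, zsmul_eq_mul] at this
    convert this using 1; push_cast; ring
  set ψ' := Q.ang (j + 1) + n * (2 * Real.pi) with hψ'
  by_cases hlt : ψ' < ψ + γ
  · obtain ⟨θ, h1, h2⟩ := exists_between (lt_min hlt (by linarith : ψ' < ψ' + γ'))
    have m1 := hP (polar_mem_sector hr1 (θ := θ) ⟨by linarith [hn.1], h2.trans_le (min_le_left _ _)⟩)
    have m2 := hQ (polar_mem_sector hr2 (θ := θ + (-n : ℤ) * (2 * Real.pi))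
      ⟨by push_cast; linarith, by
        have := h2.trans_le (min_le_right _ _)
        push_cast; linarith⟩)
    rw [polar_add_two_pi] at m2
    exact disjoint_left.1 h m1 m2
  · obtain ⟨θ, h1, h2⟩ := exists_between (lt_min (by linarith : ψ < ψ + γ)
      (by linarith : ψ < ψ' + γ' - 2 * Real.pi))
    have m1 := hP (polar_mem_sector hr1 (θ := θ) ⟨h1, h2.trans_le (min_le_left _ _)⟩)
    have m2 := hQ (polar_mem_sector hr2 (θ := θ + (1 - n : ℤ) * (2 * Real.pi))
      ⟨by push_cast; linarith [hn.2], by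
        have := h2.trans_le (min_le_right _ _)
        push_cast; linarith⟩)
    rw [polar_add_two_pi] at m2
    exact disjoint_left.1 h m1 m2

/-- A common side of two polygons without common interior points is traversed in opposite
directions. -/
theorem vertex_eq_of_edge_eq (h : Disjoint P.inside Q.inside) {i : P.Idx} {j : Q.Idx}
    (hij : P.edge i = Q.edge j) :
    P.vertex i = Q.vertex (j + 1) ∧ P.vertex (i + 1) = Q.vertex j := by
  rcases segment_eq_segment hij with ⟨h1, h2⟩ | h0
  · exfalso
    -- With equal directions both polygons would enclose the points just to the left of the side.
    have hn : P.normal i = Q.normal j := by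
      simp only [PolygonCurve.normal, PolygonCurve.dir, h1, h2]
    obtain ⟨z, hz⟩ := P.openEdge_nonempty i
    have hz' : z ∈ Q.openEdge j := by
      rw [PolygonCurve.openEdge, ← h1, ← h2]; exact hz
    have e1 := P.ccw i z hz
    rw [hn] at e1
    obtain ⟨ε, h3, h4⟩ := (e1.and (Q.ccw j z hz')).exists
    exact disjoint_left.1 h h3 h4
  · exact h0

/-- Two polygons on both sides of a common side cover a neighbourhood of its interior points. -/
theorem region_union_mem_nhds {i : P.Idx} {j : Q.Idx} (h1 : P.vertex i = Q.vertex (j + 1))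
    (h2 : P.vertex (i + 1) = Q.vertex j) {z : Plane} (hz : z ∈ P.openEdge i) :
    P.region ∪ Q.region ∈ 𝓝 z := by
  have hz' : z ∈ Q.openEdge j := by
    rw [PolygonCurve.openEdge, ← h1, ← h2, openSegment_symm]; exact hz
  have hd : Q.dir j = -P.dir i := by
    simp only [PolygonCurve.dir, h1, h2]; abel
  have hn : Q.normal j = -P.normal i := by
    apply cx.injective
    rw [map_neg, PolygonCurve.normal, PolygonCurve.normal, cx_smul, cx_smul, cx_quarterTurn,
      cx_quarterTurn, hd, norm_neg, map_neg]
    ring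
  obtain ⟨ρ, hρ, hP⟩ := P.exists_ball_left hz
  obtain ⟨ρ', hρ', hQ⟩ := Q.exists_ball_left hz'
  filter_upwards [Metric.ball_mem_nhds z hρ, Metric.ball_mem_nhds z hρ'] with x hx hx'
  rcases le_total 0 (inner ℝ (x - z) (P.normal i)) with h0 | h0
  · exact Or.inl ((hP x hx).2 h0)
  · refine Or.inr ((hQ x hx').2 ?_)
    rw [hn, inner_neg_right]; linarith

end Polygon2

/-! ### Winding sums -/

/-- The signed angle under which the segment from `a` to `b` is seen from `x`. -/
def viewAngle (x a b : Plane) : ℝ := Complex.arg ((cx b - cx x) / (cx a - cx x))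

/-- A nonpositive real ratio would place `x` between `a` and `b`. So the view angle varies
continuously as long as `x` stays off the segment. -/
lemma ratio_mem_slitPlane {x a b : Plane} (h : x ∉ segment ℝ a b) :
    (cx b - cx x) / (cx a - cx x) ∈ Complex.slitPlane := by
  by_contra hs
  rw [Complex.mem_slitPlane_iff, not_or, not_lt, not_not] at hs
  have ha : cx a - cx x ≠ 0 := by
    rw [sub_ne_zero]; intro h0
    exact h (cx.injective h0 ▸ left_mem_segment ℝ a b)
  set r := ((cx b - cx x) / (cx a - cx x)).re with hr
  have h1 : (cx b - cx x) / (cx a - cx x) = r := by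
    apply Complex.ext <;> simp [hr, hs.2]
  rw [div_eq_iff ha] at h1
  apply h
  rw [segment_eq_image']
  have h2 : (0 : ℝ) < 1 - r := by linarith [hs.1]
  have h3 : (1 : ℂ) - r ≠ 0 := by exact_mod_cast h2.ne'
  refine ⟨1 / (1 - r), ⟨by positivity, by rw [div_le_one h2]; linarith [hs.1]⟩, ?_⟩
  apply cx.injective
  simp only [map_add, cx_smul, map_sub]
  push_cast
  field_simp
  linear_combination h1

lemma Filter.Tendsto.viewAngle {X : Type*} {l : Filter X} {f g h : X → Plane} {x a b : Plane}
    (hf : Tendsto f l (𝓝 x)) (hg : Tendsto g l (𝓝 a)) (hh : Tendsto h l (𝓝 b))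
    (hx : x ∉ segment ℝ a b) :
    Tendsto (fun t => viewAngle (f t) (g t) (h t)) l (𝓝 (viewAngle x a b)) := by
  have hc : ∀ {k : X → Plane} {y : Plane}, Tendsto k l (𝓝 y) →
      Tendsto (fun t => cx (k t)) l (𝓝 (cx y)) := fun hk => (cx.continuous.tendsto _).comp hk
  have ha : cx a - cx x ≠ 0 := by
    rw [sub_ne_zero]; intro h0
    exact hx (cx.injective h0 ▸ left_mem_segment ℝ a b)
  exact (Complex.continuousAt_arg (ratio_mem_slitPlane hx)).tendsto.comp
    (((hc hh).sub (hc hf)).div ((hc hg).sub (hc hf)) ha)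

/-- The ratio is a negative real, where the principal argument is `π` and not `-π`. -/
lemma viewAngle_eq_pi {x a b : Plane} (hab : a ≠ b) (hx : x ∈ openSegment ℝ a b) :
    viewAngle x a b = Real.pi := by
  rw [openSegment_eq_image'] at hx
  obtain ⟨t, ht, rfl⟩ := hx
  have h0 : cx b - cx a ≠ 0 := sub_ne_zero.2 (cx.injective.ne hab.symm)
  have ht0 : (t : ℂ) ≠ 0 := by exact_mod_cast ht.1.ne'
  have h1 : (cx b - cx (a + t • (b - a))) / (cx a - cx (a + t • (b - a))) =
      ((-((1 - t) / t) : ℝ) : ℂ) := by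
    simp only [map_add, cx_smul, map_sub]
    have h2 : cx a - (cx a + t * (cx b - cx a)) ≠ 0 := by
      rw [sub_add_cancel_left]; exact neg_ne_zero.2 (mul_ne_zero ht0 h0)
    rw [div_eq_iff h2]
    push_cast
    field_simp
    ring
  rw [viewAngle, h1]
  refine Complex.arg_ofReal_of_neg ?_
  have := div_pos (sub_pos.2 ht.2) ht.1
  linarith

lemma arg_mem_of_im_pos {z : ℂ} (h : 0 < z.im) : Complex.arg z ∈ Ioo 0 Real.pi := by
  refine ⟨lt_of_le_of_ne (Complex.arg_nonneg_iff.2 h.le) fun h0 => ?_,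
    Complex.arg_lt_pi_iff.2 (Or.inr h.ne')⟩
  exact h.ne' (Complex.arg_eq_zero_iff.1 h0.symm).2

lemma arg_mem_of_im_neg {z : ℂ} (h : z.im < 0) : Complex.arg z ∈ Ioo (-Real.pi) 0 :=
  ⟨Complex.neg_pi_lt_arg z, Complex.arg_neg_iff.2 h⟩

namespace PolygonCurve

variable {P : PolygonCurve}

/-- For `x ≠ a` the imaginary part of the ratio is a positive multiple of the signed distance of `x`
from the line of the side. -/
lemma viewAngle_sign {i : P.Idx} {x a b : Plane} {l : ℝ} (hl : 0 < l)
    (hab : b - a = l • P.dir i) :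
    (0 < inner ℝ (x - a) (P.normal i) → viewAngle x a b ∈ Ioo 0 Real.pi) ∧
    (inner ℝ (x - a) (P.normal i) < 0 → viewAngle x a b ∈ Ioo (-Real.pi) 0) := by
  by_cases hxa : x = a
  · simp [hxa]
  have hz : cx a - cx x ≠ 0 := sub_ne_zero.2 (cx.injective.ne (Ne.symm hxa))
  have hn : 0 < Complex.normSq (cx a - cx x) := Complex.normSq_pos.2 hz
  have hd := P.norm_dir_pos i
  have h1 : ((cx b - cx x) / (cx a - cx x)).im =
      l * ‖P.dir i‖ * inner ℝ (x - a) (P.normal i) / Complex.normSq (cx a - cx x) := by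
    have hb : cx b = cx a + l * (‖P.dir i‖ * Complex.exp (P.ang i * Complex.I)) := by
      rw [← P.cx_dir_eq, ← cx_smul, ← hab, map_sub]; ring
    rw [inner_eq_re, P.cx_normal, hb, Complex.div_im, cx.map_sub]
    simp only [Complex.add_re, Complex.add_im, Complex.sub_re, Complex.sub_im, Complex.mul_re,
      Complex.mul_im, Complex.ofReal_re, Complex.ofReal_im, Complex.I_re, Complex.I_im,
      Complex.conj_re, Complex.conj_im]
    field_simp
    ring
  have hpos : 0 < l * ‖P.dir i‖ := mul_pos hl hd
  constructor
  · intro h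
    exact arg_mem_of_im_pos (by rw [h1]; positivity)
  · intro h
    refine arg_mem_of_im_neg ?_
    rw [h1]
    exact div_neg_of_neg_of_pos (mul_neg_of_pos_of_neg hpos h) hn

namespace Wavefront

/-- The sides of the wavefront, side `σ i` following side `i`, form closed curves. -/
def Closed (c : P.Wavefront) (σ : Equiv.Perm P.Idx) : Prop := ∀ i, (c i).2 = (c (σ i)).1

/-- The total angle under which the wavefront is seen from `x`: the winding number up to the factor
`2π`. -/
def windingSum (c : P.Wavefront) (x : Plane) : ℝ := ∑ i, viewAngle x (c i).1 (c i).2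

/-- The same sum without one side. -/
def windingSumErase (c : P.Wavefront) (i : P.Idx) (x : Plane) : ℝ :=
  ∑ j ∈ Finset.univ.erase i, viewAngle x (c j).1 (c j).2

lemma windingSum_eq_add (c : P.Wavefront) (i : P.Idx) (x : Plane) :
    c.windingSum x = viewAngle x (c i).1 (c i).2 + c.windingSumErase i x :=
  (Finset.add_sum_erase _ _ (Finset.mem_univ i)).symm

/-- As `σ` matches ends with starts, the ratios of all sides multiply to 1, and the winding sum is
an argument of this product. -/
lemma Closed.exists_windingSum {c : P.Wavefront} {σ : Equiv.Perm P.Idx} (h : c.Closed σ)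
    {x : Plane} (hx : ∀ i, x ≠ (c i).1) : ∃ n : ℤ, c.windingSum x = n * (2 * Real.pi) := by
  set r : P.Idx → ℂ := fun i => (cx (c i).2 - cx x) / (cx (c i).1 - cx x) with hr
  have hne : ∀ i, cx (c i).1 - cx x ≠ 0 := fun i => sub_ne_zero.2 (cx.injective.ne (hx i).symm)
  have h1 : ∏ i, r i = 1 := by
    rw [Finset.prod_div_distrib, div_eq_one_iff_eq (Finset.prod_ne_zero_iff.2 fun i _ => hne i)]
    rw [← Equiv.prod_comp σ (fun i => cx (c i).1 - cx x)]
    exact Finset.prod_congr rfl fun i _ => by rw [h i]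
  have h2 : ∏ i, r i = (∏ i, ‖r i‖ : ℝ) * Complex.exp (c.windingSum x * Complex.I) := by
    rw [windingSum, Complex.ofReal_sum, Finset.sum_mul, Complex.exp_sum, Complex.ofReal_prod,
      ← Finset.prod_mul_distrib]
    exact Finset.prod_congr rfl fun i _ => (Complex.norm_mul_exp_arg_mul_I _).symm
  have h3 : ∏ i, ‖r i‖ = 1 := by rw [← norm_prod, h1, norm_one]
  rw [h1, h3, Complex.ofReal_one, one_mul] at h2
  obtain ⟨n, hn⟩ := Complex.exp_eq_one_iff.1 h2.symm
  refine ⟨n, ?_⟩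
  have := congrArg Complex.im hn
  simpa using this

/-- The points on the wavefront sides are on the boundary of what the wavefront winds around once
counterclockwise. -/
def Filled (c : P.Wavefront) : Prop :=
  ∀ i, ∀ x ∈ openSegment ℝ (c i).1 (c i).2, c.windingSumErase i x = Real.pi

lemma tendsto_windingSumErase {c : P.Wavefront} (hc : c.Proper) {i : P.Idx} {y : Plane}
    (hy : y ∈ openSegment ℝ (c i).1 (c i).2) :
    Tendsto (c.windingSumErase i) (𝓝 y) (𝓝 (c.windingSumErase i y)) := by
  refine tendsto_finsetSum _ fun j hj => ?_
  exact tendsto_id.viewAngle tendsto_const_nhds tendsto_const_nhds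
    (hc.notMem_segment (Finset.ne_of_mem_erase hj).symm hy)

lemma Proper.ne_start {c : P.Wavefront} (hc : c.Proper) {i : P.Idx} {y : Plane}
    (hy : y ∈ openSegment ℝ (c i).1 (c i).2) (j : P.Idx) : y ≠ (c j).1 := by
  rintro rfl
  by_cases hij : i = j
  · subst hij; exact (ne_of_mem_openSegment (hc.ne i) hy).1 rfl
  · exact hc.notMem_segment hij hy (left_mem_segment _ _ _)

/-- The erased side contributes `π` to a multiple of `2π`. The remaining sum thus takes discrete
values, which makes it rigid under continuous motion. -/
lemma Closed.exists_windingSumErase {c : P.Wavefront} {σ : Equiv.Perm P.Idx} (h : c.Closed σ)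
    (hc : c.Proper) {i : P.Idx} {y : Plane} (hy : y ∈ openSegment ℝ (c i).1 (c i).2) :
    ∃ n : ℤ, c.windingSumErase i y = n * (2 * Real.pi) + Real.pi := by
  obtain ⟨n, hn⟩ := h.exists_windingSum (hc.ne_start hy)
  rw [c.windingSum_eq_add i, viewAngle_eq_pi (hc.ne i) hy] at hn
  exact ⟨n - 1, by push_cast; linarith⟩

lemma eventually_ne_start {c : P.Wavefront} {y : Plane} (h : ∀ j, y ≠ (c j).1) :
    ∀ᶠ z in 𝓝 y, ∀ j, z ≠ (c j).1 :=
  eventually_all.2 fun j => isOpen_ne.mem_nhds (h j)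

/-- Near an interior point of a side, the winding number is `1` on the left and `0` on the right. -/
lemma Filled.eventually_windingSum {c : P.Wavefront} (hf : c.Filled) {σ : Equiv.Perm P.Idx}
    (h : c.Closed σ) (hc : c.Proper) {i : P.Idx} {y : Plane}
    (hy : y ∈ openSegment ℝ (c i).1 (c i).2) :
    ∀ᶠ z in 𝓝 y, (0 < inner ℝ (z - (c i).1) (P.normal i) → c.windingSum z = 2 * Real.pi) ∧
      (inner ℝ (z - (c i).1) (P.normal i) < 0 → c.windingSum z = 0) := by
  obtain ⟨l, hl, hli⟩ := hc.1 i
  have h3 := Real.pi_gt_three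
  have ht := tendsto_windingSumErase hc hy
  rw [hf i y hy] at ht
  -- A tolerance of 1, less than `π`, pins down the integer: the other sides give a value within 1
  -- of `π`, and the own view angle is in `(0, π)` or `(-π, 0)`.
  filter_upwards [eventually_ne_start (hc.ne_start hy), ht.eventually_const_lt
    (show Real.pi - 1 < Real.pi by linarith), ht.eventually_lt_const
    (show Real.pi < Real.pi + 1 by linarith)] with z hz h1 h2
  obtain ⟨n, hn⟩ := h.exists_windingSum hz
  have hs := viewAngle_sign (x := z) hl hli
  have he := c.windingSum_eq_add i z
  constructor
  · intro hpos
    have hv := hs.1 hpos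
    have n1 : (0 : ℝ) < n := by nlinarith [hv.1]
    have n2 : (n : ℝ) < 2 := by nlinarith [hv.2]
    have n1 : 0 < n := by exact_mod_cast n1
    have n2 : n < 2 := by exact_mod_cast n2
    have : n = 1 := by omega
    rw [hn, this]; simp
  · intro hneg
    have hv := hs.2 hneg
    have n1 : (-1 : ℝ) < n := by nlinarith [hv.1]
    have n2 : (n : ℝ) < 1 := by nlinarith [hv.2]
    have n1 : -1 < n := by exact_mod_cast n1
    have n2 : n < 1 := by exact_mod_cast n2
    have : n = 0 := by omega
    rw [hn, this]; simp

end Wavefront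

/-- Two different values would be at least `2π` apart, and the smaller one plus `π` would be
attained although it is not an allowed value. -/
lemma eq_of_isPreconnected {X : Type*} [TopologicalSpace X] {S : Set X} (hS : IsPreconnected S)
    {f : X → ℝ} (hf : ContinuousOn f S) {a : ℝ}
    (hv : ∀ x ∈ S, ∃ n : ℤ, f x = n * (2 * Real.pi) + a) {x y : X} (hx : x ∈ S) (hy : y ∈ S) :
    f x = f y := by
  have key : ∀ x ∈ S, ∀ y ∈ S, ¬ f x < f y := by
    intro x hx y hy hlt
    obtain ⟨m, hm⟩ := hv x hx
    obtain ⟨n, hn⟩ := hv y hy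
    have hp := Real.pi_pos
    have hmn : m + 1 ≤ n := by
      have : (m : ℝ) < n := by nlinarith
      exact_mod_cast this
    have hmn' : (m : ℝ) + 1 ≤ n := by exact_mod_cast hmn
    obtain ⟨z, hz, hfz⟩ := hS.intermediate_value hx hy hf
      (show f x + Real.pi ∈ Icc (f x) (f y) from ⟨by linarith, by nlinarith⟩)
    obtain ⟨k, hk⟩ := hv z hz
    have h1 : (2 * (k - m) : ℝ) = 1 := by
      apply mul_right_cancel₀ hp.ne'; linarith
    have h2 : (2 * (k - m) : ℤ) = 1 := by exact_mod_cast h1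
    omega
  exact le_antisymm (not_lt.1 (key y hy x hx)) (not_lt.1 (key x hx y hy))

namespace Wavefront

lemma Closed.advance {c : P.Wavefront} {σ : Equiv.Perm P.Idx} (h : c.Closed σ) (s : ℝ) :
    (c.advance σ s).Closed σ := by
  intro i
  simp [Wavefront.advance, h i]

lemma advance_zero (c : P.Wavefront) (σ : Equiv.Perm P.Idx) : c.advance σ 0 = c := by
  funext i; simp [Wavefront.advance]

lemma advance_advance (c : P.Wavefront) (σ : Equiv.Perm P.Idx) (s t : ℝ) :
    (c.advance σ s).advance σ t = c.advance σ (s + t) := by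
  funext i
  simp only [Wavefront.advance, add_smul, add_assoc]

lemma continuous_advance_fst (c : P.Wavefront) (σ : Equiv.Perm P.Idx) (i : P.Idx) :
    Continuous fun s => (c.advance σ s i).1 := by
  simp only [Wavefront.advance]; fun_prop

lemma continuous_advance_snd (c : P.Wavefront) (σ : Equiv.Perm P.Idx) (i : P.Idx) :
    Continuous fun s => (c.advance σ s i).2 := by
  simp only [Wavefront.advance]; fun_prop

/-- The other sides never touch the open side `i`, so their sum is continuous in time and in the
position on that side. Its values are odd multiples of `π`, hence it stays at its initial value. -/
lemma Filled.advance {c : P.Wavefront} (hf : c.Filled) {σ : Equiv.Perm P.Idx} (h : c.Closed σ)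
    {d : ℝ} (hd : 0 ≤ d) (hp : ∀ s ∈ Icc 0 d, (c.advance σ s).Proper) {s : ℝ} (hs : s ∈ Icc 0 d) :
    (c.advance σ s).Filled := by
  intro i x hx
  set pt : ℝ × ℝ → Plane := fun q =>
    (c.advance σ q.1 i).1 + q.2 • ((c.advance σ q.1 i).2 - (c.advance σ q.1 i).1) with hpt
  have hptc : Continuous pt := by
    have h1 := (continuous_advance_fst c σ i).comp (continuous_fst (X := ℝ) (Y := ℝ))
    have h2 := (continuous_advance_snd c σ i).comp (continuous_fst (X := ℝ) (Y := ℝ))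
    exact h1.add (continuous_snd.smul (h2.sub h1))
  have hmem : ∀ q ∈ Icc 0 d ×ˢ Ioo (0 : ℝ) 1,
      pt q ∈ openSegment ℝ (c.advance σ q.1 i).1 (c.advance σ q.1 i).2 := by
    intro q hq
    rw [openSegment_eq_image']
    exact ⟨q.2, hq.2, rfl⟩
  set F : ℝ × ℝ → ℝ := fun q => (c.advance σ q.1).windingSumErase i (pt q) with hF
  have hFc : ContinuousOn F (Icc 0 d ×ˢ Ioo (0 : ℝ) 1) := by
    intro q hq
    refine tendsto_finsetSum _ fun j hj => ?_
    refine Tendsto.viewAngle (hptc.tendsto q |>.mono_left nhdsWithin_le_nhds) ?_ ?_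
      ((hp q.1 hq.1).notMem_segment (Finset.ne_of_mem_erase hj).symm (hmem q hq))
    · exact (((continuous_advance_fst c σ j).comp continuous_fst).tendsto q).mono_left
        nhdsWithin_le_nhds
    · exact (((continuous_advance_snd c σ j).comp continuous_fst).tendsto q).mono_left
        nhdsWithin_le_nhds
  have hx' := hx
  rw [openSegment_eq_image'] at hx'
  obtain ⟨t, ht, rfl⟩ := hx'
  have hq : (s, t) ∈ Icc 0 d ×ˢ Ioo (0 : ℝ) 1 := ⟨hs, ht⟩
  have hq0 : ((0 : ℝ), t) ∈ Icc 0 d ×ˢ Ioo (0 : ℝ) 1 := ⟨⟨le_rfl, hd⟩, ht⟩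
  have := eq_of_isPreconnected (isPreconnected_Icc.prod isPreconnected_Ioo) hFc
    (a := Real.pi) (fun q hq => (h.advance q.1).exists_windingSumErase (hp q.1 hq.1) (hmem q hq))
    hq hq0
  have h0 := hmem _ hq0
  simp only [hF, advance_zero] at this h0
  rw [hf i _ h0] at this
  exact this

end Wavefront

lemma initialWavefront_closed : P.initialWavefront.Closed (Equiv.addRight 1) := fun _ => rfl

/-- The ratio is `1 + (b - a) / (a - x)`, which tends to 1. -/
lemma tendsto_viewAngle_cobounded (a b : Plane) :
    Tendsto (fun x => viewAngle x a b) (Bornology.cobounded Plane) (𝓝 0) := by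
  have h1 : Tendsto (fun x => cx a - cx x) (Bornology.cobounded Plane)
      (Bornology.cobounded ℂ) := by
    rw [← tendsto_norm_atTop_iff_cobounded]
    refine tendsto_atTop_mono (f := fun x : Plane => ‖x‖ - ‖a‖) (fun x => ?_) ?_
    · rw [← map_sub, cx.norm_map, norm_sub_rev]
      exact norm_sub_norm_le x a
    · exact tendsto_atTop_add_const_right _ _ tendsto_norm_cobounded_atTop
  have h2 : Tendsto (fun x => 1 + (cx b - cx a) * (cx a - cx x)⁻¹) (Bornology.cobounded Plane)
      (𝓝 1) := by
    have := ((tendsto_inv₀_cobounded.comp h1).const_mul (cx b - cx a)).const_add 1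
    simpa using this
  have h3 := (Complex.continuousAt_arg (x := 1) (by simp)).tendsto.comp h2
  rw [Complex.arg_one] at h3
  refine h3.congr' ?_
  filter_upwards [Bornology.isBounded_def.1 (Bornology.isBounded_singleton (x := a))] with x hx
  have : cx a - cx x ≠ 0 := sub_ne_zero.2 (cx.injective.ne (Ne.symm hx))
  simp only [Function.comp, viewAngle]
  congr 1
  field_simp
  ring

/-- The component of `z` is unbounded; the winding sum is constant on it and small far away. -/
lemma windingSum_eq_zero_of_notMem_region {z : Plane} (hz : z ∉ P.region) :
    P.initialWavefront.windingSum z = 0 := by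
  have hzb : z ∉ P.boundary := fun h => hz (Or.inl h)
  have hnb : ¬ Bornology.IsBounded (connectedComponentIn P.boundaryᶜ z) :=
    fun h => hz (Or.inr ⟨hzb, h⟩)
  have hnot : ∀ x ∈ connectedComponentIn P.boundaryᶜ z, ∀ i, x ∉ P.edge i := fun x hx i hi =>
    connectedComponentIn_subset _ _ hx (P.edge_subset_boundary i hi)
  have hlim : Tendsto P.initialWavefront.windingSum (Bornology.cobounded Plane) (𝓝 0) := by
    have := tendsto_finsetSum (Finset.univ : Finset P.Idx) fun i _ =>
      tendsto_viewAngle_cobounded (P.initialWavefront i).1 (P.initialWavefront i).2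
    rw [Finset.sum_const_zero] at this
    exact this
  have hv : ∀ x ∈ connectedComponentIn P.boundaryᶜ z, ∃ n : ℤ,
      P.initialWavefront.windingSum x = n * (2 * Real.pi) + 0 := by
    intro x hx
    obtain ⟨n, hn⟩ := P.initialWavefront_closed.exists_windingSum (x := x)
      (fun i h => hnot x hx i (h ▸ P.vertex_mem_edge i))
    exact ⟨n, by rw [hn, add_zero]⟩
  have hfreq : ∃ᶠ x in Bornology.cobounded Plane, x ∈ connectedComponentIn P.boundaryᶜ z := by
    intro h; exact hnb (Bornology.isBounded_def.2 h)
  obtain ⟨x, ⟨hx1, hx2⟩, hx⟩ := (((hlim.eventually_const_lt (show (-1 : ℝ) < 0 by norm_num)).and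
    (hlim.eventually_lt_const (show (0 : ℝ) < 1 by norm_num))).and_frequently hfreq).exists
  have hcont : ContinuousOn P.initialWavefront.windingSum (connectedComponentIn P.boundaryᶜ z) := by
    intro x hx
    refine tendsto_finsetSum _ fun j _ => ?_
    exact Tendsto.viewAngle (tendsto_id.mono_left nhdsWithin_le_nhds) tendsto_const_nhds
      tendsto_const_nhds (hnot x hx j)
  rw [eq_of_isPreconnected isPreconnected_connectedComponentIn hcont hv
    (mem_connectedComponentIn hzb) hx]
  obtain ⟨n, hn⟩ := hv x hx
  have h3 := Real.pi_gt_three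
  have n1 : (-1 : ℝ) < n := by nlinarith
  have n2 : (n : ℝ) < 1 := by nlinarith
  have n1 : -1 < n := by exact_mod_cast n1
  have n2 : n < 1 := by exact_mod_cast n2
  have : n = 0 := by omega
  rw [hn, this]; simp

end PolygonCurve

/-- Arbitrarily close to `y` there are points outside the region. They lie to the right of the side,
so the side is seen under an angle in `(-π, 0)`, while the whole sum is 0. The other sides therefore
sum to a value in `(0, π)`, and the nearby odd multiple of `π` can only be `π`. -/
lemma Polygon2.initialWavefront_filled (P : Polygon2) : P.initialWavefront.Filled := by
  intro i y hy
  have hy' : y ∈ P.openEdge i := hy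
  obtain ⟨ρ, hρ, hb⟩ := P.exists_ball_left hy'
  have hc := P.initialWavefront_proper
  have h3 := Real.pi_gt_three
  have ht := PolygonCurve.Wavefront.tendsto_windingSumErase hc hy
  set V := P.initialWavefront.windingSumErase i y
  have hfreq : ∃ᶠ z in 𝓝 y, z ∉ P.region := fun h =>
    P.region_notMem_nhds (P.edge_subset_boundary i (P.openEdge_subset i hy'))
      (by simpa using h)
  obtain ⟨z, ⟨⟨h1, h2⟩, hzb⟩, hz⟩ := (((ht.eventually_const_lt (show V - 1 < V by linarith)).and
    (ht.eventually_lt_const (show V < V + 1 by linarith))).and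
    (Metric.ball_mem_nhds y hρ)).and_frequently hfreq |>.exists
  have hneg : inner ℝ (z - y) (P.normal i) < 0 := by
    by_contra! h0
    exact hz ((hb z hzb).2 h0)
  have hline : inner ℝ (z - P.vertex i) (P.normal i) = inner ℝ (z - y) (P.normal i) := by
    obtain ⟨t, -, rfl⟩ := P.mem_openEdge_iff.1 hy'
    have h4 : inner ℝ (P.dir i) (P.normal i) = 0 := by
      rw [inner_plane, PolygonCurve.normal]
      simp [quarterTurn]; ring
    rw [← sub_sub, inner_sub_left (z - P.vertex i), real_inner_smul_left, h4]; simp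
  rw [← hline] at hneg
  have hv := (PolygonCurve.viewAngle_sign (P := P.toPolygonCurve) (x := z) (i := i)
    (a := P.vertex i) (b := P.vertex (i + 1)) one_pos
    (by rw [one_smul]; rfl)).2 hneg
  have h0 := P.windingSum_eq_zero_of_notMem_region hz
  rw [P.initialWavefront.windingSum_eq_add i] at h0
  obtain ⟨n, hn⟩ := P.initialWavefront_closed.exists_windingSumErase hc hy
  have hv1 : -Real.pi < viewAngle z (P.initialWavefront i).1 (P.initialWavefront i).2 := hv.1
  have hv2 : viewAngle z (P.initialWavefront i).1 (P.initialWavefront i).2 < 0 := hv.2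
  change V = _ at hn
  have n1 : (-1 : ℝ) < n := by nlinarith
  have n2 : (n : ℝ) < 1 := by nlinarith
  have n1 : -1 < n := by exact_mod_cast n1
  have n2 : n < 1 := by exact_mod_cast n2
  have : n = 0 := by omega
  change V = _
  rw [hn, this]; simp

/-! ### Normals, turning angles and velocities of corners. -/

namespace PolygonCurve

variable {P : PolygonCurve}

lemma exp_ang_eq (i j : P.Idx) : Complex.exp (P.ang j * Complex.I) =
    Complex.exp (P.ang i * Complex.I) * Complex.exp (P.turn i j * Complex.I) := by
  have h := P.cx_neg_dir_eq i j
  have h1 : Complex.exp ((P.ang j + (Real.pi - P.turn i j) : ℝ) * Complex.I) =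
      - (Complex.exp (P.ang j * Complex.I) / Complex.exp (P.turn i j * Complex.I)) := by
    rw [← Complex.exp_sub, ← neg_one_mul, ← Complex.exp_pi_mul_I, ← Complex.exp_add]
    congr 1; push_cast; ring
  rw [h1, map_neg, norm_neg, P.cx_dir_eq, mul_neg, neg_inj] at h
  have h2 : (‖P.dir i‖ : ℂ) ≠ 0 := by exact_mod_cast (P.norm_dir_pos i).ne'
  rw [mul_left_cancel₀ h2 h, div_mul_cancel₀ _ (Complex.exp_ne_zero _)]

lemma inner_normal (i j : P.Idx) : inner ℝ (P.normal i) (P.normal j) = Real.cos (P.turn i j) := by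
  rw [inner_eq_re, P.cx_normal, P.cx_normal, exp_ang_eq i j]
  have h := Real.sin_sq_add_cos_sq (P.ang i)
  simp only [Complex.mul_re, Complex.mul_im, Complex.I_re, Complex.I_im, Complex.conj_re,
    Complex.conj_im, Complex.exp_ofReal_mul_I_re, Complex.exp_ofReal_mul_I_im]
  linear_combination Real.cos (P.turn i j) * h

lemma inner_normal_self (i : P.Idx) : inner ℝ (P.normal i) (P.normal i) = 1 := by
  rw [inner_normal, turn_self, Real.cos_zero]

lemma inner_dir_normal (i : P.Idx) : inner ℝ (P.dir i) (P.normal i) = 0 := by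
  rw [inner_plane, PolygonCurve.normal]
  simp [quarterTurn]; ring

lemma cos_half_turn_pos {i j : P.Idx} (h : P.turn i j ∈ Ioo (-Real.pi) Real.pi) :
    0 < Real.cos (P.turn i j / 2) :=
  Real.cos_pos_of_mem_Ioo ⟨by linarith [h.1], by linarith [h.2]⟩

lemma one_add_cos_turn (i j : P.Idx) :
    1 + Real.cos (P.turn i j) = 2 * Real.cos (P.turn i j / 2) ^ 2 := by
  rw [Real.cos_sq]; ring_nf

lemma inner_miter_right {i j : P.Idx} (h : P.turn i j ∈ Ioo (-Real.pi) Real.pi) :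
    inner ℝ (miterVelocity (P.normal i) (P.normal j)) (P.normal j) = 1 := by
  have h1 : 1 + Real.cos (P.turn i j) ≠ 0 := by
    rw [one_add_cos_turn]; have := cos_half_turn_pos h; positivity
  rw [miterVelocity, real_inner_smul_left, inner_add_left, inner_normal_self,
    inner_normal, add_comm (Real.cos _), inv_mul_cancel₀ h1]

/-- A corner moves along the bisector with speed `1 / cos (turn / 2)`. -/
lemma cx_miter {i j : P.Idx} (h : P.turn i j ∈ Ioo (-Real.pi) Real.pi) :
    cx (miterVelocity (P.normal i) (P.normal j)) = ((Real.cos (P.turn i j / 2))⁻¹ : ℝ) *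
      Complex.exp ((P.ang i + P.turn i j / 2 + Real.pi / 2 : ℝ) * Complex.I) := by
  have hc := cos_half_turn_pos h
  have hc' : (Real.cos (P.turn i j / 2) : ℂ) ≠ 0 := by exact_mod_cast hc.ne'
  have e1 : Complex.exp (P.turn i j * Complex.I) = Complex.exp ((P.turn i j / 2 : ℝ) * Complex.I) *
      Complex.exp ((P.turn i j / 2 : ℝ) * Complex.I) := by
    rw [← Complex.exp_add]; congr 1; push_cast; ring
  have e2 : Complex.exp ((P.ang i + P.turn i j / 2 + Real.pi / 2 : ℝ) * Complex.I) =
      Complex.exp (P.ang i * Complex.I) * Complex.exp ((P.turn i j / 2 : ℝ) * Complex.I) *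
        Complex.I := by
    have : Complex.exp ((P.ang i + P.turn i j / 2 + Real.pi / 2 : ℝ) * Complex.I) =
        Complex.exp (P.ang i * Complex.I) * Complex.exp ((P.turn i j / 2 : ℝ) * Complex.I) *
          Complex.exp (Real.pi / 2 * Complex.I) := by
      rw [← Complex.exp_add, ← Complex.exp_add]
      congr 1; push_cast; ring
    rw [this, Complex.exp_pi_div_two_mul_I]
  rw [miterVelocity, cx_smul, map_add, P.cx_normal, P.cx_normal, exp_ang_eq i j, inner_normal,
    one_add_cos_turn, e2, e1]
  have h3 : Complex.exp ((P.turn i j / 2 : ℝ) * Complex.I) =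
      (Real.cos (P.turn i j / 2) : ℂ) + Real.sin (P.turn i j / 2) * Complex.I := by
    rw [Complex.exp_mul_I, Complex.ofReal_cos, Complex.ofReal_sin]
  have h4 : (Real.sin (P.turn i j / 2) : ℂ) ^ 2 + (Real.cos (P.turn i j / 2) : ℂ) ^ 2 = 1 := by
    exact_mod_cast Real.sin_sq_add_cos_sq _
  rw [h3]
  push_cast at *
  field_simp
  linear_combination -h4 + Complex.sin (P.turn i j / 2) ^ 2 * Complex.I_sq

lemma arg_mul_exp {r θ : ℝ} (hr : 0 < r) (hθ : θ ∈ Ioo (-Real.pi) Real.pi) :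
    Complex.arg (r * Complex.exp (θ * Complex.I)) = θ := by
  rw [Complex.exp_mul_I]
  exact Complex.arg_mul_cos_add_sin_mul_I hr ⟨hθ.1, hθ.2.le⟩

lemma mul_exp_mem_slitPlane {r θ : ℝ} (hr : 0 < r) (hθ : θ ∈ Ioo (-Real.pi) Real.pi) :
    r * Complex.exp (θ * Complex.I) ∈ Complex.slitPlane := by
  rw [Complex.mem_slitPlane_iff_arg, arg_mul_exp hr hθ]
  exact ⟨hθ.2.ne, mul_ne_zero (by exact_mod_cast hr.ne') (Complex.exp_ne_zero _)⟩

/-! ### Reading the winding number from a visible side. -/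

namespace Wavefront

/-- From a point off the wavefront one can see an interior point of a side; which side of that side
the point lies on determines the winding number. -/
lemma Filled.exists_visible {c : P.Wavefront} (hf : c.Filled) {σ : Equiv.Perm P.Idx}
    (h : c.Closed σ) (hc : c.Proper) {p : Plane} {ρ : ℝ} {i : P.Idx}
    (hi : (segment ℝ (c i).1 (c i).2 ∩ Metric.ball p ρ).Nonempty)
    (hne : ∀ j, (segment ℝ (c j).1 (c j).2 ∩ Metric.ball p ρ).Nonempty →
      inner ℝ (p - (c j).1) (P.normal j) ≠ 0) :
    ∃ j, (segment ℝ (c j).1 (c j).2 ∩ Metric.ball p ρ).Nonempty ∧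
      (0 < inner ℝ (p - (c j).1) (P.normal j) → c.windingSum p = 2 * Real.pi) ∧
      (inner ℝ (p - (c j).1) (P.normal j) < 0 → c.windingSum p = 0) := by
  have hρ : 0 < ρ := by
    obtain ⟨x, -, hx⟩ := hi
    exact dist_nonneg.trans_lt hx
  have hline : ∀ j, ∀ x ∈ segment ℝ (c j).1 (c j).2,
      inner ℝ (x - (c j).1) (P.normal j) = 0 := by
    intro j x hx
    obtain ⟨l, -, hl⟩ := hc.1 j
    rw [segment_eq_image'] at hx
    obtain ⟨t, -, rfl⟩ := hx
    rw [add_sub_cancel_left, hl, smul_smul, real_inner_smul_left, inner_dir_normal, mul_zero]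
  have hpn : ∀ j, p ∉ segment ℝ (c j).1 (c j).2 := fun j hj =>
    hne j ⟨p, hj, Metric.mem_ball_self hρ⟩ (hline j p hj)
  obtain ⟨x₁, hx₁, hx₁'⟩ : (openSegment ℝ (c i).1 (c i).2 ∩ Metric.ball p ρ).Nonempty := by
    obtain ⟨x, hx, hxb⟩ := hi
    rw [← closure_openSegment] at hx
    obtain ⟨y, hy, hy'⟩ := mem_closure_iff_nhds.1 hx _ (Metric.isOpen_ball.mem_nhds hxb)
    exact ⟨y, hy', hy⟩
  -- The target on side `i` is chosen so that the line of sight from `p` avoids all corners.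
  -- Otherwise, by pigeonhole, one corner would block two different points of the side.
  obtain ⟨x₀, hx₀s, hx₀b, hx₀⟩ : ∃ x ∈ segment ℝ (c i).1 (c i).2, x ∈ Metric.ball p ρ ∧
      ∀ j, (c j).1 ∉ segment ℝ p x := by
    by_contra! hbad
    rw [openSegment_eq_image'] at hx₁
    obtain ⟨t₁, ht₁, rfl⟩ := hx₁
    set g : ℝ → Plane := fun t => (c i).1 + t • ((c i).2 - (c i).1) with hg
    have hgc : Continuous g := by fun_prop
    set S : Set ℝ := {t | t ∈ Ioo (0 : ℝ) 1 ∧ g t ∈ Metric.ball p ρ} with hS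
    have hSn : S ∈ 𝓝 t₁ :=
      inter_mem (Ioo_mem_nhds ht₁.1 ht₁.2) (hgc.continuousAt.preimage_mem_nhds
        (Metric.isOpen_ball.mem_nhds hx₁'))
    have hgs : ∀ t ∈ S, g t ∈ segment ℝ (c i).1 (c i).2 := by
      intro t ht
      rw [segment_eq_image']
      exact ⟨t, ⟨ht.1.1.le, ht.1.2.le⟩, rfl⟩
    have hex : ∀ t, ∃ j, t ∈ S → (c j).1 ∈ segment ℝ p (g t) := by
      intro t
      by_cases ht : t ∈ S
      · obtain ⟨j, hj⟩ := hbad _ (hgs t ht) ht.2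
        exact ⟨j, fun _ => hj⟩
      · exact ⟨i, fun h => absurd h ht⟩
    choose f hf' using hex
    obtain ⟨t, ht, t', ht', htt, hff⟩ := (infinite_of_mem_nhds t₁ hSn).exists_ne_map_eq_of_mapsTo
      (f := f) (mapsTo_univ _ _) finite_univ
    have m1 := hf' t ht
    have m2 := hf' t' ht'
    rw [← hff] at m2
    rw [segment_eq_image'] at m1 m2
    obtain ⟨a, -, ha⟩ := m1
    obtain ⟨b, -, hb⟩ := m2
    simp only at ha hb
    have hh := hne i ⟨_, hgs t ht, ht.2⟩
    have e1 : ∀ t ∈ S, inner ℝ (g t - p) (P.normal i) =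
        - inner ℝ (p - (c i).1) (P.normal i) := by
      intro t ht
      have h0 := hline i _ (hgs t ht)
      have : g t - p = (g t - (c i).1) - (p - (c i).1) := by abel
      rw [this, inner_sub_left (g t - (c i).1), h0, zero_sub]
    have hab : a • (g t - p) = b • (g t' - p) := by
      rw [← add_left_cancel_iff (a := p), ha, hb]
    -- Both target points have the same nonzero signed distance from `p` along the normal, so the
    -- blocking corner has the same parameter on both lines of sight.
    have hab' : a = b := by
      have := congrArg (fun x => inner ℝ x (P.normal i)) hab
      simp only [real_inner_smul_left, e1 t ht, e1 t' ht'] at this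
      exact mul_right_cancel₀ (neg_ne_zero.2 hh) this
    subst hab'
    by_cases ha0 : a = 0
    · rw [ha0, zero_smul, add_zero] at ha
      exact hpn (f t) (Eq.subst (motive := fun z => z ∈ segment ℝ (c (f t)).1 (c (f t)).2) ha.symm
        (left_mem_segment _ _ _))
    · have h3 := smul_right_injective _ ha0 hab
      have h4 : (t - t') • ((c i).2 - (c i).1) = 0 := by
        have : g t = g t' := sub_left_injective h3
        simp only [hg, add_left_cancel_iff] at this
        rw [sub_smul, this, sub_self]
      rcases smul_eq_zero.1 h4 with h5 | h5
      · exact htt (sub_eq_zero.1 h5)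
      · exact hc.ne i (sub_eq_zero.1 h5).symm
  set q : ℝ → Plane := fun t => p + t • (x₀ - p) with hq
  have hqc : Continuous q := by fun_prop
  set T : Set ℝ := Icc 0 1 ∩ ⋃ j, q ⁻¹' segment ℝ (c j).1 (c j).2 with hT
  have hTc : IsCompact T := isCompact_Icc.inter_right
    (isClosed_iUnion_of_finite fun j => (isCompact_segment _ _).isClosed.preimage hqc)
  have hT1 : (1 : ℝ) ∈ T := ⟨by simp, mem_iUnion.2 ⟨i, by simpa [hq] using hx₀s⟩⟩
  have hmem := hTc.sInf_mem ⟨1, hT1⟩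
  -- The parameter of the first hit. It is not at a corner, and the winding sum is constant before
  -- it.
  set τ := sInf T with hτ
  obtain ⟨j, hj⟩ := mem_iUnion.1 hmem.2
  have hqs : ∀ t ∈ Icc (0 : ℝ) 1, q t ∈ segment ℝ p x₀ := by
    intro t ht
    rw [segment_eq_image']; exact ⟨t, ht, rfl⟩
  have hqb : ∀ t ∈ Icc (0 : ℝ) 1, q t ∈ Metric.ball p ρ := fun t ht =>
    (convex_ball p ρ).segment_subset (Metric.mem_ball_self hρ) hx₀b (hqs t ht)
  have hτ0 : 0 < τ := by
    refine lt_of_le_of_ne hmem.1.1 fun h0 => ?_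
    have : q τ = p := by rw [← h0]; simp [hq]
    exact hpn j (this ▸ hj)
  have hjo : q τ ∈ openSegment ℝ (c j).1 (c j).2 := by
    refine mem_openSegment_of_ne hj (fun h0 => ?_) (fun h0 => ?_)
    · exact hx₀ j (h0 ▸ hqs τ hmem.1)
    · rw [h j] at h0
      exact hx₀ (σ j) (h0 ▸ hqs τ hmem.1)
  have hoff : ∀ t ∈ Ico 0 τ, ∀ k, q t ∉ segment ℝ (c k).1 (c k).2 := by
    intro t ht k hk
    have : t ∈ T := ⟨⟨ht.1, ht.2.le.trans hmem.1.2⟩, mem_iUnion.2 ⟨k, hk⟩⟩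
    exact absurd (csInf_le hTc.bddBelow this) (not_le.2 ht.2)
  have hcont : ContinuousOn (fun t => c.windingSum (q t)) (Ico 0 τ) := by
    intro t ht
    refine tendsto_finsetSum _ fun k _ => ?_
    exact Tendsto.viewAngle ((hqc.tendsto t).mono_left nhdsWithin_le_nhds) tendsto_const_nhds
      tendsto_const_nhds (hoff t ht k)
  have hconst : ∀ t ∈ Ico 0 τ, c.windingSum (q t) = c.windingSum p := by
    intro t ht
    have := eq_of_isPreconnected isPreconnected_Ico hcont (a := 0) (fun t ht => by
      obtain ⟨n, hn⟩ := h.exists_windingSum (x := q t)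
        (fun k hk => hoff t ht k (hk ▸ left_mem_segment ℝ _ _))
      exact ⟨n, by rw [hn, add_zero]⟩) ht ⟨le_rfl, hτ0⟩
    simpa [hq] using this
  have hevt := (hqc.tendsto τ).eventually (hf.eventually_windingSum h hc hjo)
  obtain ⟨t, ⟨ht1, ht2⟩, ht⟩ := ((hevt.filter_mono nhdsWithin_le_nhds).and
    (Ioo_mem_nhdsLT hτ0)).exists
  -- Along the line of sight the signed distance to the line of side `j` decreases linearly to 0 at
  -- `τ`, so its sign there is that at `p`.
  have hin : inner ℝ (q t - (c j).1) (P.normal j) =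
      (1 - t / τ) * inner ℝ (p - (c j).1) (P.normal j) := by
    have h0 := hline j _ hj
    have e1 : q τ - (c j).1 = (p - (c j).1) + τ • (x₀ - p) := by simp only [hq]; abel
    have e2 : q t - (c j).1 = (p - (c j).1) + t • (x₀ - p) := by simp only [hq]; abel
    rw [e1, inner_add_left (p - (c j).1), real_inner_smul_left] at h0
    rw [e2, inner_add_left (p - (c j).1), real_inner_smul_left]
    field_simp
    linear_combination t * h0
  have hpos : 0 < 1 - t / τ := by
    rw [sub_pos, div_lt_one hτ0]; exact ht.2
  refine ⟨j, ⟨q τ, hj, hqb τ hmem.1⟩, fun h0 => ?_, fun h0 => ?_⟩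
  · rw [← hconst t ⟨ht.1.le, ht.2⟩]
    exact ht1 (by rw [hin]; positivity)
  · rw [← hconst t ⟨ht.1.le, ht.2⟩]
    exact ht2 (by rw [hin]; exact mul_neg_of_pos_of_neg hpos h0)

end Wavefront

end PolygonCurve

/-! ### Balance of turning angles at a point where corners meet. -/

namespace PolygonCurve

namespace Wavefront

variable {P : PolygonCurve}

/-- By compactness of the parameter interval, a side not through `p` stays away from `p` for a short
time. -/
lemma eventually_mem_segment (c : P.Wavefront) (σ : Equiv.Perm P.Idx) (p : Plane) :
    ∀ᶠ q : ℝ × Plane in 𝓝 (0, p), ∀ j,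
      q.2 ∈ segment ℝ (c.advance σ q.1 j).1 (c.advance σ q.1 j).2 →
        p ∈ segment ℝ (c j).1 (c j).2 := by
  rw [eventually_all]
  intro j
  by_cases hp : p ∈ segment ℝ (c j).1 (c j).2
  · exact Eventually.of_forall fun _ _ => hp
  set g : (ℝ × Plane) × ℝ → Plane := fun q => (c.advance σ q.1.1 j).1 +
    q.2 • ((c.advance σ q.1.1 j).2 - (c.advance σ q.1.1 j).1) with hg
  have hgc : Continuous g := by
    have h1 := (continuous_advance_fst c σ j).comp
      (continuous_fst.comp (continuous_fst (X := ℝ × Plane) (Y := ℝ)))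
    have h2 := (continuous_advance_snd c σ j).comp
      (continuous_fst.comp (continuous_fst (X := ℝ × Plane) (Y := ℝ)))
    exact h1.add (continuous_snd.smul (h2.sub h1))
  have := (isCompact_Icc (a := (0 : ℝ)) (b := 1)).eventually_forall_of_forall_eventually
    (x₀ := ((0 : ℝ), p)) (P := fun q t => q.2 ≠ g (q, t)) (fun t ht => by
      have h1 : Continuous fun q : (ℝ × Plane) × ℝ => q.1.2 := by fun_prop
      refine (isOpen_ne_fun h1 hgc).mem_nhds (x := ((0, p), t)) ?_
      simp only [hg, advance_zero, ne_eq, mem_ofPred_eq]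
      rintro h0
      apply hp
      rw [segment_eq_image']
      exact ⟨t, ht, h0.symm⟩)
  filter_upwards [this] with q hq hq'
  rw [segment_eq_image'] at hq'
  obtain ⟨t, ht, h0⟩ := hq'
  exact absurd h0.symm (hq t ht)

variable {c : P.Wavefront} {σ : Equiv.Perm P.Idx}

lemma Proper.turn_mem (hc : c.Proper) (h : c.Closed σ) (i : P.Idx) :
    P.turn i (σ i) ∈ Ioo (-Real.pi) Real.pi := hc.abs_turn_lt (h i)

lemma Proper.turn_mem' (hc : c.Proper) (h : c.Closed σ) (i : P.Idx) :
    P.turn (σ.symm i) i ∈ Ioo (-Real.pi) Real.pi := by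
  have := hc.turn_mem h (σ.symm i)
  rwa [Equiv.apply_symm_apply] at this

/-- The line of side `j` moves with unit speed towards its left while `p` stays behind; negative `t`
is allowed. -/
lemma inner_advance (hc : c.Proper) (h : c.Closed σ) {p : Plane} {j : P.Idx}
    (hp : p ∈ segment ℝ (c j).1 (c j).2) (t : ℝ) :
    inner ℝ (p - (c.advance σ t j).1) (P.normal j) = -t := by
  obtain ⟨l, -, hl⟩ := hc.1 j
  rw [segment_eq_image'] at hp
  obtain ⟨r, -, rfl⟩ := hp
  simp only [advance]
  rw [add_sub_add_left_eq_sub, hl, smul_smul, inner_sub_left _ (t • _), real_inner_smul_left,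
    real_inner_smul_left, inner_dir_normal, inner_miter_right (hc.turn_mem' h j)]
  ring

/-- Here `κ = -1` stands for the time just before the event and `κ = 1` for just after it. Before,
`p` is to the left of every nearby side, afterwards to the right, so any visible side yields `2π` or
0 respectively. -/
lemma eventually_windingSum_advance (hc : c.Proper) (h : c.Closed σ) {κ : ℝ}
    (hκ : κ = 1 ∨ κ = -1)
    (hev : ∀ᶠ s in 𝓝[>] (0 : ℝ), (c.advance σ (κ * s)).Proper ∧ (c.advance σ (κ * s)).Filled)
    (i : P.Idx) : ∀ᶠ s in 𝓝[>] (0 : ℝ),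
      (c.advance σ (κ * s)).windingSum (c i).2 = Real.pi * (1 - κ) := by
  set p := (c i).2 with hp
  have h1 := c.eventually_mem_segment σ p
  rw [nhds_prod_eq, eventually_prod_iff] at h1
  obtain ⟨A, hA, B, hB, hAB⟩ := h1
  obtain ⟨ρ, hρ, hB⟩ := Metric.eventually_nhds_iff_ball.1 hB
  have hk : Tendsto (fun s => κ * s) (𝓝[>] (0 : ℝ)) (𝓝 0) := by
    have : ContinuousAt (fun s : ℝ => κ * s) 0 := by fun_prop
    have h := this.tendsto
    simp only [mul_zero] at h
    exact h.mono_left nhdsWithin_le_nhds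
  have hend : Tendsto (fun s => (c.advance σ (κ * s) i).2) (𝓝[>] (0 : ℝ)) (𝓝 p) := by
    have := (continuous_advance_snd c σ i).tendsto 0
    rw [advance_zero] at this
    exact this.comp hk
  filter_upwards [hev, hk.eventually hA, hend (Metric.ball_mem_nhds p hρ), self_mem_nhdsWithin]
    with s hs hsA hsb hs0
  have hs0 : 0 < s := hs0
  have hin : ∀ j, (segment ℝ (c.advance σ (κ * s) j).1 (c.advance σ (κ * s) j).2 ∩
      Metric.ball p ρ).Nonempty →
      inner ℝ (p - (c.advance σ (κ * s) j).1) (P.normal j) = -(κ * s) := by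
    rintro j ⟨x, hx, hxb⟩
    exact inner_advance hc h (hAB hsA (hB x hxb) j hx) _
  have hne : κ * s ≠ 0 := by rcases hκ with rfl | rfl <;> simp [hs0.ne']
  obtain ⟨j, hj, h2, h3⟩ := hs.2.exists_visible (h.advance _) hs.1
    ⟨_, right_mem_segment ℝ _ _, hsb⟩ (fun j hj => by
      rw [hin j hj]; exact neg_ne_zero.2 hne)
  rw [hin j hj] at h2 h3
  rcases hκ with rfl | rfl
  · rw [h3 (by linarith)]; ring
  · rw [h2 (by linarith)]; ring

lemma tendsto_arg_of_exp {X : Type*} {l : Filter X} {f : X → ℂ} {r θ : ℝ} (hr : 0 < r)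
    (hθ : θ ∈ Ioo (-Real.pi) Real.pi)
    (hf : Tendsto f l (𝓝 (r * Complex.exp (θ * Complex.I)))) :
    Tendsto (fun x => Complex.arg (f x)) l (𝓝 θ) := by
  have := (Complex.continuousAt_arg (mul_exp_mem_slitPlane hr hθ)).tendsto.comp hf
  rwa [arg_mul_exp hr hθ] at this

lemma exp_sub_kappa {κ : ℝ} (hκ : κ = 1 ∨ κ = -1) (θ : ℝ) :
    Complex.exp ((θ - κ * (Real.pi / 2) : ℝ) * Complex.I) =
      -κ * Complex.I * Complex.exp (θ * Complex.I) := by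
  have h := Complex.exp_pi_div_two_mul_I
  rcases hκ with rfl | rfl
  · have : ((θ - 1 * (Real.pi / 2) : ℝ) : ℂ) * Complex.I =
      θ * Complex.I - Real.pi / 2 * Complex.I := by push_cast; ring
    rw [this, Complex.exp_sub, h, div_eq_iff Complex.I_ne_zero]
    push_cast
    linear_combination (Complex.exp (θ * Complex.I)) * Complex.I_sq
  · have : ((θ - (-1) * (Real.pi / 2) : ℝ) : ℂ) * Complex.I =
      θ * Complex.I + Real.pi / 2 * Complex.I := by push_cast; ring
    rw [this, Complex.exp_add, h]
    push_cast
    ring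

lemma cx_miter' {i j : P.Idx} (h : P.turn i j ∈ Ioo (-Real.pi) Real.pi) :
    cx (miterVelocity (P.normal i) (P.normal j)) = ((Real.cos (P.turn i j / 2))⁻¹ : ℝ) *
      (Complex.I * Complex.exp (P.ang i * Complex.I) *
        Complex.exp ((P.turn i j / 2 : ℝ) * Complex.I)) := by
  rw [cx_miter h]
  have : ((P.ang i + P.turn i j / 2 + Real.pi / 2 : ℝ) : ℂ) * Complex.I =
      P.ang i * Complex.I + (P.turn i j / 2 : ℝ) * Complex.I + Real.pi / 2 * Complex.I := by
    push_cast; ring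
  rw [this, Complex.exp_add, Complex.exp_add, Complex.exp_pi_div_two_mul_I]
  ring

lemma half_turn_mem {κ τ : ℝ} (hκ : κ = 1 ∨ κ = -1) (h : τ ∈ Ioo (-Real.pi) Real.pi) :
    τ / 2 - κ * (Real.pi / 2) ∈ Ioo (-Real.pi) Real.pi := by
  rcases hκ with rfl | rfl <;> exact ⟨by linarith [h.1, h.2], by linarith [h.1, h.2]⟩

lemma tendsto_kappa (κ : ℝ) : Tendsto (fun s => κ * s) (𝓝[>] (0 : ℝ)) (𝓝 0) := by
  have : ContinuousAt (fun s : ℝ => κ * s) 0 := by fun_prop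
  have h := this.tendsto
  simp only [mul_zero] at h
  exact h.mono_left nhdsWithin_le_nhds

/-- From the old end point the start of the side is seen in direction `ang i + π` in the limit, and
the displaced end along the bisector in direction `ang i + turn / 2 + κ * π / 2`, up to full turns.
-/
lemma tendsto_viewAngle_end (hc : c.Proper) (h : c.Closed σ) {κ : ℝ} (hκ : κ = 1 ∨ κ = -1)
    (i : P.Idx) : Tendsto (fun s => viewAngle (c i).2 (c.advance σ (κ * s) i).1
      (c.advance σ (κ * s) i).2) (𝓝[>] (0 : ℝ))
      (𝓝 (P.turn i (σ i) / 2 - κ * (Real.pi / 2))) := by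
  have hτ := hc.turn_mem h i
  obtain ⟨l, hl, hl'⟩ := hc.1 i
  have hd := P.norm_dir_pos i
  have hcos := cos_half_turn_pos hτ
  set w := miterVelocity (P.normal i) (P.normal (σ i)) with hw
  have hkk : (κ : ℂ) * κ = 1 := by rcases hκ with rfl | rfl <;> norm_num
  have hden : cx (c i).1 - cx (c i).2 = -(l * cx (P.dir i)) := by
    rw [← cx_smul, ← hl', map_sub]; ring
  have hd0 : cx (c i).1 - cx (c i).2 ≠ 0 := by
    rw [hden]; exact neg_ne_zero.2 (mul_ne_zero (by exact_mod_cast hl.ne') (P.cx_dir_ne_zero i))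
  have hstart : Tendsto (fun s => cx (c.advance σ (κ * s) i).1) (𝓝[>] (0 : ℝ))
      (𝓝 (cx (c i).1)) := by
    have := (continuous_advance_fst c σ i).tendsto 0
    rw [advance_zero] at this
    exact (cx.continuous.tendsto _).comp (this.comp (tendsto_kappa κ))
  have hlim := (tendsto_const_nhds (x := κ * cx w)).div
    (hstart.sub (tendsto_const_nhds (x := cx (c i).2))) hd0
  have hval : κ * cx w / (cx (c i).1 - cx (c i).2) =
      ((Real.cos (P.turn i (σ i) / 2))⁻¹ / (l * ‖P.dir i‖) : ℝ) *
        Complex.exp ((P.turn i (σ i) / 2 - κ * (Real.pi / 2) : ℝ) * Complex.I) := by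
    rw [hden, exp_sub_kappa hκ, hw, cx_miter' hτ, P.cx_dir_eq i]
    have h1 : (l : ℂ) ≠ 0 := by exact_mod_cast hl.ne'
    have h2 : (‖P.dir i‖ : ℂ) ≠ 0 := by exact_mod_cast hd.ne'
    have h3 : ((Real.cos (P.turn i (σ i) / 2) : ℝ) : ℂ) ≠ 0 := by exact_mod_cast hcos.ne'
    have h4 := Complex.exp_ne_zero (P.ang i * Complex.I)
    simp only [Complex.ofReal_div, Complex.ofReal_inv, Complex.ofReal_mul]
    field_simp
  rw [hval] at hlim
  have := tendsto_arg_of_exp (by positivity) (half_turn_mem hκ hτ) hlim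
  refine this.congr' ?_
  filter_upwards [self_mem_nhdsWithin] with s hs
  have hs : 0 < s := hs
  -- The end is at distance of order `s`; scaling by the positive factor `s` leaves the argument
  -- unchanged and gives a ratio with a limit.
  rw [viewAngle, ← Complex.arg_real_mul _ hs]
  congr 1
  have : cx (c.advance σ (κ * s) i).2 - cx (c i).2 = s * (κ * cx w) := by
    simp only [advance, map_add, cx_smul]; push_cast; ring
  rw [this, mul_div_assoc, Pi.div_apply]

lemma tendsto_viewAngle_start (hc : c.Proper) (h : c.Closed σ) {κ : ℝ} (hκ : κ = 1 ∨ κ = -1)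
    (i : P.Idx) : Tendsto (fun s => viewAngle (c i).1 (c.advance σ (κ * s) i).1
      (c.advance σ (κ * s) i).2) (𝓝[>] (0 : ℝ))
      (𝓝 (P.turn (σ.symm i) i / 2 - κ * (Real.pi / 2))) := by
  have hτ := hc.turn_mem' h i
  obtain ⟨l, hl, hl'⟩ := hc.1 i
  have hd := P.norm_dir_pos i
  have hcos := cos_half_turn_pos hτ
  set m := σ.symm i
  set w := miterVelocity (P.normal m) (P.normal i) with hw
  have hκ0 : (κ : ℂ) ≠ 0 := by rcases hκ with rfl | rfl <;> norm_num
  have hkk : (κ : ℂ) ^ 2 = 1 := by rcases hκ with rfl | rfl <;> norm_num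
  have hnum : cx (c i).2 - cx (c i).1 = l * cx (P.dir i) := by
    rw [← cx_smul, ← hl', map_sub]
  have hw0 : κ * cx w ≠ 0 := by
    rw [hw, cx_miter' hτ]
    refine mul_ne_zero hκ0 (mul_ne_zero ?_ ?_)
    · exact_mod_cast (inv_pos.2 hcos).ne'
    · exact mul_ne_zero (mul_ne_zero Complex.I_ne_zero (Complex.exp_ne_zero _))
        (Complex.exp_ne_zero _)
  have hend : Tendsto (fun s => cx (c.advance σ (κ * s) i).2) (𝓝[>] (0 : ℝ))
      (𝓝 (cx (c i).2)) := by
    have := (continuous_advance_snd c σ i).tendsto 0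
    rw [advance_zero] at this
    exact (cx.continuous.tendsto _).comp (this.comp (tendsto_kappa κ))
  have hlim := (hend.sub (tendsto_const_nhds (x := cx (c i).1))).div
    (tendsto_const_nhds (x := κ * cx w)) hw0
  have hval : (cx (c i).2 - cx (c i).1) / (κ * cx w) =
      (Real.cos (P.turn m i / 2) * (l * ‖P.dir i‖) : ℝ) *
        Complex.exp ((P.turn m i / 2 - κ * (Real.pi / 2) : ℝ) * Complex.I) := by
    rw [div_eq_iff hw0, hnum, exp_sub_kappa hκ, hw, cx_miter' hτ, P.cx_dir_eq i, exp_ang_eq m i]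
    have h3 : ((Real.cos (P.turn m i / 2) : ℝ) : ℂ) ≠ 0 := by exact_mod_cast hcos.ne'
    have h5 : Complex.exp (P.turn m i * Complex.I) = Complex.exp ((P.turn m i / 2 : ℝ) * Complex.I) *
        Complex.exp ((P.turn m i / 2 : ℝ) * Complex.I) := by
      rw [← Complex.exp_add]; congr 1; push_cast; ring
    rw [h5]
    simp only [Complex.ofReal_inv, Complex.ofReal_mul]
    field_simp
    rw [hkk, Complex.I_sq]
    ring
  rw [hval] at hlim
  have := tendsto_arg_of_exp (by positivity) (half_turn_mem hκ hτ) hlim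
  refine this.congr' ?_
  filter_upwards [self_mem_nhdsWithin] with s hs
  have hs : 0 < s := hs
  have hs' : (s : ℂ) ≠ 0 := by exact_mod_cast hs.ne'
  rw [viewAngle, ← Complex.arg_real_mul (_ / _) hs]
  congr 1
  have : cx (c.advance σ (κ * s) i).1 - cx (c i).1 = s * (κ * cx w) := by
    simp only [advance, map_add, cx_smul]; push_cast; ring
  rw [this, Pi.div_apply]
  field_simp

open scoped Classical in
/-- The turning angles at a point `p` where corners of the wavefront meet are determined by the
sides that do not contain `p`. -/
lemma sum_turn_add_eq (hc : c.Proper) (h : c.Closed σ) {κ : ℝ} (hκ : κ = 1 ∨ κ = -1)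
    (hev : ∀ᶠ s in 𝓝[>] (0 : ℝ), (c.advance σ (κ * s)).Proper ∧ (c.advance σ (κ * s)).Filled)
    (i₀ : P.Idx) :
    ∑ i with (c i).2 = (c i₀).2, (P.turn i (σ i) - κ * Real.pi) +
      ∑ i, (if (c i).2 ≠ (c i₀).2 ∧ (c i).1 ≠ (c i₀).2 then
        viewAngle (c i₀).2 (c i).1 (c i).2 else 0) = Real.pi * (1 - κ) := by
  set p := (c i₀).2 with hp
  have hterm : ∀ i, Tendsto (fun s => viewAngle p (c.advance σ (κ * s) i).1
      (c.advance σ (κ * s) i).2) (𝓝[>] (0 : ℝ)) (𝓝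
      ((if (c i).2 = p then P.turn i (σ i) / 2 - κ * (Real.pi / 2) else 0) +
       (if (c i).1 = p then P.turn (σ.symm i) i / 2 - κ * (Real.pi / 2) else 0) +
       (if (c i).2 ≠ p ∧ (c i).1 ≠ p then viewAngle p (c i).1 (c i).2 else 0))) := by
    intro i
    have hne := hc.ne i
    by_cases h2 : (c i).2 = p
    · have h1 : (c i).1 ≠ p := fun h1 => hne (h1.trans h2.symm)
      simp only [h2, h1, if_true, if_false, ne_eq, not_true, false_and, add_zero]
      rw [← h2]
      exact tendsto_viewAngle_end hc h hκ i
    · by_cases h1 : (c i).1 = p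
      · simp only [h2, h1, if_true, if_false, ne_eq, not_true, and_false, add_zero, zero_add]
        rw [← h1]
        exact tendsto_viewAngle_start hc h hκ i
      · simp only [h2, h1, if_true, if_false, ne_eq, not_false_iff, and_true, add_zero, zero_add]
        refine Tendsto.viewAngle tendsto_const_nhds ?_ ?_ ?_
        · have := (continuous_advance_fst c σ i).tendsto 0
          rw [advance_zero] at this
          exact this.comp (tendsto_kappa κ)
        · have := (continuous_advance_snd c σ i).tendsto 0
          rw [advance_zero] at this
          exact this.comp (tendsto_kappa κ)
        · intro hpi
          by_cases hii : i = i₀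
          · subst hii; exact h2 rfl
          · have := (hc.2 i i₀ hii p ⟨hpi, right_mem_segment _ _ _⟩).1
            rcases this with h3 | h3
            · exact h1 h3.symm
            · exact h2 h3.symm
  have hlim := tendsto_finsetSum (Finset.univ : Finset P.Idx) fun i _ => hterm i
  have hval := tendsto_nhds_unique_of_eventuallyEq hlim tendsto_const_nhds
    (eventually_windingSum_advance hc h hκ hev i₀)
  rw [← hval, Finset.sum_add_distrib, Finset.sum_add_distrib, add_left_inj]
  -- Reindexing the sides that start at `p` along `σ` brings together the two halves belonging to
  -- one corner.
  rw [← Equiv.sum_comp σ (fun i => if (c i).1 = p then P.turn (σ.symm i) i / 2 -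
    κ * (Real.pi / 2) else 0), ← Finset.sum_add_distrib, Finset.sum_filter]
  refine Finset.sum_congr rfl fun i _ => ?_
  rw [← h i, Equiv.symm_apply_apply]
  split_ifs
  · ring
  · ring

end Wavefront

end PolygonCurve

/-! ### Colour changes when sides are joined anew. -/

namespace PolygonCurve

variable {P : PolygonCurve}

/-- The sum of the turning angles at the corners where two sides of different colours meet. -/
def transitionTurn (χ : P.Idx → Bool) (σ : Equiv.Perm P.Idx) : ℝ :=
  ∑ i with χ i ≠ χ (σ i), P.turn i (σ i)

/-- Replacing the successor function `σ` by `σ'` increases the turning angles at colour changes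
or does not affect colour changes. -/
def TransitionLE (χ : P.Idx → Bool) (σ σ' : Equiv.Perm P.Idx) : Prop :=
  transitionTurn χ σ < transitionTurn χ σ' ∨
    (transitionTurn χ σ = transitionTurn χ σ' ∧ ∀ i, χ i ≠ χ (σ i) → σ' i = σ i)

lemma TransitionLE.refl (χ : P.Idx → Bool) (σ : Equiv.Perm P.Idx) : TransitionLE χ σ σ :=
  Or.inr ⟨rfl, fun _ _ => rfl⟩

lemma TransitionLE.trans {χ : P.Idx → Bool} {σ₁ σ₂ σ₃ : Equiv.Perm P.Idx}
    (h : TransitionLE χ σ₁ σ₂) (h' : TransitionLE χ σ₂ σ₃) : TransitionLE χ σ₁ σ₃ := by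
  rcases h with h | ⟨h, hk⟩ <;> rcases h' with h' | ⟨h', hk'⟩
  · exact Or.inl (h.trans h')
  · exact Or.inl (h.trans_eq h')
  · exact Or.inl (h.trans_lt h')
  · refine Or.inr ⟨h.trans h', fun i hi => ?_⟩
    have h1 := hk i hi
    rw [← h1] at hi ⊢
    exact hk' i hi

namespace Wavefront

variable {c : P.Wavefront} {σ σ' : Equiv.Perm P.Idx}

open scoped Classical in
lemma sum_perm_eq (h : c.Closed σ) (p : Plane) {M : Type*} [AddCommMonoid M] (g : P.Idx → M) :
    ∑ i with (c i).2 = p, g (σ i) = ∑ j with (c j).1 = p, g j :=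
  Finset.sum_equiv σ (fun i => by simp [h i]) (fun _ _ => rfl)

-- Modulo 2 a colour change is the sum of the two colours. Added over the corners at `p`, this
-- involves all sides ending and all sides starting at `p`, regardless of how they are joined.
open scoped Classical in
lemma even_card_transitions (h : c.Closed σ) (h' : c.Closed σ') (χ : P.Idx → Bool) (p : Plane) :
    Even ((Finset.univ.filter fun i => (c i).2 = p ∧ χ i ≠ χ (σ i)).card +
      (Finset.univ.filter fun i => (c i).2 = p ∧ χ i ≠ χ (σ' i)).card) := by
  set f : Bool → ZMod 2 := fun b => if b then 1 else 0
  have key : ∀ τ : Equiv.Perm P.Idx, c.Closed τ →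
      ((Finset.univ.filter fun i => (c i).2 = p ∧ χ i ≠ χ (τ i)).card : ZMod 2) =
        ∑ i with (c i).2 = p, f (χ i) + ∑ j with (c j).1 = p, f (χ j) := by
    intro τ hτ
    rw [← sum_perm_eq hτ p (fun j => f (χ j)), ← Finset.sum_add_distrib, ← Finset.filter_filter,
      Finset.card_filter, Nat.cast_sum]
    refine Finset.sum_congr rfl fun i _ => ?_
    cases χ i <;> cases χ (τ i) <;> (simp [f]; try decide)
  rw [← ZMod.natCast_eq_zero_iff_even, Nat.cast_add, key σ h, key σ' h']
  exact CharTwo.add_self_eq_zero _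

open scoped Classical in
/-- The comparison of `TransitionLE` at a single point. -/
lemma transition_at (hc : c.Proper) (h : c.Closed σ) (h' : c.Closed σ')
    (hb : ∀ᶠ s in 𝓝[>] (0 : ℝ), (c.advance σ (-1 * s)).Proper ∧ (c.advance σ (-1 * s)).Filled)
    (ha : ∀ᶠ s in 𝓝[>] (0 : ℝ), (c.advance σ' (1 * s)).Proper ∧ (c.advance σ' (1 * s)).Filled)
    (χ : P.Idx → Bool) (i₀ : P.Idx) :
    ∑ i with (c i).2 = (c i₀).2 ∧ χ i ≠ χ (σ i), P.turn i (σ i) <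
      ∑ i with (c i).2 = (c i₀).2 ∧ χ i ≠ χ (σ' i), P.turn i (σ' i) ∨
    (∑ i with (c i).2 = (c i₀).2 ∧ χ i ≠ χ (σ i), P.turn i (σ i) =
      ∑ i with (c i).2 = (c i₀).2 ∧ χ i ≠ χ (σ' i), P.turn i (σ' i) ∧
      ∀ i, (c i).2 = (c i₀).2 → χ i ≠ χ (σ i) → σ' i = σ i) := by
  set p := (c i₀).2 with hp
  by_cases hsame : ∀ i, (c i).2 = p → σ' i = σ i
  · refine Or.inr ⟨?_, fun i hi _ => hsame i hi⟩
    refine Finset.sum_congr (Finset.filter_congr fun i _ => ?_) fun i hi => ?_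
    · refine and_congr_right fun hi => ?_
      rw [hsame i hi]
    · rw [hsame i (Finset.mem_filter.1 hi).2.1]
  push Not at hsame
  obtain ⟨i₁, hi₁, hne⟩ := hsame
  set I := Finset.univ.filter fun i => (c i).2 = p with hI
  set S := Finset.univ.filter fun i => (c i).2 = p ∧ χ i ≠ χ (σ i) with hS
  set S' := Finset.univ.filter fun i => (c i).2 = p ∧ χ i ≠ χ (σ' i) with hS'
  have hSI : S ⊆ I := fun i hi => by
    simp only [hS, hI, Finset.mem_filter] at hi ⊢; exact ⟨hi.1, hi.2.1⟩
  have hSI' : S' ⊆ I := fun i hi => by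
    simp only [hS', hI, Finset.mem_filter] at hi ⊢; exact ⟨hi.1, hi.2.1⟩
  -- A side that changes its successor at `p` comes with a second one, the old predecessor of its
  -- new successor.
  have hcard : 1 < I.card := by
    refine Finset.one_lt_card.2 ⟨i₁, by simp [hI, hi₁], σ.symm (σ' i₁), ?_, fun h0 => hne ?_⟩
    · simp only [hI, Finset.mem_filter, Finset.mem_univ, true_and]
      rw [h, Equiv.apply_symm_apply, ← h', hi₁]
    · rw [← (Equiv.symm_apply_eq σ).1 h0.symm]
  have hE := sum_turn_add_eq hc h (Or.inr rfl) hb i₀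
  have hE' := sum_turn_add_eq hc h' (Or.inl rfl) ha i₀
  rw [← hp] at hE hE'
  have hpos : ∀ i, 0 < P.turn i (σ i) + Real.pi := fun i => by linarith [(hc.turn_mem h i).1]
  have hpos' : ∀ i, 0 < Real.pi - P.turn i (σ' i) := fun i => by linarith [(hc.turn_mem h' i).2]
  -- Subtract the two balances: the sides not through `p` contribute the same before and after, and
  -- the winding sums differ by `2π`.
  have hsum : ∑ i ∈ I, (P.turn i (σ i) + Real.pi) + ∑ i ∈ I, (Real.pi - P.turn i (σ' i)) =
      2 * Real.pi := by
    have e1 : ∑ i ∈ I, (P.turn i (σ i) - -1 * Real.pi) = ∑ i ∈ I, (P.turn i (σ i) + Real.pi) :=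
      Finset.sum_congr rfl fun i _ => by ring
    have e2 : ∑ i ∈ I, (P.turn i (σ' i) - 1 * Real.pi) =
        -∑ i ∈ I, (Real.pi - P.turn i (σ' i)) := by
      rw [← Finset.sum_neg_distrib]
      exact Finset.sum_congr rfl fun i _ => by ring
    rw [e1] at hE
    rw [e2] at hE'
    linarith
  have hev : Even (S.card + S'.card) := even_card_transitions h h' χ p
  have hdS : ∑ i ∈ S, (P.turn i (σ i) + Real.pi) = ∑ i ∈ S, P.turn i (σ i) + S.card * Real.pi := by
    rw [Finset.sum_add_distrib, Finset.sum_const, nsmul_eq_mul]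
  have hdS' : ∑ i ∈ S', (Real.pi - P.turn i (σ' i)) =
      S'.card * Real.pi - ∑ i ∈ S', P.turn i (σ' i) := by
    rw [Finset.sum_sub_distrib, Finset.sum_const, nsmul_eq_mul]
  have hle : ∑ i ∈ S, (P.turn i (σ i) + Real.pi) ≤ ∑ i ∈ I, (P.turn i (σ i) + Real.pi) :=
    Finset.sum_le_sum_of_subset_of_nonneg hSI fun i _ _ => (hpos i).le
  have hle' : ∑ i ∈ S', (Real.pi - P.turn i (σ' i)) ≤ ∑ i ∈ I, (Real.pi - P.turn i (σ' i)) :=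
    Finset.sum_le_sum_of_subset_of_nonneg hSI' fun i _ _ => (hpos' i).le
  have hπ := Real.pi_pos
  rcases Nat.eq_zero_or_pos (S.card + S'.card) with h0 | h0
  · have hS0 : S = ∅ := Finset.card_eq_zero.1 (by omega)
    have hS0' : S' = ∅ := Finset.card_eq_zero.1 (by omega)
    refine Or.inr ⟨by rw [hS0, hS0']; simp, fun i hi hχ => ?_⟩
    have : i ∈ S := by simp only [hS, Finset.mem_filter, Finset.mem_univ, true_and]; exact ⟨hi, hχ⟩
    rw [hS0] at this
    simp at this
  left
  have h2 : 2 ≤ S.card + S'.card := by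
    obtain ⟨k, hk⟩ := hev; omega
  have h2' : (2 : ℝ) ≤ S.card + S'.card := by exact_mod_cast h2
  -- If every corner is a colour change both times, there are at least 4 changes, more than the
  -- identity allows without a strict increase. Otherwise a positive term is left out, so the
  -- partial sum is below `2π` and 2 changes are enough.
  by_cases hall : S = I ∧ S' = I
  · have h4 : (4 : ℝ) ≤ S.card + S'.card := by
      rw [hall.1, hall.2]
      have : 4 ≤ I.card + I.card := by omega
      exact_mod_cast this
    nlinarith
  · have hlt : ∑ i ∈ S, (P.turn i (σ i) + Real.pi) + ∑ i ∈ S', (Real.pi - P.turn i (σ' i)) <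
        2 * Real.pi := by
      rw [← hsum]
      by_cases hSe : S = I
      · have hss : S' ⊂ I := lt_of_le_of_ne hSI' fun h => hall ⟨hSe, h⟩
        obtain ⟨k, hk, hk'⟩ := Finset.exists_of_ssubset hss
        exact add_lt_add_of_le_of_lt hle (Finset.sum_lt_sum_of_subset hSI' hk hk' (hpos' k)
          fun j _ _ => (hpos' j).le)
      · have hss : S ⊂ I := lt_of_le_of_ne hSI hSe
        obtain ⟨k, hk, hk'⟩ := Finset.exists_of_ssubset hss
        exact add_lt_add_of_lt_of_le (Finset.sum_lt_sum_of_subset hSI hk hk' (hpos k)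
          fun j _ _ => (hpos j).le) hle'
    nlinarith

/-- When the sides are joined anew, the turning angles at colour changes increase. -/
lemma transitionLE (hc : c.Proper) (h : c.Closed σ) (h' : c.Closed σ')
    (hb : ∀ᶠ s in 𝓝[>] (0 : ℝ), (c.advance σ (-1 * s)).Proper ∧ (c.advance σ (-1 * s)).Filled)
    (ha : ∀ᶠ s in 𝓝[>] (0 : ℝ), (c.advance σ' (1 * s)).Proper ∧ (c.advance σ' (1 * s)).Filled)
    (χ : P.Idx → Bool) : TransitionLE χ σ σ' := by
  classical
  set A : Finset Plane := Finset.univ.image fun i => (c i).2 with hA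
  have hfib : ∀ τ : Equiv.Perm P.Idx, transitionTurn χ τ =
      ∑ p ∈ A, ∑ i with (c i).2 = p ∧ χ i ≠ χ (τ i), P.turn i (τ i) := by
    intro τ
    rw [transitionTurn, ← Finset.sum_fiberwise_of_maps_to (g := fun i => (c i).2) (t := A)
      (fun i _ => Finset.mem_image_of_mem _ (Finset.mem_univ i))]
    refine Finset.sum_congr rfl fun p _ => ?_
    rw [Finset.filter_filter]
    exact Finset.sum_congr (Finset.filter_congr fun i _ => and_comm) fun _ _ => rfl
  rw [TransitionLE, hfib σ, hfib σ']
  have hall : ∀ p ∈ A, ∑ i with (c i).2 = p ∧ χ i ≠ χ (σ i), P.turn i (σ i) ≤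
      ∑ i with (c i).2 = p ∧ χ i ≠ χ (σ' i), P.turn i (σ' i) := by
    intro p hp
    obtain ⟨i₀, -, rfl⟩ := Finset.mem_image.1 hp
    rcases transition_at hc h h' hb ha χ i₀ with h1 | h1
    · exact h1.le
    · exact h1.1.le
  by_cases hs : ∃ p ∈ A, ∑ i with (c i).2 = p ∧ χ i ≠ χ (σ i), P.turn i (σ i) <
      ∑ i with (c i).2 = p ∧ χ i ≠ χ (σ' i), P.turn i (σ' i)
  · exact Or.inl (Finset.sum_lt_sum hall hs)
  · push Not at hs
    refine Or.inr ⟨Finset.sum_congr rfl fun p hp => le_antisymm (hall p hp) (hs p hp),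
      fun i hi => ?_⟩
    rcases transition_at hc h h' hb ha χ i with h1 | h1
    · exact absurd h1 (not_lt.2 (hs _ (Finset.mem_image_of_mem _ (Finset.mem_univ i))))
    · exact h1.2 i rfl hi

end Wavefront

end PolygonCurve

-- The induction also records the last joining and a proper, filled wavefront shortly before `c`,
-- because the comparison at the next event needs both sides of it. At time 0 there is no such past,
-- whence the alternative.
open PolygonCurve in
lemma Polygon2.miteredOffset_invariant (P : Polygon2) (χ : P.Idx → Bool) {t : ℝ}
    {c : P.Wavefront} (hc : P.MiteredOffset t c) : c.Proper ∧ c.Filled ∧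
      ((t = 0 ∧ c = P.initialWavefront) ∨ ∃ σ, c.Closed σ ∧
        (∀ᶠ s in 𝓝[>] (0 : ℝ), (c.advance σ (-1 * s)).Proper ∧ (c.advance σ (-1 * s)).Filled) ∧
        TransitionLE χ (Equiv.addRight 1) σ) := by
  induction hc with
  | start => exact ⟨P.initialWavefront_proper, P.initialWavefront_filled, Or.inl ⟨rfl, rfl⟩⟩
  | @move t c hc σ hσ d hd hproper ih =>
    obtain ⟨hp, hf, ih⟩ := ih
    have hprop : ∀ s ∈ Icc 0 d, (c.advance σ s).Proper := by
      intro s hs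
      rcases hs.1.eq_or_lt with rfl | h0
      · rwa [Wavefront.advance_zero]
      · exact hproper s ⟨h0, hs.2⟩
    have hfill : ∀ s ∈ Icc 0 d, (c.advance σ s).Filled := fun s hs =>
      hf.advance hσ hd.le hprop hs
    have hd' : d ∈ Icc 0 d := ⟨hd.le, le_rfl⟩
    refine ⟨hprop d hd', hfill d hd', Or.inr ⟨σ, Wavefront.Closed.advance hσ d, ?_, ?_⟩⟩
    · filter_upwards [Ioo_mem_nhdsGT hd] with s hs
      rw [Wavefront.advance_advance]
      have : d + -1 * s ∈ Icc 0 d := ⟨by linarith [hs.2], by linarith [hs.1]⟩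
      exact ⟨hprop _ this, hfill _ this⟩
    · rcases ih with ⟨-, rfl⟩ | ⟨σ₀, hσ₀, hb, hle⟩
      -- The vertices of the polygon are distinct, so the first move can only use the original
      -- cyclic order.
      · have : σ = Equiv.addRight 1 := by
          ext1 i
          exact (P.vertex_injective (hσ i)).symm
        rw [this]
        exact TransitionLE.refl _ _
      · refine hle.trans (Wavefront.transitionLE hp hσ₀ hσ hb ?_ χ)
        filter_upwards [Ioo_mem_nhdsGT hd] with s hs
        rw [one_mul]
        exact ⟨hprop _ ⟨hs.1.le, hs.2.le⟩, hfill _ ⟨hs.1.le, hs.2.le⟩⟩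

/-- If the final wavefront is split into parts of different colours, then the turning angles of the
polygon at the colour changes have a negative sum. -/
theorem Polygon2.transition_turn_neg (P : Polygon2) {t : ℝ} (ht : 0 < t) {c : P.Wavefront}
    (hc : P.MiteredOffset t c) (χ : P.Idx → Bool)
    (hχ : ∀ i j, (c i).2 = (c j).1 → χ i = χ j) (hex : ∃ i, χ i ≠ χ (i + 1)) :
    ∑ i with χ i ≠ χ (i + 1), P.turn i (i + 1) < 0 := by
  obtain ⟨-, -, ⟨h0, -⟩ | ⟨σ, hσ, -, h⟩⟩ := P.miteredOffset_invariant χ hc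
  · exact absurd h0 ht.ne'
  -- In the final joining there are no colour changes. If the sum had not increased strictly, the
  -- initial colour changes would have survived.
  have hz : PolygonCurve.transitionTurn χ σ = 0 := by
    rw [PolygonCurve.transitionTurn, Finset.filter_false_of_mem, Finset.sum_empty]
    intro i _
    rw [not_not]
    exact hχ i (σ i) (hσ i)
  rcases h with h | ⟨-, h⟩
  · rw [hz] at h
    exact h
  · obtain ⟨i, hi⟩ := hex
    have h1 := h i hi
    have h2 := hχ i (σ i) (hσ i)
    rw [h1] at h2
    exact absurd h2 hi

lemma PolygonCurve.MiteredOffset.proper {P : PolygonCurve} {t : ℝ} {c : P.Wavefront}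
    (hc : P.MiteredOffset t c) : c.Proper := by
  cases hc with
  | start => exact P.initialWavefront_proper
  | move hc σ hσ d hd hproper => exact hproper d ⟨hd, le_rfl⟩

/-! ### Common sides -/

/-- The polygons meet only along common vertices and common sides. -/
def Touch (P Q : Polygon2) : Prop := ∀ x ∈ P.region ∩ Q.region,
  (∃ i j, x = P.vertex i ∧ x = Q.vertex j) ∨ (∃ i j, P.edge i = Q.edge j ∧ x ∈ P.edge i)

lemma MeetInFace.touch {P Q : Polygon2} (h : MeetInFace P.toPolygonCurve Q.toPolygonCurve) :
    Touch P Q := by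
  intro x hx
  rcases h with h | ⟨i, j, hij, h⟩ | ⟨i, j, hij, h⟩
  · rw [h] at hx; exact absurd hx (notMem_empty x)
  · rw [h, mem_singleton_iff] at hx
    exact Or.inl ⟨i, j, hx, hx.trans hij⟩
  · rw [h] at hx; exact Or.inr ⟨i, j, hij, hx⟩

namespace Touch

variable {P Q : Polygon2}

lemma symm (h : Touch P Q) : Touch Q P := by
  intro x hx
  rcases h x ⟨hx.2, hx.1⟩ with ⟨i, j, h1, h2⟩ | ⟨i, j, h1, h2⟩
  · exact Or.inl ⟨j, i, h2, h1⟩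
  · exact Or.inr ⟨j, i, h1.symm, h1 ▸ h2⟩

lemma notMem_region (h : Touch P Q) {x : Plane} (hx : x ∈ P.inside) : x ∉ Q.region := by
  intro hxQ
  rcases h x ⟨P.inside_subset_region hx, hxQ⟩ with ⟨i, j, h1, -⟩ | ⟨i, j, -, h2⟩
  · exact hx.1 (h1 ▸ P.edge_subset_boundary i (P.vertex_mem_edge i))
  · exact hx.1 (P.edge_subset_boundary i h2)

lemma disjoint_inside (h : Touch P Q) : Disjoint P.inside Q.inside :=
  disjoint_left.2 fun _ hx hx' => h.notMem_region hx (Q.inside_subset_region hx')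

lemma exists_edge_eq (h : Touch P Q) {i : P.Idx} {x : Plane} (hx : x ∈ P.openEdge i)
    (hxQ : x ∈ Q.region) : ∃ j, P.edge i = Q.edge j := by
  rcases h x ⟨P.edge_subset_region i (P.openEdge_subset i hx), hxQ⟩ with
    ⟨k, j, h1, -⟩ | ⟨k, j, h1, h2⟩
  · exact absurd (h1 ▸ hx) P.vertex_notMem_openEdge
  · exact ⟨j, P.eq_of_mem_openEdge hx h2 ▸ h1⟩

end Touch

namespace PolygonCurve

/-- Side `i` of `P` has the end points `u` and `v`. -/
def IsSide (P : PolygonCurve) (i : P.Idx) (u v : Plane) : Prop :=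
  (u = P.vertex i ∧ v = P.vertex (i + 1)) ∨ (u = P.vertex (i + 1) ∧ v = P.vertex i)

variable {P Q : PolygonCurve} {u v : Plane}

lemma IsSide.symm {i : P.Idx} (h : P.IsSide i u v) : P.IsSide i v u :=
  h.elim (fun h => Or.inr ⟨h.2, h.1⟩) (fun h => Or.inl ⟨h.2, h.1⟩)

lemma IsSide.edge_eq {i : P.Idx} (h : P.IsSide i u v) : P.edge i = segment ℝ u v := by
  rcases h with ⟨rfl, rfl⟩ | ⟨rfl, rfl⟩
  · rfl
  · rw [segment_symm]; rfl

lemma isSide_of_edge_eq {i : P.Idx} (h : P.edge i = segment ℝ u v) : P.IsSide i u v := by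
  rcases segment_eq_segment h with ⟨h1, h2⟩ | ⟨h1, h2⟩
  · exact Or.inl ⟨h1.symm, h2.symm⟩
  · exact Or.inr ⟨h2.symm, h1.symm⟩

lemma IsSide.eq {i j : P.Idx} (h : P.IsSide i u v) (h' : P.IsSide j u v) : i = j :=
  P.edge_inj (h.edge_eq.trans h'.edge_eq.symm)

lemma IsSide.ne {i : P.Idx} (h : P.IsSide i u v) : u ≠ v := by
  rcases h with ⟨rfl, rfl⟩ | ⟨rfl, rfl⟩
  · exact P.vertex_succ_ne i
  · exact (P.vertex_succ_ne i).symm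

end PolygonCurve

/-! ### Each side belongs to exactly two cells. -/

section Complex

variable {ι κ : Type*} {K : PolygonalComplex ι} {H : κ → Polygon2}

/-- The polygons of the complex and the holes. -/
def polygonAt (K : PolygonalComplex ι) (H : κ → Polygon2) : ι ⊕ κ → Polygon2 :=
  Sum.elim K.polygon H

/-- The cell of a polygon. -/
def polygonCell : ι ⊕ κ → Cell ι κ := Sum.elim Cell.mesh Cell.hole

lemma polygonCell_injective : Function.Injective (polygonCell : ι ⊕ κ → Cell ι κ) := by
  rintro (f | h) (g | k) hh <;> simp_all [polygonCell]

lemma Cell.eq_outside_or (c : Cell ι κ) : c = Cell.outside ∨ ∃ a, c = polygonCell a := by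
  rcases c with f | h | _
  · exact Or.inr ⟨Sum.inl f, rfl⟩
  · exact Or.inr ⟨Sum.inr h, rfl⟩
  · exact Or.inl rfl

lemma polygonCell_ne_outside (a : ι ⊕ κ) : polygonCell a ≠ Cell.outside := by
  rcases a with f | h <;> simp [polygonCell]

lemma support_union_eq : K.support ∪ ⋃ h, (H h).region = ⋃ a, (polygonAt K H a).region := by
  rw [iUnion_sum]; rfl

lemma AdmissibleInput.touch (hKH : AdmissibleInput K H) {a b : ι ⊕ κ} (hab : a ≠ b) :
    Touch (polygonAt K H a) (polygonAt K H b) := by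
  rcases a with f | h <;> rcases b with g | k
  · exact (K.meet f g (fun h => hab (h ▸ rfl))).touch
  · exact hKH.meet_hole f k
  · exact Touch.symm (hKH.meet_hole g h)
  · intro x hx
    exact absurd hx.2 (disjoint_left.1 (hKH.holes_disjoint h k (fun h => hab (h ▸ rfl))) hx.1)

/-- Polygons on both sides cover a neighbourhood of an interior point of the side, which is then not
a limit of uncovered points. -/
lemma AdmissibleInput.not_subset_outside (hKH : AdmissibleInput K H) {a b : ι ⊕ κ} (hab : a ≠ b)
    {i : (polygonAt K H a).Idx} {j : (polygonAt K H b).Idx}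
    (hij : (polygonAt K H a).edge i = (polygonAt K H b).edge j) :
    ¬ (polygonAt K H a).edge i ⊆ outsideRegion K H := by
  intro hsub
  obtain ⟨h1, h2⟩ := Polygon2.vertex_eq_of_edge_eq (hKH.touch hab).disjoint_inside hij
  obtain ⟨x, hx⟩ := (polygonAt K H a).openEdge_nonempty i
  have hn := Polygon2.region_union_mem_nhds h1 h2 hx
  have hxo := hsub ((polygonAt K H a).openEdge_subset i hx)
  obtain ⟨y, hy, hyc⟩ := mem_closure_iff_nhds.1 hxo _ hn
  apply hyc
  rw [support_union_eq]
  rcases hy with hy | hy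
  · exact mem_iUnion.2 ⟨a, hy⟩
  · exact mem_iUnion.2 ⟨b, hy⟩

/-- If no other polygon has this side, none reaches its interior points; and near these there are
points outside the polygon itself, by `region_notMem_nhds`. Such points are uncovered. -/
lemma AdmissibleInput.exists_opposite [Finite ι] [Finite κ] (hKH : AdmissibleInput K H)
    (a : ι ⊕ κ) (i : (polygonAt K H a).Idx) :
    (∃ b, b ≠ a ∧ ∃ j, (polygonAt K H a).edge i = (polygonAt K H b).edge j) ∨
      (polygonAt K H a).edge i ⊆ outsideRegion K H := by
  by_cases hex : ∃ b, b ≠ a ∧ ∃ j, (polygonAt K H a).edge i = (polygonAt K H b).edge j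
  · exact Or.inl hex
  right
  rw [← (polygonAt K H a).closure_openEdge]
  refine closure_minimal (fun x hx => ?_) isClosed_closure
  rw [outsideRegion, support_union_eq]
  have hev : ∀ᶠ y in 𝓝 x, ∀ b, b ≠ a → y ∉ (polygonAt K H b).region := by
    rw [eventually_all]
    intro b
    by_cases hb : b = a
    · exact Eventually.of_forall fun _ h => absurd hb h
    have hxb : x ∉ (polygonAt K H b).region := fun hxb =>
      hex ⟨b, hb, (hKH.touch (Ne.symm hb)).exists_edge_eq hx hxb⟩
    filter_upwards [(polygonAt K H b).isClosed_region.isOpen_compl.mem_nhds hxb] with y hy _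
    exact hy
  have hfreq : ∃ᶠ y in 𝓝 x, y ∉ (polygonAt K H a).region := fun h =>
    (polygonAt K H a).region_notMem_nhds ((polygonAt K H a).edge_subset_boundary i
      ((polygonAt K H a).openEdge_subset i hx)) (by simpa using h)
  rw [mem_closure_iff_frequently]
  refine (hfreq.and_eventually hev).mono fun y hy => ?_
  rw [mem_compl_iff, mem_iUnion, not_exists]
  intro b
  by_cases hb : b = a
  · rw [hb]; exact hy.1
  · exact hy.2 b hb

lemma hole_side_not_outside (hKH : AdmissibleInput K H) {h : κ} {j : (H h).Idx} {u v : Plane}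
    (hs : (H h).IsSide j u v) (hsub : segment ℝ u v ⊆ outsideRegion K H) : False :=
  disjoint_left.1 (hKH.hole_outside_disjoint h)
    ((H h).edge_subset_region j (hs.edge_eq ▸ left_mem_segment ℝ u v))
    (hsub (left_mem_segment ℝ u v))

lemma PolygonalComplex.edge_unique (K : PolygonalComplex ι) {f g : ι} (hfg : f ≠ g)
    {i i' : (K.polygon f).Idx} {j j' : (K.polygon g).Idx}
    (h : (K.polygon f).edge i = (K.polygon g).edge j)
    (h' : (K.polygon f).edge i' = (K.polygon g).edge j') : i = i' := by
  have key : ∀ i j, (K.polygon f).edge i = (K.polygon g).edge j →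
      ∀ x ∈ (K.polygon f).openEdge i, x ∈ (K.polygon f).region ∩ (K.polygon g).region := by
    intro i j h x hx
    have := (K.polygon f).openEdge_subset i hx
    exact ⟨(K.polygon f).edge_subset_region i this, (K.polygon g).edge_subset_region j (h ▸ this)⟩
  obtain ⟨x, hx⟩ := (K.polygon f).openEdge_nonempty i
  obtain ⟨x', hx'⟩ := (K.polygon f).openEdge_nonempty i'
  have m := key i j h x hx
  have m' := key i' j' h' x' hx'
  rcases K.meet f g hfg with h0 | ⟨k, l, -, h0⟩ | ⟨k, l, -, h0⟩
  · rw [h0] at m; exact absurd m (notMem_empty x)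
  · rw [h0, mem_singleton_iff] at m
    exact absurd (m ▸ hx) (K.polygon f).vertex_notMem_openEdge
  · rw [h0] at m m'
    rw [(K.polygon f).eq_of_mem_openEdge hx m, (K.polygon f).eq_of_mem_openEdge hx' m']

/-- The cell `c` has a side with end points `u` and `v`. -/
def HasSide (K : PolygonalComplex ι) (H : κ → Polygon2) : Cell ι κ → Plane → Plane → Prop
  | Cell.mesh f, u, v => ∃ i, (K.polygon f).IsSide i u v
  | Cell.hole h, u, v => ∃ j, (H h).IsSide j u v
  | Cell.outside, u, v => ∃ f i, (K.polygon f).IsSide i u v ∧ segment ℝ u v ⊆ outsideRegion K H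

lemma hasSide_polygonCell {a : ι ⊕ κ} {u v : Plane} :
    HasSide K H (polygonCell a) u v ↔ ∃ i, (polygonAt K H a).IsSide i u v := by
  rcases a with f | h <;> rfl

lemma HasSide.exists_opposite [Finite ι] [Finite κ] (hKH : AdmissibleInput K H) {c : Cell ι κ}
    {u v : Plane} (h : HasSide K H c u v) : ∃ c', c' ≠ c ∧ HasSide K H c' u v := by
  rcases c.eq_outside_or with rfl | ⟨a, rfl⟩
  · obtain ⟨f, i, hi, -⟩ := h
    exact ⟨Cell.mesh f, by simp, i, hi⟩
  · obtain ⟨i, hi⟩ := hasSide_polygonCell.1 h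
    rcases hKH.exists_opposite a i with ⟨b, hb, j, hj⟩ | hsub
    · exact ⟨polygonCell b, polygonCell_injective.ne hb, hasSide_polygonCell.2
        ⟨j, PolygonCurve.isSide_of_edge_eq (hj.symm.trans hi.edge_eq)⟩⟩
    · rw [hi.edge_eq] at hsub
      rcases a with f | k
      · exact ⟨Cell.outside, (polygonCell_ne_outside _).symm, f, i, hi, hsub⟩
      · exact (hole_side_not_outside hKH hi hsub).elim

/-- Any two of the polygons traverse the side in opposite directions, which is impossible for three.
-/
lemma HasSide.not_three_polygons (hKH : AdmissibleInput K H) {a b b' : ι ⊕ κ} {u v : Plane}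
    (ha : HasSide K H (polygonCell a) u v) (hb : HasSide K H (polygonCell b) u v)
    (hb' : HasSide K H (polygonCell b') u v) (h1 : a ≠ b) (h2 : a ≠ b') (h3 : b ≠ b') : False := by
  obtain ⟨i, hi⟩ := hasSide_polygonCell.1 ha
  obtain ⟨j, hj⟩ := hasSide_polygonCell.1 hb
  obtain ⟨k, hk⟩ := hasSide_polygonCell.1 hb'
  have e1 := Polygon2.vertex_eq_of_edge_eq (hKH.touch h1).disjoint_inside
    (hi.edge_eq.trans hj.edge_eq.symm)
  have e2 := Polygon2.vertex_eq_of_edge_eq (hKH.touch h2).disjoint_inside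
    (hi.edge_eq.trans hk.edge_eq.symm)
  have e3 := Polygon2.vertex_eq_of_edge_eq (hKH.touch h3).disjoint_inside
    (hj.edge_eq.trans hk.edge_eq.symm)
  exact (polygonAt K H a).vertex_succ_ne i (e2.1.trans (e3.1.symm.trans e1.2.symm))

lemma HasSide.not_two_polygons_outside (hKH : AdmissibleInput K H) {a b : ι ⊕ κ} {u v : Plane}
    (ha : HasSide K H (polygonCell a) u v) (hb : HasSide K H (polygonCell b) u v)
    (ho : HasSide K H Cell.outside u v) (h1 : a ≠ b) : False := by
  obtain ⟨i, hi⟩ := hasSide_polygonCell.1 ha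
  obtain ⟨j, hj⟩ := hasSide_polygonCell.1 hb
  obtain ⟨-, -, -, hsub⟩ := ho
  exact hKH.not_subset_outside h1 (hi.edge_eq.trans hj.edge_eq.symm) (hi.edge_eq ▸ hsub)

lemma HasSide.opposite_unique (hKH : AdmissibleInput K H) {c c' c'' : Cell ι κ} {u v : Plane}
    (h : HasSide K H c u v) (h' : HasSide K H c' u v) (h'' : HasSide K H c'' u v)
    (hc' : c' ≠ c) (hc'' : c'' ≠ c) : c' = c'' := by
  by_contra hne
  rcases c.eq_outside_or with rfl | ⟨a, rfl⟩ <;> rcases c'.eq_outside_or with rfl | ⟨b, rfl⟩ <;>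
    rcases c''.eq_outside_or with rfl | ⟨d, rfl⟩
  · exact hc' rfl
  · exact hc' rfl
  · exact hc'' rfl
  · exact h'.not_two_polygons_outside hKH h'' h (fun e => hne (e ▸ rfl))
  · exact hne rfl
  · exact h.not_two_polygons_outside hKH h'' h' (fun e => hc'' (e ▸ rfl))
  · exact h.not_two_polygons_outside hKH h' h'' (fun e => hc' (e ▸ rfl))
  · exact h.not_three_polygons hKH h' h'' (fun e => hc' (e ▸ rfl)) (fun e => hc'' (e ▸ rfl))
      (fun e => hne (e ▸ rfl))

lemma HasSide.exists_mesh (hKH : AdmissibleInput K H) {c c' : Cell ι κ} {u v : Plane}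
    (h : HasSide K H c u v) (h' : HasSide K H c' u v) (hc : c ≠ c') :
    (∃ f, c = Cell.mesh f) ∨ ∃ f, c' = Cell.mesh f := by
  rcases c with f | k | _
  · exact Or.inl ⟨f, rfl⟩
  · rcases c' with g | l | _
    · exact Or.inr ⟨g, rfl⟩
    · obtain ⟨i, hi⟩ := h
      obtain ⟨j, hj⟩ := h'
      have hkl : k ≠ l := fun e => hc (e ▸ rfl)
      exact (disjoint_left.1 (hKH.holes_disjoint k l hkl)
        ((H k).edge_subset_region i (hi.edge_eq ▸ left_mem_segment ℝ u v))
        ((H l).edge_subset_region j (hj.edge_eq ▸ left_mem_segment ℝ u v))).elim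
    · obtain ⟨i, hi⟩ := h
      obtain ⟨-, -, -, hsub⟩ := h'
      exact (hole_side_not_outside hKH hi hsub).elim
  · rcases c' with g | l | _
    · exact Or.inr ⟨g, rfl⟩
    · obtain ⟨-, -, -, hsub⟩ := h
      obtain ⟨i, hi⟩ := h'
      exact (hole_side_not_outside hKH hi hsub).elim
    · exact (hc rfl).elim

lemma HasSide.segment_eq (hKH : AdmissibleInput K H) {a b : ι ⊕ κ} {u v u' v' : Plane}
    (ha : HasSide K H (polygonCell a) u v) (hb : HasSide K H (polygonCell b) u v)
    (ha' : HasSide K H (polygonCell a) u' v') (hb' : HasSide K H (polygonCell b) u' v')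
    (hab : a ≠ b) : segment ℝ u v = segment ℝ u' v' := by
  have hm := HasSide.exists_mesh hKH ha hb (polygonCell_injective.ne hab)
  obtain ⟨i, hi⟩ := hasSide_polygonCell.1 ha
  obtain ⟨j, hj⟩ := hasSide_polygonCell.1 hb
  obtain ⟨i', hi'⟩ := hasSide_polygonCell.1 ha'
  obtain ⟨j', hj'⟩ := hasSide_polygonCell.1 hb'
  have e := hi.edge_eq.trans hj.edge_eq.symm
  have e' := hi'.edge_eq.trans hj'.edge_eq.symm
  rcases a with f | h <;> rcases b with g | k
  · have := K.edge_unique (f := f) (g := g) (fun e => hab (e ▸ rfl)) e e'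
    rw [← hi.edge_eq, this, hi'.edge_eq]
  · have := hKH.hole_edge_unique f k i i' j j' e e'
    rw [← hi.edge_eq, this, hi'.edge_eq]
  · have := hKH.hole_edge_unique g h j j' i i' e.symm e'.symm
    rw [← hj.edge_eq, this, hj'.edge_eq]
  · simp [polygonCell] at hm

/-- A polygon has at most one side at a vertex that lies in the outside cell. -/
lemma AdmissibleInput.outside_side_unique (hKH : AdmissibleInput K H) {f : ι}
    {i j : (K.polygon f).Idx} {u u' v : Plane} (hi : (K.polygon f).IsSide i u v)
    (hj : (K.polygon f).IsSide j u' v) (hu : segment ℝ u v ⊆ outsideRegion K H)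
    (hu' : segment ℝ u' v ⊆ outsideRegion K H) : u = u' := by
  rw [← hi.edge_eq] at hu
  rw [← hj.edge_eq] at hu'
  rcases hi with ⟨rfl, rfl⟩ | ⟨rfl, rfl⟩ <;> rcases hj with ⟨rfl, h⟩ | ⟨rfl, h⟩
  · rw [add_right_cancel ((K.polygon f).vertex_injective h)]
  · rw [← (K.polygon f).vertex_injective h] at hu'
    exact (hKH.outside_not_adjacent f i ⟨hu, hu'⟩).elim
  · rw [(K.polygon f).vertex_injective h] at hu
    exact (hKH.outside_not_adjacent f j ⟨hu', hu⟩).elim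
  · rw [(K.polygon f).vertex_injective h]

end Complex

/-! ### Copies of sides and the degrees of vertices. -/

section Degree

variable {ι κ : Type*} {K : PolygonalComplex ι} {H : κ → Polygon2}
  {W : ∀ f, (K.polygon f).Wavefront}

lemma isCopy_mesh_iff {f : ι} {u v u' v' : Plane} : IsCopy K H W (Cell.mesh f) u v u' v' ↔
    ∃ i, (u = (K.polygon f).vertex i ∧ v = (K.polygon f).vertex (i + 1) ∧
        u' = (W f i).1 ∧ v' = (W f i).2) ∨
      (u = (K.polygon f).vertex (i + 1) ∧ v = (K.polygon f).vertex i ∧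
        u' = (W f i).2 ∧ v' = (W f i).1) := by
  constructor
  · intro h
    generalize hc : Cell.mesh f = c at h
    induction h with
    | mesh g i => cases hc; exact ⟨i, Or.inl ⟨rfl, rfl, rfl, rfl⟩⟩
    | hole h j => cases hc
    | outside g i hi => cases hc
    | symm h ih =>
      obtain ⟨i, ⟨h1, h2, h3, h4⟩ | ⟨h1, h2, h3, h4⟩⟩ := ih hc
      · exact ⟨i, Or.inr ⟨h2, h1, h4, h3⟩⟩
      · exact ⟨i, Or.inl ⟨h2, h1, h4, h3⟩⟩
  · rintro ⟨i, ⟨rfl, rfl, rfl, rfl⟩ | ⟨rfl, rfl, rfl, rfl⟩⟩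
    · exact IsCopy.mesh f i
    · exact (IsCopy.mesh f i).symm

lemma IsCopy.hasSide {c : Cell ι κ} {u v u' v' : Plane} (h : IsCopy K H W c u v u' v') :
    HasSide K H c u v := by
  induction h with
  | mesh f i => exact ⟨i, Or.inl ⟨rfl, rfl⟩⟩
  | hole h j => exact ⟨j, Or.inl ⟨rfl, rfl⟩⟩
  | outside f i hi => exact ⟨f, i, Or.inl ⟨rfl, rfl⟩, hi⟩
  | @symm c _ _ _ _ h ih =>
    rcases c with f | k | _
    · obtain ⟨i, hi⟩ := ih; exact ⟨i, hi.symm⟩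
    · obtain ⟨i, hi⟩ := ih; exact ⟨i, hi.symm⟩
    · obtain ⟨f, i, hi, hs⟩ := ih
      exact ⟨f, i, hi.symm, by rwa [segment_symm]⟩

lemma IsCopy.unmoved {c : Cell ι κ} {u v u' v' : Plane} (h : IsCopy K H W c u v u' v')
    (hc : ∀ f, c ≠ Cell.mesh f) : u' = u ∧ v' = v := by
  induction h with
  | mesh f i => exact (hc f rfl).elim
  | hole h j => exact ⟨rfl, rfl⟩
  | outside f i hi => exact ⟨rfl, rfl⟩
  | symm h ih => exact ⟨(ih hc).2, (ih hc).1⟩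

lemma HasSide.exists_isCopy {c : Cell ι κ} {u v : Plane} (h : HasSide K H c u v) :
    ∃ u' v', IsCopy K H W c u v u' v' := by
  rcases c with f | k | _
  · obtain ⟨i, ⟨rfl, rfl⟩ | ⟨rfl, rfl⟩⟩ := h
    · exact ⟨_, _, IsCopy.mesh f i⟩
    · exact ⟨_, _, (IsCopy.mesh f i).symm⟩
  · obtain ⟨i, ⟨rfl, rfl⟩ | ⟨rfl, rfl⟩⟩ := h
    · exact ⟨_, _, IsCopy.hole k i⟩
    · exact ⟨_, _, (IsCopy.hole k i).symm⟩
  · obtain ⟨f, i, hi, hs⟩ := h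
    have hs' := hs
    rw [← hi.edge_eq] at hs'
    rcases hi with ⟨rfl, rfl⟩ | ⟨rfl, rfl⟩
    · exact ⟨_, _, IsCopy.outside f i hs'⟩
    · exact ⟨_, _, (IsCopy.outside f i hs').symm⟩

lemma Cell.mesh_or (c : Cell ι κ) : (∃ f, c = Cell.mesh f) ∨ ∀ f, c ≠ Cell.mesh f := by
  rcases c with f | h | _
  · exact Or.inl ⟨f, rfl⟩
  · exact Or.inr fun f => by simp
  · exact Or.inr fun f => by simp

lemma IsCopy.unique {c : Cell ι κ} {u v u₁ v₁ u₂ v₂ : Plane} (h : IsCopy K H W c u v u₁ v₁)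
    (h' : IsCopy K H W c u v u₂ v₂) : u₁ = u₂ ∧ v₁ = v₂ := by
  rcases c.mesh_or with ⟨f, rfl⟩ | hc
  · obtain ⟨i, hi⟩ := isCopy_mesh_iff.1 h
    obtain ⟨j, hj⟩ := isCopy_mesh_iff.1 h'
    have hij : i = j := PolygonCurve.IsSide.eq (P := (K.polygon f).toPolygonCurve) (u := u) (v := v)
      (hi.imp (fun h => ⟨h.1, h.2.1⟩) (fun h => ⟨h.1, h.2.1⟩))
      (hj.imp (fun h => ⟨h.1, h.2.1⟩) (fun h => ⟨h.1, h.2.1⟩))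
    subst hij
    have hne := (K.polygon f).vertex_succ_ne i
    rcases hi with ⟨h1, h2, h3, h4⟩ | ⟨h1, h2, h3, h4⟩ <;>
      rcases hj with ⟨k1, k2, k3, k4⟩ | ⟨k1, k2, k3, k4⟩
    · exact ⟨h3.trans k3.symm, h4.trans k4.symm⟩
    · exact absurd (h1.symm.trans k1) hne
    · exact absurd (k1.symm.trans h1) hne
    · exact ⟨h3.trans k3.symm, h4.trans k4.symm⟩
  · have e1 := h.unmoved hc
    have e2 := h'.unmoved hc
    exact ⟨e1.1.trans e2.1.symm, e1.2.trans e2.2.symm⟩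

lemma hasSide_ne {c : Cell ι κ} {u v : Plane} (h : HasSide K H c u v) : u ≠ v := by
  rcases c with f | k | _
  · obtain ⟨i, hi⟩ := h; exact hi.ne
  · obtain ⟨i, hi⟩ := h; exact hi.ne
  · obtain ⟨f, i, hi, -⟩ := h; exact hi.ne

lemma IsCopy.ne (hW : ∀ f, (W f).Proper) {c : Cell ι κ} {u v u' v' : Plane}
    (h : IsCopy K H W c u v u' v') : u' ≠ v' := by
  rcases c.mesh_or with ⟨f, rfl⟩ | hc
  · obtain ⟨i, ⟨-, -, rfl, rfl⟩ | ⟨-, -, rfl, rfl⟩⟩ := isCopy_mesh_iff.1 h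
    · exact (hW f).ne i
    · exact ((hW f).ne i).symm
  · obtain ⟨rfl, rfl⟩ := h.unmoved hc
    exact hasSide_ne h.hasSide

lemma IsCopy.side_unique (hW : ∀ f, (W f).Proper) {c : Cell ι κ} {u v u₁ v₁ q p : Plane}
    (h : IsCopy K H W c u v q p) (h' : IsCopy K H W c u₁ v₁ q p) : u = u₁ ∧ v = v₁ := by
  rcases c.mesh_or with ⟨f, rfl⟩ | hc
  · obtain ⟨i, hi⟩ := isCopy_mesh_iff.1 h
    obtain ⟨j, hj⟩ := isCopy_mesh_iff.1 h'
    have hne := (hW f).ne i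
    have hseg : ∀ k, (q = (W f k).1 ∧ p = (W f k).2) ∨ (q = (W f k).2 ∧ p = (W f k).1) →
        segment ℝ (W f k).1 (W f k).2 = segment ℝ q p := by
      rintro k (⟨rfl, rfl⟩ | ⟨rfl, rfl⟩)
      · rfl
      · exact segment_symm _ _ _
    have si := hseg i (hi.imp (fun h => h.2.2) (fun h => h.2.2))
    have sj := hseg j (hj.imp (fun h => h.2.2) (fun h => h.2.2))
    have hij : i = j := by
      by_contra hij
      have := (hW f).notMem_segment hij (midpoint_mem_openSegment (W f i).1 (W f i).2)
      rw [sj, ← si] at this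
      exact this (midpoint_mem_segment _ _)
    subst hij
    rcases hi with ⟨h1, h2, h3, h4⟩ | ⟨h1, h2, h3, h4⟩ <;>
      rcases hj with ⟨k1, k2, k3, k4⟩ | ⟨k1, k2, k3, k4⟩
    · exact ⟨h1.trans k1.symm, h2.trans k2.symm⟩
    · exact absurd (h3.symm.trans k3) hne
    · exact absurd (k3.symm.trans h3) hne
    · exact ⟨h1.trans k1.symm, h2.trans k2.symm⟩
  · have e1 := h.unmoved hc
    have e2 := h'.unmoved hc
    exact ⟨e1.1.symm.trans e2.1, e1.2.symm.trans e2.2⟩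

/-- Different sides at a vertex of the duplicate of a cell lead to different vertices of the
duplicates of the neighbouring cells. -/
lemma IsCopy.opposite_injective (hKH : AdmissibleInput K H) (hW : ∀ f, (W f).Proper)
    {c c' : Cell ι κ} (hcc : c' ≠ c) {u v q u₁ v₁ q₁ p u₂ u₂' w : Plane}
    (h : IsCopy K H W c u v q p) (h' : IsCopy K H W c' u v u₂ w)
    (h₁ : IsCopy K H W c u₁ v₁ q₁ p) (h₁' : IsCopy K H W c' u₁ v₁ u₂' w) : u = u₁ ∧ v = v₁ := by
  have hout : ∀ {f : ι} {u v u₁ v₁ : Plane}, HasSide K H (Cell.mesh f) u v →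
      HasSide K H Cell.outside u v → HasSide K H (Cell.mesh f) u₁ v₁ →
      HasSide K H Cell.outside u₁ v₁ → v = v₁ → u = u₁ ∧ v = v₁ := by
    rintro f u v u₁ v₁ ⟨i, hi⟩ ⟨-, -, -, hs⟩ ⟨j, hj⟩ ⟨-, -, -, hs'⟩ rfl
    exact ⟨hKH.outside_side_unique hi hj hs hs', rfl⟩
  -- If one of the cells is the outside, the other is a polygon of `K`; the outside does not move
  -- its points, so `v = v₁`, and the polygon has only one outside side there. Otherwise two
  -- polygons share a single side, up to its orientation.
  rcases c.eq_outside_or with rfl | ⟨a, rfl⟩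
  · rcases HasSide.exists_mesh hKH h'.hasSide h.hasSide hcc with ⟨f, rfl⟩ | ⟨f, hf⟩
    · refine hout h'.hasSide h.hasSide h₁'.hasSide h₁.hasSide ?_
      exact (h.unmoved (by simp)).2.symm.trans (h₁.unmoved (by simp)).2
    · simp at hf
  rcases c'.eq_outside_or with rfl | ⟨b, rfl⟩
  · rcases HasSide.exists_mesh hKH h.hasSide h'.hasSide hcc.symm with ⟨f, hf⟩ | ⟨f, hf⟩
    · rw [hf] at h h₁
      refine hout h.hasSide h'.hasSide h₁.hasSide h₁'.hasSide ?_
      exact (h'.unmoved (by simp)).2.symm.trans (h₁'.unmoved (by simp)).2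
    · simp at hf
  · rcases segment_eq_segment (HasSide.segment_eq hKH h.hasSide h'.hasSide h₁.hasSide h₁'.hasSide
      (fun e => hcc (e ▸ rfl))) with h0 | ⟨rfl, rfl⟩
    · exact h0
    -- The reversed orientation would give both ends of the copy the same position.
    · have := h.unique h₁.symm
      exact absurd this.1 (h.ne hW)

/-- Edges are either copies of sides or links across a side, the latter all occurring in Class 3. A
copied side of a hole or of the outside comes from Class 2, since the opposite cell is a polygon of
`K`. -/
lemma mem_eulerEdges_iff [Finite ι] [Finite κ] (hKH : AdmissibleInput K H)
    {x y : Cell ι κ × Plane} : s(x, y) ∈ eulerEdges K H W ↔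
      (x.1 = y.1 ∧ ∃ u v, IsCopy K H W x.1 u v y.2 x.2) ∨
      (y.1 ≠ x.1 ∧ ∃ u v u₁ u₂, IsCopy K H W x.1 u v u₁ x.2 ∧ IsCopy K H W y.1 u v u₂ y.2) := by
  constructor
  · have hsame : ∀ {c : Cell ι κ} {u v u' v' : Plane}, IsCopy K H W c u v u' v' →
        s(x, y) = s((c, u'), (c, v')) → (x.1 = y.1 ∧ ∃ u v, IsCopy K H W x.1 u v y.2 x.2) := by
      intro c u v u' v' h he
      rcases Sym2.eq_iff.1 he with ⟨rfl, rfl⟩ | ⟨rfl, rfl⟩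
      · exact ⟨rfl, v, u, h.symm⟩
      · exact ⟨rfl, u, v, h⟩
    have hdiff : ∀ {c c' : Cell ι κ} {u v u₁ v₁ u₂ v₂ : Plane}, c ≠ c' →
        IsCopy K H W c u v u₁ v₁ → IsCopy K H W c' u v u₂ v₂ →
        s(x, y) = s((c, v₁), (c', v₂)) → (y.1 ≠ x.1 ∧
          ∃ u v u₁ u₂, IsCopy K H W x.1 u v u₁ x.2 ∧ IsCopy K H W y.1 u v u₂ y.2) := by
      intro c c' u v u₁ v₁ u₂ v₂ hc h h' he
      rcases Sym2.eq_iff.1 he with ⟨rfl, rfl⟩ | ⟨rfl, rfl⟩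
      · exact ⟨hc.symm, u, v, _, _, h, h'⟩
      · exact ⟨hc, u, v, _, _, h', h⟩
    rintro ((h | h) | h)
    · obtain ⟨f, u, v, u', v', h, he⟩ := mem_iUnion.1 h
      exact Or.inl (hsame h he)
    · obtain ⟨u, h⟩ := mem_iUnion.1 h
      obtain ⟨v, f, c, u₁, v₁, u₂, v₂, hc, h1, h2, he | he | he | he⟩ := mem_iUnion.1 h
      · exact Or.inl (hsame h1 he)
      · exact Or.inl (hsame h2 he)
      · exact Or.inr (hdiff hc.symm h1.symm h2.symm he)
      · exact Or.inr (hdiff hc.symm h1 h2 he)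
    · obtain ⟨w, c₁, c₂, u, u₁, v₁, u₂, v₂, hc, h1, h2, he⟩ := mem_iUnion.1 h
      exact Or.inr (hdiff hc h1 h2 he)
  · obtain ⟨c, p⟩ := x
    obtain ⟨c', q⟩ := y
    rintro (⟨hc, u, v, h⟩ | ⟨hc, u, v, u₁, u₂, h1, h2⟩)
    · simp only at hc h
      subst hc
      rcases c.mesh_or with ⟨f, rfl⟩ | hcm
      · exact Or.inl (Or.inl (mem_iUnion.2 ⟨f, v, u, p, q, h.symm, rfl⟩))
      · obtain ⟨c', hc', h'⟩ := h.hasSide.exists_opposite hKH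
        obtain ⟨f, rfl⟩ : ∃ f, c' = Cell.mesh f := by
          rcases HasSide.exists_mesh hKH h.hasSide h' hc'.symm with ⟨f, hf⟩ | hf
          · exact (hcm f hf).elim
          · exact hf
        obtain ⟨u', v', h''⟩ := h'.exists_isCopy (W := W)
        exact Or.inl (Or.inr (mem_iUnion.2 ⟨v, mem_iUnion.2 ⟨u, f, c, v', u', p, q, hc'.symm,
          h''.symm, h.symm, Or.inr (Or.inl rfl)⟩⟩))
    · exact Or.inr (mem_iUnion.2 ⟨v, c, c', u, u₁, p, u₂, q, hc.symm, h1, h2, rfl⟩)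

/-- The sides of a cell with a marked end point whose copy is `p`. -/
def darts (K : PolygonalComplex ι) (H : κ → Polygon2) (W : ∀ f, (K.polygon f).Wavefront)
    (c : Cell ι κ) (p : Plane) : Set (Plane × Plane × Plane) :=
  {d | IsCopy K H W c d.1 d.2.1 d.2.2 p}

lemma finite_vertices [Finite ι] [Finite κ] (K : PolygonalComplex ι) (H : κ → Polygon2) :
    (⋃ a, range (polygonAt K H a).vertex).Finite :=
  finite_iUnion fun _ => finite_range _

lemma HasSide.mem_vertices {c : Cell ι κ} {u v : Plane} (h : HasSide K H c u v) :
    u ∈ ⋃ a, range (polygonAt K H a).vertex := by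
  have key : ∀ {a : ι ⊕ κ} {i : (polygonAt K H a).Idx}, (polygonAt K H a).IsSide i u v →
      u ∈ ⋃ a, range (polygonAt K H a).vertex := by
    rintro a i (⟨rfl, -⟩ | ⟨rfl, -⟩) <;> exact mem_iUnion.2 ⟨a, mem_range_self _⟩
  rcases c with f | k | _
  · obtain ⟨i, hi⟩ := h; exact key (a := Sum.inl f) hi
  · obtain ⟨i, hi⟩ := h; exact key (a := Sum.inr k) hi
  · obtain ⟨f, i, hi, -⟩ := h; exact key (a := Sum.inl f) hi

lemma finite_darts [Finite ι] [Finite κ] (c : Cell ι κ) (p : Plane) :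
    (darts K H W c p).Finite := by
  refine Finite.of_finite_image (f := fun d => (d.1, d.2.1)) (((finite_vertices K H).prod
    (finite_vertices K H)).subset ?_) ?_
  · rintro _ ⟨⟨u, v, q⟩, h, rfl⟩
    have h : IsCopy K H W c u v q p := h
    exact ⟨h.hasSide.mem_vertices, h.symm.hasSide.mem_vertices⟩
  · rintro ⟨u, v, q⟩ h ⟨u', v', q'⟩ h' he
    have h : IsCopy K H W c u v q p := h
    have h' : IsCopy K H W c u' v' q' p := h'
    simp only [Prod.mk.injEq] at he
    obtain ⟨rfl, rfl⟩ := he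
    rw [(h.unique h').1]

theorem eulerSkeleton_degree [Finite ι] [Finite κ] (hKH : AdmissibleInput K H)
    (hW : ∀ f, (W f).Proper) (x : Cell ι κ × Plane) :
    ((eulerSkeleton K H W).neighborSet x).Finite ∧
      Even ((eulerSkeleton K H W).neighborSet x).ncard := by
  obtain ⟨c, p⟩ := x
  have hfin := finite_darts (K := K) (H := H) (W := W) c p
  -- The function `g` sends a side at `p` to the vertex across it; its value off `darts` is
  -- irrelevant.
  have hopp : ∀ d : Plane × Plane × Plane, ∃ y : Cell ι κ × Plane, d ∈ darts K H W c p →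
      y.1 ≠ c ∧ ∃ u₂, IsCopy K H W y.1 d.1 d.2.1 u₂ y.2 := by
    intro d
    by_cases hd : d ∈ darts K H W c p
    · have hd' : IsCopy K H W c d.1 d.2.1 d.2.2 p := hd
      obtain ⟨c', hc', h'⟩ := hd'.hasSide.exists_opposite hKH
      obtain ⟨u', v', h''⟩ := h'.exists_isCopy (W := W)
      exact ⟨(c', v'), fun _ => ⟨hc', u', h''⟩⟩
    · exact ⟨(c, p), fun h => absurd h hd⟩
  choose g hg using hopp
  have hN : (eulerSkeleton K H W).neighborSet (c, p) =
      (fun d : Plane × Plane × Plane => (c, d.2.2)) '' darts K H W c p ∪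
        g '' darts K H W c p := by
    ext y
    rw [SimpleGraph.mem_neighborSet, eulerSkeleton, SimpleGraph.fromEdgeSet_adj,
      mem_eulerEdges_iff hKH]
    constructor
    · rintro ⟨⟨hc, u, v, h⟩ | ⟨hc, u, v, u₁, u₂, h1, h2⟩, -⟩
      · exact Or.inl ⟨(u, v, y.2), h, Prod.ext hc rfl⟩
      · right
        refine ⟨(u, v, u₁), h1, ?_⟩
        obtain ⟨k1, u', k2⟩ := hg (u, v, u₁) h1
        have hcc := HasSide.opposite_unique hKH h1.hasSide k2.hasSide h2.hasSide k1 hc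
        rw [hcc] at k2
        exact Prod.ext hcc (k2.unique h2).2
    · rintro (⟨⟨u, v, q⟩, h, rfl⟩ | ⟨d, hd, rfl⟩)
      · have h : IsCopy K H W c u v q p := h
        exact ⟨Or.inl ⟨rfl, u, v, h⟩, fun he => h.ne hW (congrArg Prod.snd he).symm⟩
      · obtain ⟨k1, u', k2⟩ := hg d hd
        exact ⟨Or.inr ⟨k1, d.1, d.2.1, _, u', hd, k2⟩, fun he => k1 (congrArg Prod.fst he).symm⟩
  have hinj1 : InjOn (fun d : Plane × Plane × Plane => (c, d.2.2)) (darts K H W c p) := by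
    rintro ⟨u, v, q⟩ h ⟨u', v', q'⟩ h' he
    have h : IsCopy K H W c u v q p := h
    have h' : IsCopy K H W c u' v' q' p := h'
    simp only [Prod.mk.injEq, true_and] at he
    subst he
    obtain ⟨rfl, rfl⟩ := h.side_unique hW h'
    rfl
  have hinj2 : InjOn g (darts K H W c p) := by
    rintro ⟨u, v, q⟩ h ⟨u', v', q'⟩ h' he
    obtain ⟨k1, w, k2⟩ := hg _ h
    obtain ⟨k1', w', k2'⟩ := hg _ h'
    have h : IsCopy K H W c u v q p := h
    have h' : IsCopy K H W c u' v' q' p := h'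
    rw [← he] at k2'
    obtain ⟨rfl, rfl⟩ := h.opposite_injective hKH hW k1 k2 h' k2'
    rw [(h.unique h').1]
  have hdisj : Disjoint ((fun d : Plane × Plane × Plane => (c, d.2.2)) '' darts K H W c p)
      (g '' darts K H W c p) := by
    rw [disjoint_left]
    rintro _ ⟨d, -, rfl⟩ ⟨d', hd', he⟩
    exact (hg d' hd').1 (by rw [he])
  rw [hN]
  refine ⟨(hfin.image _).union (hfin.image _), ?_⟩
  rw [ncard_union_eq hdisj (hfin.image _) (hfin.image _), hinj1.ncard_image,
    hinj2.ncard_image]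
  -- Both kinds of neighbours are counted by the darts.
  exact ⟨_, rfl⟩

end Degree

/-! ### Compatible colourings of the sides -/

section Counting

/-- At most one term is negative, and any other term compensates for it. -/
lemma Finset.sum_nonneg_of_pairwise {α : Type*} (s : Finset α) (f : α → ℝ)
    (h : ∀ a ∈ s, ∀ b ∈ s, a ≠ b → 0 ≤ f a + f b) (hs : s.card ≠ 1) : 0 ≤ ∑ a ∈ s, f a := by
  classical
  by_cases hn : ∀ a ∈ s, 0 ≤ f a
  · exact Finset.sum_nonneg hn
  push Not at hn
  obtain ⟨a, ha, hfa⟩ := hn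
  have h1 : 1 < s.card := lt_of_le_of_ne (Finset.card_pos.2 ⟨a, ha⟩) (Ne.symm hs)
  obtain ⟨b, hb, hba⟩ := Finset.exists_mem_ne h1 a
  have hb' : b ∈ s.erase a := Finset.mem_erase.2 ⟨hba, hb⟩
  rw [← Finset.add_sum_erase s f ha, ← Finset.add_sum_erase _ f hb', ← add_assoc]
  refine add_nonneg (h a ha b hb hba.symm) (Finset.sum_nonneg fun c hc => ?_)
  have hc' := Finset.mem_of_mem_erase hc
  linarith [h a ha c (Finset.mem_of_mem_erase hc') (Finset.ne_of_mem_erase hc').symm]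

/-- If each element is an arrow between two points, no point is the source or the target of two
arrows, arrows carry colours at both ends that agree at common points, and all ends at points which
are not both a source and a target have the same colour, then there is not exactly one arrow
whose two colours differ. -/
lemma not_existsUnique_color_change {C X : Type*} [Finite C] {a b : C → X}
    (ha : Function.Injective a) (hb : Function.Injective b) {A B : C → Bool} {ν : Bool}
    (hab : ∀ c d, a c = b d → A c = B d) (hA : ∀ c, a c ∉ range b → A c = ν)
    (hB : ∀ c, b c ∉ range a → B c = ν) : ¬ ∃! c, A c ≠ B c := by
  rintro ⟨c, hc, huniq⟩
  -- Ends of colour other than `ν` are matched, source against target, so there are equally many of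
  -- both. A single arrow with different colours would make the two numbers differ by 1.
  have himg : a '' {c | A c ≠ ν} = b '' {c | B c ≠ ν} := by
    ext x
    constructor
    · rintro ⟨d, hd, rfl⟩
      obtain ⟨e, he⟩ : a d ∈ range b := by_contra fun h => hd (hA d h)
      exact ⟨e, by rw [mem_ofPred_eq, ← hab d e he.symm]; exact hd, he⟩
    · rintro ⟨d, hd, rfl⟩
      obtain ⟨e, he⟩ : b d ∈ range a := by_contra fun h => hd (hB d h)
      exact ⟨e, by rw [mem_ofPred_eq, hab e d he]; exact hd, he⟩
  have hcard : {c | A c ≠ ν}.ncard = {c | B c ≠ ν}.ncard := by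
    rw [← ncard_image_of_injective _ ha, himg, ncard_image_of_injective _ hb]
  have heq : ∀ d, d ≠ c → A d = B d := fun d hd => by_contra fun h => hd (huniq d h)
  have key : ∀ {S T : Set C}, S.ncard = T.ncard → (∀ d, d ≠ c → (d ∈ S ↔ d ∈ T)) → c ∈ S →
      c ∉ T → False := by
    intro S T hST hd hcS hcT
    have : S = insert c T := by
      ext d
      by_cases hdc : d = c
      · simp [hdc, hcS]
      · simp [hdc, hd d hdc]
    rw [this, ncard_insert_of_notMem hcT] at hST
    omega
  by_cases hcA : A c = ν
  · exact key hcard.symm (fun d hd => by simp [heq d hd]) (fun h => hc (hcA.trans h.symm))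
      (fun h => h hcA)
  · by_cases hcB : B c = ν
    · exact key hcard (fun d hd => by simp [heq d hd]) hcA (fun h => h hcB)
    · apply hc
      cases h1 : A c <;> cases h2 : B c <;> cases ν <;> simp_all

end Counting

section Coloring

variable {ι κ : Type*} {K : PolygonalComplex ι} {H : κ → Polygon2}
  {χ : ∀ f, (K.polygon f).Idx → Bool}

/-- A colouring of the sides of the polygons of `K` such that common sides have the same colour, and
so do sides at a common vertex which belong to the same hole or to the outside cell. -/
structure CompatibleColoring (K : PolygonalComplex ι) (H : κ → Polygon2)
    (χ : ∀ f, (K.polygon f).Idx → Bool) : Prop where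
  shared : ∀ {f g i j u v}, (K.polygon f).IsSide i u v → (K.polygon g).IsSide j u v →
    χ f i = χ g j
  boundary : ∀ {c : Cell ι κ} {f g i j u u' v}, (∀ f, c ≠ Cell.mesh f) →
    HasSide K H c u v → HasSide K H c u' v →
    (K.polygon f).IsSide i u v → (K.polygon g).IsSide j u' v → χ f i = χ g j

lemma AdmissibleInput.boundary_cell_unique (hKH : AdmissibleInput K H) {c c' : Cell ι κ}
    (hc : ∀ f, c ≠ Cell.mesh f) (hc' : ∀ f, c' ≠ Cell.mesh f) {u u' v : Plane}
    (h : HasSide K H c u v) (h' : HasSide K H c' u' v) : c = c' := by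
  have hmem : ∀ {k : κ} {u : Plane}, HasSide K H (Cell.hole k) u v → v ∈ (H k).region := by
    rintro k u ⟨i, hi⟩
    exact (H k).edge_subset_region i (hi.edge_eq ▸ right_mem_segment ℝ u v)
  have hout : ∀ {u : Plane}, HasSide K H Cell.outside u v → v ∈ outsideRegion K H := by
    rintro u ⟨-, -, -, hsub⟩
    exact hsub (right_mem_segment ℝ u v)
  rcases c with f | k | _ <;> rcases c' with f' | k' | _
  · exact (hc f rfl).elim
  · exact (hc f rfl).elim
  · exact (hc f rfl).elim
  · exact (hc' f' rfl).elim
  · by_contra hne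
    exact disjoint_left.1 (hKH.holes_disjoint k k' fun e => hne (e ▸ rfl)) (hmem h) (hmem h')
  · exact (disjoint_left.1 (hKH.hole_outside_disjoint k) (hmem h) (hout h')).elim
  · exact (hc' f' rfl).elim
  · exact (disjoint_left.1 (hKH.hole_outside_disjoint k') (hmem h') (hout h)).elim
  · rfl

lemma CompatibleColoring.boundary_color (hKH : AdmissibleInput K H)
    (hχ : CompatibleColoring K H χ) {c c' : Cell ι κ} (hc : ∀ f, c ≠ Cell.mesh f)
    (hc' : ∀ f, c' ≠ Cell.mesh f) {f g : ι} {i : (K.polygon f).Idx} {j : (K.polygon g).Idx}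
    {u u' v : Plane} (h : HasSide K H c u v) (h' : HasSide K H c' u' v)
    (hi : (K.polygon f).IsSide i u v) (hj : (K.polygon g).IsSide j u' v) : χ f i = χ g j := by
  obtain rfl := hKH.boundary_cell_unique hc hc' h h'
  exact hχ.boundary hc h h' hi hj

lemma CompatibleColoring.exists_boundary_color (hKH : AdmissibleInput K H)
    (hχ : CompatibleColoring K H χ) (v : Plane) : ∃ ν, ∀ (c : Cell ι κ), (∀ f, c ≠ Cell.mesh f) →
      ∀ (f : ι) (i : (K.polygon f).Idx) (u : Plane), HasSide K H c u v →
        (K.polygon f).IsSide i u v → χ f i = ν := by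
  by_cases hex : ∃ (c : Cell ι κ), (∀ f, c ≠ Cell.mesh f) ∧
      ∃ (f : ι) (i : (K.polygon f).Idx) (u : Plane), HasSide K H c u v ∧ (K.polygon f).IsSide i u v
  · obtain ⟨c, hc, f, i, u, h, hi⟩ := hex
    exact ⟨χ f i, fun c' hc' g j u' h' hj => hχ.boundary_color hKH hc' hc h' h hj hi⟩
  · push Not at hex
    exact ⟨true, fun c hc f i u h hi => (hex c hc f i u h hi).elim⟩

/-- The corners of the polygons of `K` at `v`. -/
abbrev Corner (K : PolygonalComplex ι) (v : Plane) : Type _ :=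
  {c : Σ f, (K.polygon f).Idx // (K.polygon c.1).vertex (c.2 + 1) = v}

lemma Polygon2.vertex_eq_of_edge_mesh (hKH : AdmissibleInput K H) {f g : ι} (hfg : f ≠ g)
    {i : (K.polygon f).Idx} {j : (K.polygon g).Idx}
    (h : (K.polygon f).edge i = (K.polygon g).edge j) :
    (K.polygon f).vertex i = (K.polygon g).vertex (j + 1) ∧
      (K.polygon f).vertex (i + 1) = (K.polygon g).vertex j :=
  Polygon2.vertex_eq_of_edge_eq
    (hKH.touch (a := Sum.inl f) (b := Sum.inl g) fun e => hfg (Sum.inl_injective e)).disjoint_inside h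

/-- Two different polygons traverse a common side in opposite directions, so a directed side
determines polygon and index. -/
lemma corner_eq (hKH : AdmissibleInput K H) {f g : ι} {i : (K.polygon f).Idx}
    {j : (K.polygon g).Idx} (h : (K.polygon f).vertex i = (K.polygon g).vertex j)
    (h' : (K.polygon f).vertex (i + 1) = (K.polygon g).vertex (j + 1)) :
    (⟨f, i⟩ : Σ f, (K.polygon f).Idx) = ⟨g, j⟩ := by
  by_cases hfg : f = g
  · subst hfg
    rw [(K.polygon f).vertex_injective h]
  · have he : (K.polygon f).edge i = (K.polygon g).edge j := by
      rw [PolygonCurve.edge, PolygonCurve.edge, h, h']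
    exact ((K.polygon f).vertex_succ_ne i
      (h'.trans (Polygon2.vertex_eq_of_edge_mesh hKH hfg he).1.symm).symm).elim

lemma exists_reversed_side [Finite ι] [Finite κ] (hKH : AdmissibleInput K H) (f : ι)
    (i : (K.polygon f).Idx) {u v : Plane} (hi : (K.polygon f).IsSide i u v) :
    (∃ c : Cell ι κ, (∀ f, c ≠ Cell.mesh f) ∧ HasSide K H c u v) ∨
      ∃ g j, (K.polygon g).vertex j = (K.polygon f).vertex (i + 1) ∧
        (K.polygon g).vertex (j + 1) = (K.polygon f).vertex i := by
  have h : HasSide K H (Cell.mesh f) u v := ⟨i, hi⟩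
  obtain ⟨c, hc, h'⟩ := h.exists_opposite hKH
  rcases c.mesh_or with ⟨g, rfl⟩ | hc'
  · obtain ⟨j, hj⟩ := h'
    have := Polygon2.vertex_eq_of_edge_mesh hKH (f := g) (g := f)
      (fun e => hc (congrArg Cell.mesh e))
      (hj.edge_eq.trans hi.edge_eq.symm)
    exact Or.inr ⟨g, j, this.1, this.2⟩
  · exact Or.inl ⟨c, hc', h'⟩

/-- A corner at `v` is an arrow from the preceding to the following neighbour of `v` on its polygon.
Arrows of adjacent polygons fit together with equal colours, and unmatched ends lie on a hole or the
outside, where only one colour `ν` occurs at `v`. -/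
lemma CompatibleColoring.not_existsUnique_transition [Finite ι] [Finite κ]
    (hKH : AdmissibleInput K H) (hχ : CompatibleColoring K H χ) (v : Plane) :
    ¬ ∃! c : Corner K v, χ c.1.1 c.1.2 ≠ χ c.1.1 (c.1.2 + 1) := by
  obtain ⟨ν, hν⟩ := hχ.exists_boundary_color hKH v
  have hin : ∀ c : Corner K v, (K.polygon c.1.1).IsSide c.1.2 ((K.polygon c.1.1).vertex c.1.2) v :=
    fun c => Or.inl ⟨rfl, c.2.symm⟩
  have hout : ∀ c : Corner K v, (K.polygon c.1.1).IsSide (c.1.2 + 1)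
      ((K.polygon c.1.1).vertex (c.1.2 + 1 + 1)) v := fun c => Or.inr ⟨rfl, c.2.symm⟩
  refine not_existsUnique_color_change
    (a := fun c : Corner K v => (K.polygon c.1.1).vertex c.1.2)
    (b := fun c : Corner K v => (K.polygon c.1.1).vertex (c.1.2 + 1 + 1)) (ν := ν) ?_ ?_ ?_ ?_ ?_
  · rintro ⟨⟨f, i⟩, h⟩ ⟨⟨g, j⟩, h'⟩ he
    exact Subtype.ext (corner_eq hKH he (h.trans h'.symm))
  · rintro ⟨⟨f, i⟩, h⟩ ⟨⟨g, j⟩, h'⟩ he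
    have := corner_eq hKH (h.trans h'.symm) he
    simp only [Sigma.mk.injEq] at this
    obtain ⟨rfl, h2⟩ := this
    have := add_right_cancel (eq_of_heq h2)
    subst this
    rfl
  · intro c d he
    have h1 := hin c
    have he : (K.polygon c.1.1).vertex c.1.2 = (K.polygon d.1.1).vertex (d.1.2 + 1 + 1) := he
    rw [he] at h1
    exact hχ.shared h1 (hout d)
  · intro c hc
    rcases exists_reversed_side hKH _ _ (hin c) with ⟨c', hc', h⟩ | ⟨g, j, h1, h2⟩
    · exact hν c' hc' _ _ _ h (hin c)
    · refine (hc ⟨⟨⟨g, j - 1⟩, ?_⟩, ?_⟩).elim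
      · simp only [sub_add_cancel]; exact h1.trans c.2
      · simp only [sub_add_cancel]; exact h2
  · intro c hc
    rcases exists_reversed_side hKH _ _ (hout c) with ⟨c', hc', h⟩ | ⟨g, j, h1, h2⟩
    · exact hν c' hc' _ _ _ h (hout c)
    · exact (hc ⟨⟨⟨g, j⟩, h2.trans c.2⟩, h1⟩).elim

theorem CompatibleColoring.constant [Finite ι] [Finite κ] (hKH : AdmissibleInput K H)
    (hχ : CompatibleColoring K H χ) {δ : ι → ℝ} (hδ : ∀ f, 0 < δ f)
    {W : ∀ f, (K.polygon f).Wavefront} (hW : ∀ f, (K.polygon f).MiteredOffset (δ f) (W f))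
    (hcyc : ∀ f i j, (W f i).2 = (W f j).1 → χ f i = χ f j) (f : ι) (i j : (K.polygon f).Idx) :
    χ f i = χ f j := by
  classical
  have := Fintype.ofFinite ι
  have hsucc : ∀ f i, χ f i = χ f (i + 1) := by
    by_contra! hex
    obtain ⟨f, i, hfi⟩ := hex
    let S : Finset (Σ f, (K.polygon f).Idx) :=
      Finset.univ.filter fun c => χ c.1 c.2 ≠ χ c.1 (c.2 + 1)
    let τ : (Σ f, (K.polygon f).Idx) → ℝ := fun c => (K.polygon c.1).turn c.2 (c.2 + 1)
    -- Summation polygon by polygon.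
    have hneg : ∑ c ∈ S, τ c < 0 := by
      have hS : ∑ c ∈ S, τ c = ∑ f, ∑ i with χ f i ≠ χ f (i + 1), (K.polygon f).turn i (i + 1) := by
        rw [Finset.sum_filter, Fintype.sum_sigma]
        exact Finset.sum_congr rfl fun f _ => (Finset.sum_filter _ _).symm
      rw [hS]
      have hle : ∀ f, (∃ i, χ f i ≠ χ f (i + 1)) →
          ∑ i with χ f i ≠ χ f (i + 1), (K.polygon f).turn i (i + 1) < 0 := fun f hf =>
        (K.polygon f).transition_turn_neg (hδ f) (hW f) (χ f) (hcyc f) hf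
      refine Finset.sum_neg' (fun f _ => ?_) ⟨f, Finset.mem_univ f, hle f ⟨i, hfi⟩⟩
      by_cases hf : ∃ i, χ f i ≠ χ f (i + 1)
      · exact (hle f hf).le
      · push Not at hf
        rw [Finset.sum_eq_zero fun i hi => absurd (hf i) (Finset.mem_filter.1 hi).2]
    -- Summation vertex by vertex: two corners at a vertex never have a negative turning sum, and a
    -- vertex never has exactly one colour change.
    have hpos : 0 ≤ ∑ c ∈ S, τ c := by
      let p : (Σ f, (K.polygon f).Idx) → Plane := fun c => (K.polygon c.1).vertex (c.2 + 1)
      rw [← Finset.sum_fiberwise_of_maps_to (t := S.image p) (g := p)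
        fun c hc => Finset.mem_image_of_mem p hc]
      refine Finset.sum_nonneg fun v _ => Finset.sum_nonneg_of_pairwise _ _ ?_ ?_
      · rintro ⟨f, i⟩ ha ⟨g, j⟩ hb hab
        have ha := (Finset.mem_filter.1 ha).2
        have hb := (Finset.mem_filter.1 hb).2
        by_cases hfg : f = g
        · subst hfg
          have : i = j := add_right_cancel ((K.polygon f).vertex_injective (ha.trans hb.symm))
          exact (hab (by rw [this])).elim
        · exact Polygon2.turn_add_turn_nonneg (hKH.touch (a := Sum.inl f) (b := Sum.inl g)
            fun e => hfg (Sum.inl_injective e)).disjoint_inside (ha.trans hb.symm)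
      · intro hcard
        obtain ⟨c, hc⟩ := Finset.card_eq_one.1 hcard
        have hmem : ∀ d, d = c ↔ χ d.1 d.2 ≠ χ d.1 (d.2 + 1) ∧ p d = v := by
          intro d
          rw [← Finset.mem_singleton, ← hc, Finset.mem_filter, Finset.mem_filter]
          simp
        refine hχ.not_existsUnique_transition hKH v ⟨⟨c, ((hmem c).1 rfl).2⟩, ((hmem c).1 rfl).1, ?_⟩
        intro d hd
        exact Subtype.ext ((hmem d.1).2 ⟨hd, d.2⟩)
    exact absurd hneg (not_lt.2 hpos)
  have h0 : ∀ i, χ f i = χ f 0 := fun i =>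
    Fin.cyclic_induction (p := fun i => χ f i = χ f 0) 0 rfl (fun j hj => (hsucc f j).symm.trans hj) i
  rw [h0 i, h0 j]

end Coloring

/-! ### Connected complexes -/

lemma isPreconnected_punctured_ball (z : Plane) (ρ : ℝ) :
    IsPreconnected (Metric.ball z ρ \ {z}) := by
  have h : Metric.ball z ρ \ {z} =
      (fun q : ℝ × ℝ => polar z q.1 q.2) '' (Ioo 0 ρ ×ˢ univ) := by
    ext x
    constructor
    · rintro ⟨hx, hxz⟩
      obtain ⟨r, θ, hr, -, rfl⟩ := exists_polar hxz 0
      rw [Metric.mem_ball, dist_polar, abs_of_pos hr] at hx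
      exact ⟨(r, θ), ⟨⟨hr, hx⟩, mem_univ _⟩, rfl⟩
    · rintro ⟨⟨r, θ⟩, ⟨hr, -⟩, rfl⟩
      have hd := dist_polar z r θ
      rw [abs_of_pos hr.1] at hd
      refine ⟨by rw [Metric.mem_ball, hd]; exact hr.2, fun h0 => ?_⟩
      have h0 : polar z r θ = z := h0
      rw [h0, dist_self] at hd
      exact hr.1.ne hd
  rw [h]
  exact (isPreconnected_Ioo.prod isPreconnected_univ).image _ (continuous_polar z).continuousOn

section Connected

variable {ι κ : Type*} {K : PolygonalComplex ι} {H : κ → Polygon2}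

/-- If every side at `v` of a polygon of the family `S` is shared with another polygon of `S`,
then `S` covers a neighbourhood of `v`. -/
lemma iUnion_region_mem_nhds [Finite ι] [Finite κ] (hKH : AdmissibleInput K H) {S : Set ι}
    {f : ι} (hf : f ∈ S) (i : (K.polygon f).Idx)
    (hS : ∀ h ∈ S, ∀ j, (K.polygon f).vertex i ∈ (K.polygon h).edge j →
      ∃ g ∈ S, g ≠ h ∧ ∃ j', (K.polygon h).edge j = (K.polygon g).edge j') :
    (⋃ h ∈ S, (K.polygon h).region) ∈ 𝓝 ((K.polygon f).vertex i) := by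
  set v := (K.polygon f).vertex i
  set A := ⋃ h ∈ S, (K.polygon h).region
  have hA : IsClosed A := (toFinite S).isClosed_biUnion fun h _ => (K.polygon h).isClosed_region
  have hev : ∀ᶠ x in 𝓝 v, (∀ h j, x ∈ (K.polygon h).edge j → v ∈ (K.polygon h).edge j) ∧
      x ∉ (⋃ a, range (polygonAt K H a).vertex) \ {v} := by
    refine (eventually_all.2 fun h => ?_).and
      (((finite_vertices K H).sdiff).isClosed.isOpen_compl.mem_nhds (by simp))
    obtain ⟨ρ, hρ, hh⟩ := (K.polygon h).exists_ball_edge v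
    exact eventually_of_mem (Metric.ball_mem_nhds v hρ) hh
  obtain ⟨ρ, hρ, hball⟩ := Metric.eventually_nhds_iff_ball.1 hev
  -- A small punctured ball contains no other vertex, so its points of `A` are enclosed or inside a
  -- side shared within `S`, hence interior to `A`. Being connected, the punctured ball lies in `A`
  -- as soon as it meets its interior.
  have hcover : Metric.ball v ρ \ {v} ⊆ interior A ∪ Aᶜ := by
    rintro x ⟨hx, hxv⟩
    by_cases hxA : x ∈ A
    · left
      obtain ⟨h, hh, hxh⟩ := mem_iUnion₂.1 hxA
      rw [mem_interior_iff_mem_nhds]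
      rcases hxh with hxb | hxi
      · obtain ⟨j, hj⟩ := mem_iUnion.1 hxb
        obtain ⟨g, hg, hgh, j', hj'⟩ := hS h hh j ((hball x hx).1 h j hj)
        have hvert : ∀ k, x ≠ (K.polygon h).vertex k := fun k hk =>
          (hball x hx).2 ⟨mem_iUnion.2 ⟨Sum.inl h, k, hk.symm⟩, hxv⟩
        have hxo : x ∈ (K.polygon h).openEdge j :=
          mem_openSegment_of_ne_left_right (hvert j).symm (hvert (j + 1)).symm hj
        obtain ⟨e1, e2⟩ := Polygon2.vertex_eq_of_edge_mesh hKH hgh.symm hj'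
        refine mem_of_superset (Polygon2.region_union_mem_nhds e1 e2 hxo) (union_subset ?_ ?_)
        · exact subset_biUnion_of_mem (u := fun h => (K.polygon h).region) hh
        · exact subset_biUnion_of_mem (u := fun h => (K.polygon h).region) hg
      · refine mem_of_superset ((K.polygon h).isOpen_inside.mem_nhds hxi)
          ((K.polygon h).inside_subset_region.trans ?_)
        exact subset_biUnion_of_mem (u := fun h => (K.polygon h).region) hh
    · exact Or.inr hxA
  obtain ⟨y, hyi, hy⟩ := (K.polygon f).inside_inter_nhds_vertex i (Metric.ball_mem_nhds v hρ)
  have hyv : y ≠ v := fun h0 =>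
    hyi.1 (h0 ▸ (K.polygon f).edge_subset_boundary i ((K.polygon f).vertex_mem_edge i))
  have hyA : y ∈ interior A := by
    refine mem_interior.2 ⟨(K.polygon f).inside, (K.polygon f).inside_subset_region.trans ?_,
      (K.polygon f).isOpen_inside, hyi⟩
    exact subset_biUnion_of_mem (u := fun h => (K.polygon h).region) hf
  have hsub := (isPreconnected_punctured_ball v ρ).subset_left_of_subset_union isOpen_interior
    hA.isOpen_compl (disjoint_compl_right.mono_left interior_subset) hcover ⟨y, ⟨hy, hyv⟩, hyA⟩
  refine mem_of_superset (Metric.ball_mem_nhds v hρ) fun x hx => ?_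
  by_cases hxv : x = v
  · exact mem_biUnion hf (hxv ▸ (K.polygon f).vertex_mem_region i)
  · exact interior_subset (hsub ⟨hx, hxv⟩)

/-- Polygons meet in common faces, so a vertex of one cannot lie in the middle of a side of another.
-/
lemma isSide_of_vertex_mem_edge (K : PolygonalComplex ι) {f h : ι} {i : (K.polygon f).Idx}
    {j : (K.polygon h).Idx} (hij : (K.polygon f).vertex i ∈ (K.polygon h).edge j) :
    ∃ u, (K.polygon h).IsSide j u ((K.polygon f).vertex i) := by
  have hself : ∀ k, (K.polygon h).vertex k ∈ (K.polygon h).edge j →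
      ∃ u, (K.polygon h).IsSide j u ((K.polygon h).vertex k) := by
    intro k hk
    rcases (K.polygon h).eq_of_vertex_mem_edge hk with rfl | rfl
    · exact ⟨_, Or.inr ⟨rfl, rfl⟩⟩
    · exact ⟨_, Or.inl ⟨rfl, rfl⟩⟩
  obtain ⟨k, hk⟩ : ∃ k, (K.polygon f).vertex i = (K.polygon h).vertex k := by
    by_cases hfh : f = h
    · subst hfh; exact ⟨i, rfl⟩
    · rcases (K.meet f h hfh).touch _ ⟨(K.polygon f).vertex_mem_region i,
        (K.polygon h).edge_subset_region j hij⟩ with ⟨-, k, -, hk⟩ | ⟨a, b, hab, ha⟩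
      · exact ⟨k, hk⟩
      · have hs : (K.polygon f).IsSide a ((K.polygon h).vertex b) ((K.polygon h).vertex (b + 1)) :=
          PolygonCurve.isSide_of_edge_eq hab
        rcases (K.polygon f).eq_of_vertex_mem_edge ha with rfl | rfl <;>
          rcases hs with ⟨h1, h2⟩ | ⟨h1, h2⟩
        · exact ⟨_, h1.symm⟩
        · exact ⟨_, h2.symm⟩
        · exact ⟨_, h2.symm⟩
        · exact ⟨_, h1.symm⟩
  rw [hk] at hij ⊢
  exact hself k hij

variable {γ : ι → Bool}

/-- Otherwise every side at the vertex of a polygon coloured like `f` is shared with another such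
polygon. These polygons then cover a neighbourhood, leaving no room for the enclosed points of `g`.
-/
lemma CompatibleColoring.exists_boundary_side [Finite ι] [Finite κ] (hKH : AdmissibleInput K H)
    (hγ : CompatibleColoring K H fun f _ => γ f) {f g : ι} {i : (K.polygon f).Idx}
    {j : (K.polygon g).Idx} (hij : (K.polygon f).vertex i = (K.polygon g).vertex j)
    (hfg : γ f ≠ γ g) : ∃ h k u, ∃ c : Cell ι κ, γ h = γ f ∧ (∀ f, c ≠ Cell.mesh f) ∧
      (K.polygon h).IsSide k u ((K.polygon f).vertex i) ∧
      HasSide K H c u ((K.polygon f).vertex i) := by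
  by_contra! hno
  have hnhds := iUnion_region_mem_nhds hKH (S := {h | γ h = γ f}) rfl i (by
    intro h hh k hk
    obtain ⟨u, hu⟩ := isSide_of_vertex_mem_edge K hk
    have hm : HasSide K H (Cell.mesh h) u ((K.polygon f).vertex i) := ⟨k, hu⟩
    obtain ⟨c, hc, hcs⟩ := hm.exists_opposite hKH
    rcases c.mesh_or with ⟨g, rfl⟩ | hc'
    · obtain ⟨l, hl⟩ := hcs
      exact ⟨g, (hγ.shared hl hu).trans hh, fun e => hc (congrArg Cell.mesh e), l,
        hu.edge_eq.trans hl.edge_eq.symm⟩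
    · exact (hno h k u c hh hc' hu hcs).elim)
  rw [hij] at hnhds
  obtain ⟨y, hyi, hy⟩ := (K.polygon g).inside_inter_nhds_vertex j hnhds
  obtain ⟨h, hh, hyh⟩ := mem_iUnion₂.1 hy
  have hne : g ≠ h := fun e => hfg ((e ▸ hh : γ g = γ f).symm)
  exact (K.meet g h hne).touch.notMem_region hyi hyh

/-- The unions of the polygons of either colour are closed and so must meet. A common side is
excluded at once; at a common vertex both colours would occur on sides of a hole or the outside. -/
theorem CompatibleColoring.eq_of_isConnected [Finite ι] [Finite κ] (hKH : AdmissibleInput K H)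
    (hγ : CompatibleColoring K H fun f _ => γ f) (hK : IsConnected K.support) (f g : ι) :
    γ f = γ g := by
  by_contra hfg
  have hclosed : ∀ S : Set ι, IsClosed (⋃ h ∈ S, (K.polygon h).region) := fun S =>
    (toFinite S).isClosed_biUnion fun h _ => (K.polygon h).isClosed_region
  have hne : ∀ h, ∃ x ∈ K.support, x ∈ (K.polygon h).region := fun h =>
    ⟨_, mem_iUnion.2 ⟨h, (K.polygon h).vertex_mem_region 0⟩, (K.polygon h).vertex_mem_region 0⟩
  obtain ⟨x, hx, hx'⟩ := hne f
  obtain ⟨y, hy, hy'⟩ := hne g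
  obtain ⟨z, -, hz1, hz2⟩ := isPreconnected_closed_iff.1 hK.isPreconnected _ _
    (hclosed {h | γ h = γ f}) (hclosed {h | γ h ≠ γ f}) (by
      intro x hx
      obtain ⟨h, hh⟩ := mem_iUnion.1 hx
      by_cases e : γ h = γ f
      · exact Or.inl (mem_biUnion (x := h) e hh)
      · exact Or.inr (mem_biUnion (x := h) e hh))
    ⟨x, hx, mem_biUnion (x := f) rfl hx'⟩ ⟨y, hy, mem_biUnion (x := g) (Ne.symm hfg) hy'⟩
  obtain ⟨a, ha, hza⟩ := mem_iUnion₂.1 hz1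
  obtain ⟨b, hb, hzb⟩ := mem_iUnion₂.1 hz2
  have hab : γ a ≠ γ b := fun e => hb (e.symm.trans ha)
  rcases (K.meet a b fun e => hab (congrArg γ e)).touch z ⟨hza, hzb⟩ with
    ⟨i, j, rfl, hij⟩ | ⟨i, j, hij, -⟩
  · obtain ⟨h, k, u, c, h1, h2, h3, h4⟩ := hγ.exists_boundary_side hKH hij hab
    obtain ⟨h', k', u', c', h1', h2', h3', h4'⟩ :=
      hγ.exists_boundary_side hKH hij.symm hab.symm
    rw [← hij] at h3' h4'
    exact hab (h1.symm.trans ((hγ.boundary_color hKH h2 h2' h4 h4' h3 h3').trans h1'))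
  · exact hab (hγ.shared (i := i) (j := j) (PolygonCurve.isSide_of_edge_eq rfl)
      (PolygonCurve.isSide_of_edge_eq hij.symm))

end Connected

/-! ### The Euler transformation -/

section Euler

variable {ι κ : Type*} {K : PolygonalComplex ι} {H : κ → Polygon2}
  {W : ∀ f, (K.polygon f).Wavefront}

lemma IsCopy.reachable_same [Finite ι] [Finite κ] (hKH : AdmissibleInput K H) {c : Cell ι κ}
    {u v u' v' : Plane} (h : IsCopy K H W c u v u' v') :
    (eulerSkeleton K H W).Reachable (c, u') (c, v') := by
  by_cases he : u' = v'
  · rw [he]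
  · refine SimpleGraph.Adj.reachable ?_
    rw [eulerSkeleton, SimpleGraph.fromEdgeSet_adj, mem_eulerEdges_iff hKH]
    exact ⟨Or.inl ⟨rfl, v, u, h.symm⟩, fun h0 => he (congrArg Prod.snd h0)⟩

lemma IsCopy.reachable_opposite [Finite ι] [Finite κ] (hKH : AdmissibleInput K H)
    {c c' : Cell ι κ} {u v u₁ v₁ u₂ v₂ : Plane} (h : IsCopy K H W c u v u₁ v₁)
    (h' : IsCopy K H W c' u v u₂ v₂) :
    (eulerSkeleton K H W).Reachable (c, v₁) (c', v₂) := by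
  by_cases hc : c' = c
  · subst hc
    rw [(h.unique h').2]
  · refine SimpleGraph.Adj.reachable ?_
    rw [eulerSkeleton, SimpleGraph.fromEdgeSet_adj, mem_eulerEdges_iff hKH]
    exact ⟨Or.inr ⟨hc, u, v, u₁, u₂, h, h'⟩, fun h0 => hc (congrArg Prod.fst h0).symm⟩

lemma exists_isCopy_of_mem_eulerVertices [Finite ι] [Finite κ] (hKH : AdmissibleInput K H)
    {x : Cell ι κ × Plane} (hx : x ∈ eulerVertices K H W) :
    ∃ u v q, IsCopy K H W x.1 u v q x.2 := by
  obtain ⟨e, he, hxe⟩ := hx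
  obtain ⟨y, rfl⟩ := Sym2.mem_iff_exists.1 hxe
  rcases (mem_eulerEdges_iff hKH).1 he with ⟨-, u, v, h⟩ | ⟨-, u, v, u₁, u₂, h, -⟩
  · exact ⟨u, v, y.2, h⟩
  · exact ⟨u, v, u₁, h⟩

/-- The vertices reachable from a given one define a compatible colouring. -/
lemma compatibleColoring_reachable [Finite ι] [Finite κ] (hKH : AdmissibleInput K H)
    (x : Cell ι κ × Plane) {χ : ∀ f, (K.polygon f).Idx → Bool}
    (hχ : ∀ f i, χ f i = true ↔
      (eulerSkeleton K H W).Reachable x (Cell.mesh f, (W f i).1)) :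
    CompatibleColoring K H χ := by
  have hend : ∀ {f : ι} {i : (K.polygon f).Idx} {u v : Plane}, (K.polygon f).IsSide i u v →
      ∃ u' v', IsCopy K H W (Cell.mesh f) u v u' v' ∧
        (χ f i = true ↔ (eulerSkeleton K H W).Reachable x (Cell.mesh f, v')) := by
    rintro f i u v (⟨rfl, rfl⟩ | ⟨rfl, rfl⟩)
    · have h := IsCopy.mesh (K := K) (H := H) (W := W) f i
      exact ⟨_, _, h, (hχ f i).trans ⟨fun k => k.trans (h.reachable_same hKH),
        fun k => k.trans (h.symm.reachable_same hKH)⟩⟩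
    · exact ⟨_, _, (IsCopy.mesh f i).symm, hχ f i⟩
  constructor
  · intro f g i j u v hi hj
    obtain ⟨a, b, h1, h2⟩ := hend hi
    obtain ⟨a', b', h1', h2'⟩ := hend hj
    rw [Bool.eq_iff_iff, h2, h2']
    exact ⟨fun k => k.trans (h1.reachable_opposite hKH h1'),
      fun k => k.trans (h1'.reachable_opposite hKH h1)⟩
  · intro c f g i j u u' v hc h h' hi hj
    obtain ⟨a, b, h1, h2⟩ := hend hi
    obtain ⟨a', b', h1', h2'⟩ := hend hj
    obtain ⟨p, q, k1⟩ := h.exists_isCopy (W := W)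
    obtain ⟨p', q', k1'⟩ := h'.exists_isCopy (W := W)
    -- Holes and the outside do not move their points, so both sides lead to the same copy of `v` in
    -- `c`, which serves as a bridge.
    obtain rfl := (k1.unmoved hc).2
    obtain rfl := (k1'.unmoved hc).2
    rw [Bool.eq_iff_iff, h2, h2']
    exact ⟨fun k => (k.trans (h1.reachable_opposite hKH k1)).trans
        (k1'.reachable_opposite hKH h1'),
      fun k => (k.trans (h1'.reachable_opposite hKH k1')).trans (k1.reachable_opposite hKH h1)⟩

theorem eulerSkeleton_reachable [Finite ι] [Finite κ] (hKH : AdmissibleInput K H)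
    {δ : ι → ℝ} (hδ : ∀ f, 0 < δ f) (hW : ∀ f, (K.polygon f).MiteredOffset (δ f) (W f))
    (hK : IsConnected K.support) {x y : Cell ι κ × Plane} (hx : x ∈ eulerVertices K H W)
    (hy : y ∈ eulerVertices K H W) : (eulerSkeleton K H W).Reachable x y := by
  classical
  -- One of the two cells at any side is a polygon of `K`, so every vertex is linked to an offset
  -- polygon.
  have hmesh : ∀ {z : Cell ι κ × Plane}, z ∈ eulerVertices K H W →
      ∃ f i, (eulerSkeleton K H W).Reachable (Cell.mesh f, (W f i).1) z := by
    intro z hz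
    obtain ⟨u, v, q, h⟩ := exists_isCopy_of_mem_eulerVertices hKH hz
    have key : ∀ {f a b}, IsCopy K H W (Cell.mesh f) u v a b →
        ∃ f i, (eulerSkeleton K H W).Reachable (Cell.mesh f, (W f i).1) z := by
      intro f a b k
      have k2 := k.reachable_opposite hKH h
      have k1 := k.reachable_same hKH
      obtain ⟨i, ⟨-, -, rfl, rfl⟩ | ⟨-, -, rfl, rfl⟩⟩ := isCopy_mesh_iff.1 k
      · exact ⟨f, i, k1.trans k2⟩
      · exact ⟨f, i, k2⟩
    obtain ⟨c, hc, h'⟩ := h.hasSide.exists_opposite hKH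
    rcases h.hasSide.exists_mesh hKH h' hc.symm with ⟨f, hf⟩ | ⟨f, rfl⟩
    · rw [hf] at h
      exact key h
    · obtain ⟨a, b, k⟩ := h'.exists_isCopy (W := W)
      exact key k
  obtain ⟨f, i, hfi⟩ := hmesh hx
  obtain ⟨g, j, hgj⟩ := hmesh hy
  let χ : ∀ f, (K.polygon f).Idx → Bool := fun f i =>
    decide ((eulerSkeleton K H W).Reachable x (Cell.mesh f, (W f i).1))
  have hχ : ∀ f i, χ f i = true ↔
      (eulerSkeleton K H W).Reachable x (Cell.mesh f, (W f i).1) := fun f i => decide_eq_true_iff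
  have hcol := compatibleColoring_reachable hKH x hχ
  have hcyc : ∀ f i j, (W f i).2 = (W f j).1 → χ f i = χ f j := by
    intro f i j hij
    have h := (IsCopy.mesh (K := K) (H := H) (W := W) f i)
    rw [Bool.eq_iff_iff, hχ, hχ, ← hij]
    exact ⟨fun k => k.trans (h.reachable_same hKH), fun k => k.trans (h.symm.reachable_same hKH)⟩
  have hconst := hcol.constant hKH hδ hW hcyc
  have hγ : CompatibleColoring K H fun f _ => χ f 0 := by
    have : (fun f (_ : (K.polygon f).Idx) => χ f 0) = χ := by
      funext f i; exact hconst f 0 i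
    rw [this]; exact hcol
  have heq := hγ.eq_of_isConnected hKH hK f g
  have h1 : χ f i = true := (hχ f i).2 hfi.symm
  rw [hconst f 0 i, h1, hconst g 0 j] at heq
  exact ((hχ g j).1 heq.symm).trans hgj

end Euler

theorem mainTheorem9 {ι κ : Type*} [Finite ι] [Finite κ]
    (K : PolygonalComplex ι) (H : κ → Polygon2) (hKH : AdmissibleInput K H)
    (δ : ι → ℝ) (hδ : ∀ f, 0 < δ f)
    (W : ∀ f, (K.polygon f).Wavefront)
    (hW : ∀ f, (K.polygon f).MiteredOffset (δ f) (W f)) :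
    (∀ x ∈ eulerVertices K H W,
      ((eulerSkeleton K H W).neighborSet x).Finite ∧
      Even ((eulerSkeleton K H W).neighborSet x).ncard) ∧
    (IsConnected K.support →
      ((eulerSkeleton K H W).induce (eulerVertices K H W)).Connected) := by
  refine ⟨fun x _ => eulerSkeleton_degree hKH (fun f => (hW f).proper) x, fun hK => ?_⟩
  have hadj : ∀ {x y}, (eulerSkeleton K H W).Adj x y → x ∈ eulerVertices K H W := by
    intro x y h
    exact ⟨s(x, y), ((SimpleGraph.fromEdgeSet_adj _).1 h).1, Sym2.mem_mk_left x y⟩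
  -- Walks never leave the set of vertices, since every end of an edge belongs to it.
  have hlift : ∀ {x y} (p : (eulerSkeleton K H W).Walk x y) (hx : x ∈ eulerVertices K H W)
      (hy : y ∈ eulerVertices K H W),
      ((eulerSkeleton K H W).induce (eulerVertices K H W)).Reachable ⟨x, hx⟩ ⟨y, hy⟩ := by
    intro x y p
    induction p with
    | nil => exact fun _ _ => SimpleGraph.Reachable.refl _
    | @cons a b c h p ih =>
      intro hx hy
      have hab : ((eulerSkeleton K H W).induce (eulerVertices K H W)).Adj ⟨a, hx⟩
          ⟨b, hadj h.symm⟩ := h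
      exact hab.reachable.trans (ih _ hy)
  obtain ⟨p, hp⟩ := hK.nonempty
  obtain ⟨f, -⟩ := mem_iUnion.1 hp
  have hcopy := IsCopy.mesh (K := K) (H := H) (W := W) f 0
  have hv : (Cell.mesh f, (W f 0).1) ∈ eulerVertices K H W :=
    ⟨s((Cell.mesh f, (W f 0).1), (Cell.mesh f, (W f 0).2)),
      (mem_eulerEdges_iff hKH).2 (Or.inl ⟨rfl, _, _, hcopy.symm⟩), Sym2.mem_mk_left _ _⟩
  have : Nonempty (eulerVertices K H W) := ⟨⟨_, hv⟩⟩
  refine SimpleGraph.Connected.mk fun x y => ?_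
  obtain ⟨p⟩ := eulerSkeleton_reachable hKH hδ hW hK x.2 y.2
  exact hlift p x.2 y.2
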